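/- **Theorem.** For two disjoint finite sets $P$ (of $n$ points) and $R$ (of $m$ roots) in the closed first quadrant of $\mathbb{R}^2$ with $(0,0)\in R$, a *rectilinear Steiner forest arborescence* (RSFA) for $P$ with the root set $R$ is an acyclic finite plane graph $F$ whose edges are horizontal or vertical segments meeting only in common endpoints, whose vertex set contains $P\cup R$, and each of whose connected components contains some $r\in R$ such that for every $p\in P$ in this component the path in $F$ from $r$ to $p$ has length $({\rm x}(p)-{\rm x}(r))+({\rm y}(p)-{\rm y}(r))$. It is *optimal* if the total length of its edges is minimum. Let $h$ be the minimum number of horizontal lines that contain all of $P\cup R$. The model is the real RAM (exact arithmetic $+,-,\cdot,/$ and comparisons on reals at unit cost, integers of $O(\log(n+m)+h)$ bits in (a), a read-only input and a write-only output not counted as space); the input is the list of the points of $P\cup R$, each marked as a point or a root, and the output is the list of edges of an RSFA. (a) There is an algorithm that, if the input is given in lexicographic order (by ${\rm x}$, then by ${\rm y}$), computes an optimal RSFA for $P$ with the root set $R$ in $O((n+m)\,h\,2^h)$ time and $O(2^h)$ space. (b) There is an algorithm that, for an input in arbitrary order, computes an optimal RSFA for $P$ with the root set $R$ in time $2^h\cdot(n+m)^{O(1)}$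 (with memory and integer values bounded by the same expression); in particular, the problem is fixed-parameter tractable with respect to $h$. -/

import Mathlib

/-! ### Rectilinear graphs and rectilinear Steiner forest arborescences -/

/-- Points of the plane; `p.1` and `p.2` are the x- and the y-coordinate. -/
abbrev Pt : Type := ℝ × ℝ

/-- The `L₁`-length of the segment that joins the two endpoints of an edge (for a horizontal or
vertical segment this is its usual length). -/
noncomputable def edgeLength : Sym2 Pt → ℝ :=
  Sym2.lift ⟨fun p q => |p.1 - q.1| + |p.2 - q.2|, fun p q => by
    beta_reduce
    rw [abs_sub_comm p.1 q.1, abs_sub_comm p.2 q.2]⟩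

/-- A finite rectilinear graph: a plane graph whose edges are nondegenerate horizontal or vertical
segments joining two vertices.  Two different edges meet at most in a common endpoint, and a vertex
lies on an edge only as one of its endpoints. -/
structure RectilinearGraph where
  verts : Finset Pt
  edges : Finset (Sym2 Pt)
  endpoints_mem : ∀ p q, s(p, q) ∈ edges → p ∈ verts ∧ q ∈ verts
  ne_of_edge : ∀ p q, s(p, q) ∈ edges → p ≠ q
  axis_parallel : ∀ p q, s(p, q) ∈ edges → p.1 = q.1 ∨ p.2 = q.2
  edges_meet : ∀ p q p' q', s(p, q) ∈ edges → s(p', q') ∈ edges → s(p, q) ≠ s(p', q') →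
    ∀ z, z ∈ segment ℝ p q → z ∈ segment ℝ p' q' → (z = p ∨ z = q) ∧ (z = p' ∨ z = q')
  vertex_on_edge : ∀ p q, s(p, q) ∈ edges → ∀ z ∈ verts, z ∈ segment ℝ p q → z = p ∨ z = q

namespace RectilinearGraph

/-- The underlying combinatorial graph (points outside `verts` are isolated in it). -/
def graph (F : RectilinearGraph) : SimpleGraph Pt :=
  SimpleGraph.fromEdgeSet (F.edges : Set (Sym2 Pt))

/-- The weight `l(F)`: the sum of the lengths of all edges. -/
noncomputable def weight (F : RectilinearGraph) : ℝ := ∑ e ∈ F.edges, edgeLength e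

/-- The length of a walk in a rectilinear graph. -/
noncomputable def walkLength (F : RectilinearGraph) {p q : Pt} (w : F.graph.Walk p q) : ℝ :=
  (w.edges.map edgeLength).sum

end RectilinearGraph

/-- The instances of the problem: two disjoint finite sets of points and of roots in the (closed)
first quadrant such that the origin is a root. -/
structure IsInstance (P R : Finset Pt) : Prop where
  disjoint : Disjoint P R
  origin_mem : ((0, 0) : Pt) ∈ R
  quadrant : ∀ p ∈ P ∪ R, 0 ≤ p.1 ∧ 0 ≤ p.2

/-- `F` is a rectilinear Steiner forest arborescence for the points `P` with the root set `R`: a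
rectilinear forest that spans `P ∪ R` such that each of its connected components (the component of
`v`, for each vertex `v`) is a rectilinear Steiner arborescence rooted at some `r ∈ R`, i.e. it
contains `r`, and the path in it from `r` to each of its points `p ∈ P` has length
`(x(p) - x(r)) + (y(p) - y(r))`. -/
structure IsRSFA (P R : Finset Pt) (F : RectilinearGraph) : Prop where
  acyclic : F.graph.IsAcyclic
  spanning : P ∪ R ⊆ F.verts
  rooted : ∀ v ∈ F.verts, ∃ r ∈ R, F.graph.Reachable r v ∧
    ∀ p ∈ P, F.graph.Reachable r p →
      ∃ w : F.graph.Walk r p, w.IsPath ∧ F.walkLength w = (p.1 - r.1) + (p.2 - r.2)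

/-- `F` is an optimal, i.e. minimum-weight, rectilinear Steiner forest arborescence. -/
def IsOptimalRSFA (P R : Finset Pt) (F : RectilinearGraph) : Prop :=
  IsRSFA P R F ∧ ∀ F' : RectilinearGraph, IsRSFA P R F' → F.weight ≤ F'.weight

/-- The number of horizontal lines needed to contain all points and roots. -/
noncomputable def numHorizontalLines (P R : Finset Pt) : ℕ := ((P ∪ R).image Prod.snd).card

/-! ### The real RAM

A program has finitely many integer and real registers, an integer memory and a real memory
with indirect addressing, a read-only input (the list of all points, each with a flag telling
whether it is a root) and a write-only output (a list of segments).  It computes exactly with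
reals through `+`, `-`, `*`, `/` and comparisons; there is no rounding and no conversion of reals
to integers. -/

/-- Integer expressions over the integer registers. -/
inductive IExpr : Type
  | const (k : ℕ)
  | reg (x : ℕ)
  | add (a b : IExpr)
  | sub (a b : IExpr)
  | mul (a b : IExpr)
  | div (a b : IExpr)
  | mod (a b : IExpr)

/-- Real expressions over the real registers. -/
inductive RExpr : Type
  | const (q : ℚ)
  | reg (x : ℕ)
  | add (a b : RExpr)
  | sub (a b : RExpr)
  | mul (a b : RExpr)
  | div (a b : RExpr)

/-- Tests. -/
inductive BExpr : Type
  | ile (a b : IExpr)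
  | rle (a b : RExpr)
  | not (b : BExpr)
  | and (b c : BExpr)

/-- Programs. -/
inductive Prog : Type
  | skip
  /-- integer register `x := e` -/
  | iset (x : ℕ) (e : IExpr)
  /-- real register `x := e` -/
  | rset (x : ℕ) (e : RExpr)
  /-- integer register `x :=` integer memory cell at address `a` -/
  | iload (x : ℕ) (a : IExpr)
  /-- integer memory cell at address `a := e` -/
  | istore (a : IExpr) (e : IExpr)
  /-- real register `x :=` real memory cell at address `a` -/
  | rload (x : ℕ) (a : IExpr)
  /-- real memory cell at address `a := e` -/
  | rstore (a : IExpr) (e : RExpr)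
  /-- integer register `x :=` number of input points -/
  | inputLength (x : ℕ)
  /-- real register `x :=` x-coordinate of the `i`-th input point -/
  | inputX (x : ℕ) (i : IExpr)
  /-- real register `x :=` y-coordinate of the `i`-th input point -/
  | inputY (x : ℕ) (i : IExpr)
  /-- integer register `x := 1` if the `i`-th input point is a root, and `x := 0` otherwise -/
  | inputRoot (x : ℕ) (i : IExpr)
  /-- output the segment with the endpoints `(a, b)` and `(c, d)` -/
  | emit (a b c d : RExpr)
  | seq (c₁ c₂ : Prog)
  | ite (b : BExpr) (c₁ c₂ : Prog)
  | while (b : BExpr) (c : Prog)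

/-- The configuration of the machine during a computation. -/
structure Store where
  ireg : ℕ → ℕ
  rreg : ℕ → ℝ
  imem : ℕ → ℕ
  rmem : ℕ → ℝ
  /-- the segments that have been output, the latest first -/
  out : List (Pt × Pt)

/-- The initial configuration. -/
def Store.init : Store := ⟨fun _ => 0, fun _ => 0, fun _ => 0, fun _ => 0, []⟩

def IExpr.eval (s : Store) : IExpr → ℕ
  | .const k => k
  | .reg x => s.ireg x
  | .add a b => a.eval s + b.eval s
  | .sub a b => a.eval s - b.eval s
  | .mul a b => a.eval s * b.eval s
  | .div a b => a.eval s / b.eval s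
  | .mod a b => a.eval s % b.eval s

noncomputable def RExpr.eval (s : Store) : RExpr → ℝ
  | .const q => (q : ℝ)
  | .reg x => s.rreg x
  | .add a b => a.eval s + b.eval s
  | .sub a b => a.eval s - b.eval s
  | .mul a b => a.eval s * b.eval s
  | .div a b => a.eval s / b.eval s

def BExpr.Holds (s : Store) : BExpr → Prop
  | .ile a b => a.eval s ≤ b.eval s
  | .rle a b => a.eval s ≤ b.eval s
  | .not b => ¬ b.Holds s
  | .and b c => b.Holds s ∧ c.Holds s

/-- `Exec inp cap word c s t s'`: on the input `inp`, the program `c` started in `s` halts in `s'`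
after `t` steps, has only used the memory cells at the addresses `0, …, cap - 1` (of each of the two
memories), and has only stored integers of value at most `word`.  There is no rule for an access
outside these limits or outside the input: it makes the program fail.  Each assignment, load, store,
input or output command and each test is one step (the expressions in a program have a fixed
size). -/
inductive Exec (inp : List (Pt × Bool)) (cap word : ℕ) : Prog → Store → ℕ → Store → Prop
  | skip (s) : Exec inp cap word .skip s 1 s
  | iset (s x e) (h : e.eval s ≤ word) :
      Exec inp cap word (.iset x e) s 1
        { s with ireg := Function.update s.ireg x (e.eval s) }
  | rset (s x e) :
      Exec inp cap word (.rset x e) s 1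
        { s with rreg := Function.update s.rreg x (e.eval s) }
  | iload (s x a) (h : a.eval s < cap) :
      Exec inp cap word (.iload x a) s 1
        { s with ireg := Function.update s.ireg x (s.imem (a.eval s)) }
  | istore (s a e) (h : a.eval s < cap) (he : e.eval s ≤ word) :
      Exec inp cap word (.istore a e) s 1
        { s with imem := Function.update s.imem (a.eval s) (e.eval s) }
  | rload (s x a) (h : a.eval s < cap) :
      Exec inp cap word (.rload x a) s 1
        { s with rreg := Function.update s.rreg x (s.rmem (a.eval s)) }
  | rstore (s a e) (h : a.eval s < cap) :
      Exec inp cap word (.rstore a e) s 1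
        { s with rmem := Function.update s.rmem (a.eval s) (e.eval s) }
  | inputLength (s x) (h : inp.length ≤ word) :
      Exec inp cap word (.inputLength x) s 1
        { s with ireg := Function.update s.ireg x inp.length }
  | inputX (s x i) (h : i.eval s < inp.length) :
      Exec inp cap word (.inputX x i) s 1
        { s with rreg := Function.update s.rreg x (inp[i.eval s]'h).1.1 }
  | inputY (s x i) (h : i.eval s < inp.length) :
      Exec inp cap word (.inputY x i) s 1
        { s with rreg := Function.update s.rreg x (inp[i.eval s]'h).1.2 }
  | inputRoot (s x i) (h : i.eval s < inp.length) (hw : 1 ≤ word) :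
      Exec inp cap word (.inputRoot x i) s 1
        { s with ireg := Function.update s.ireg x (inp[i.eval s]'h).2.toNat }
  | emit (s a b c d) :
      Exec inp cap word (.emit a b c d) s 1
        { s with out := ((a.eval s, b.eval s), (c.eval s, d.eval s)) :: s.out }
  | seq {c₁ c₂ s t₁ s' t₂ s''} (h₁ : Exec inp cap word c₁ s t₁ s')
      (h₂ : Exec inp cap word c₂ s' t₂ s'') :
      Exec inp cap word (.seq c₁ c₂) s (t₁ + t₂) s''
  | ite_true {b c₁ c₂ s t s'} (hb : b.Holds s) (h : Exec inp cap word c₁ s t s') :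
      Exec inp cap word (.ite b c₁ c₂) s (t + 1) s'
  | ite_false {b c₁ c₂ s t s'} (hb : ¬ b.Holds s) (h : Exec inp cap word c₂ s t s') :
      Exec inp cap word (.ite b c₁ c₂) s (t + 1) s'
  | while_true {b c s t₁ s' t₂ s''} (hb : b.Holds s) (h₁ : Exec inp cap word c s t₁ s')
      (h₂ : Exec inp cap word (.while b c) s' t₂ s'') :
      Exec inp cap word (.while b c) s (t₁ + t₂ + 1) s''
  | while_false {b c s} (hb : ¬ b.Holds s) :
      Exec inp cap word (.while b c) s 1 s

/-! ### Solving the problem on the real RAM -/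

/-- The list `inp` presents the instance `(P, R)`: it lists every point of `P ∪ R` exactly once,
with the flag `true` for the roots and `false` for the points of `P`. -/
def Presents (inp : List (Pt × Bool)) (P R : Finset Pt) : Prop :=
  inp.Nodup ∧ ∀ q : Pt, ((q, false) ∈ inp ↔ q ∈ P) ∧ ((q, true) ∈ inp ↔ q ∈ R)

/-- The input points are listed in lexicographic order (by x-coordinate, then by y-coordinate). -/
def LexSorted (inp : List (Pt × Bool)) : Prop :=
  inp.Pairwise fun a b => a.1.1 < b.1.1 ∨ (a.1.1 = b.1.1 ∧ a.1.2 < b.1.2)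

/-- The list `out` lists the edges of `F`, each of them once and in one of its two directions.  (For
an RSFA `F` with the root set `R` this determines `F`, as its vertices are the points of `R` and the
endpoints of its edges.) -/
def ListsEdges (out : List (Pt × Pt)) (F : RectilinearGraph) : Prop :=
  (out.map fun e => s(e.1, e.2)).Nodup ∧ ∀ e, e ∈ F.edges ↔ e ∈ out.map fun e => s(e.1, e.2)

/-- On the input `inp` the program `c` halts after at most `time` steps, within the limits `cap` on
the number of memory cells and `word` on the integers, and outputs the edges of an optimal RSFA for
`P` with the root set `R`. -/
def ComputesRSFA (c : Prog) (inp : List (Pt × Bool)) (P R : Finset Pt) (time cap word : ℕ) : Prop :=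
  ∃ (t : ℕ) (s : Store) (F : RectilinearGraph),
    Exec inp cap word c Store.init t s ∧ t ≤ time ∧ ListsEdges s.out F ∧ IsOptimalRSFA P R F

/-! The optimal forest is computed by a sweep over the grid that the vertical and horizontal lines
through the terminals span.

*Reduction to the grid.* Let `Z` be the set of the x-coordinates of the terminals. Between two
neighbours in `Z`, a threshold decides which coordinates are rounded down and which are rounded up, and
the average over all thresholds of the total length of the rounded edges is at most the original one; so
some monotone rounding to `Z` does not increase the weight of a forest (`exists_rounding`). The same
holds for the y-coordinates. The edges of a rounded forest run along the lines of the grid, and each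
point is still reached from a root by a path that only goes right and up, because a path whose length is
the coordinate difference of its ends is monotone (`RectilinearGraph.of_walkLength_eq`).

*States.* The sweep visits the grid nodes column by column, each column from bottom to top, and a column
with several terminals is repeated once for each of them. At a node it decides between no edge, the edge
to the left and the edge downwards. Of the past it has to know only the set of the rows whose node visited
last is connected to a root, which is one of `2 ^ h` sets. A run that greedily buys every useful edge
covered by a rounded forest connects all points and is not longer than this forest
(`Sweep.exists_isStateRun_cost_le`). Conversely, the edges bought by a legal run form a forest
arborescence whose weight is the cost of the run (`Sweep.IsStateRun.exists_forest`), since each node has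
at most one parent, which lies to the left or below.

*Little space.* Storing all decisions of the dynamic program would need space for each node. Instead,
the program runs backwards over the nodes and keeps, for each state, the optimal cost of the rest of the
sweep and the decisions that attain it, coded as the base-three digits of one real number in `[0, 1)`;
the next digit is read off by a multiplication by three and comparisons. A node only relates the two
states that differ in its row, so the tables are updated in place, pair by pair, and `O(2 ^ h)` cells
suffice (`Sweep.exists_optimal_decisions`, `runs_backward`). A forward pass decodes the decisions and
outputs the edges (`runs_forward`).

*Access to the input.* The program `sweepProg` asks for the terminals by their lexicographic index
(`Fetches`). A sorted input answers in constant time; otherwise the terminal with the given rank is found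
by counting, which takes polynomial time. -/

/-! ### Rounding to a finite set of reals -/

/-- Averaging over the thresholds `t ∈ (M, z]`: some `t` is crossed by at most as many of the
intervals `(a e, b e]` as the average threshold. -/
lemma exists_threshold {ι : Type*} (s : Finset ι) (a b : ι → ℝ) (hab : ∀ e ∈ s, a e ≤ b e)
    {M z : ℝ} (hMz : M < z) :
    ∃ t, M < t ∧ t ≤ z ∧ ∑ e ∈ s, (if a e < t ∧ t ≤ b e then z - M else 0) ≤
      ∑ e ∈ s, (min (max (b e) M) z - min (max (a e) M) z) := by
  classical
  let f : ℝ → ℝ := fun t => ∑ e ∈ s, (Set.Ioc (a e) (b e)).indicator (fun _ => (1 : ℝ)) t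
  have hvol : MeasureTheory.volume (Set.Ioc M z) ≠ 0 := by
    simp [Real.volume_Ioc, hMz]
  have hvol' : MeasureTheory.volume (Set.Ioc M z) ≠ ⊤ := by simp [Real.volume_Ioc]
  have hint : ∀ e ∈ s, MeasureTheory.IntegrableOn
      ((Set.Ioc (a e) (b e)).indicator (fun _ => (1 : ℝ))) (Set.Ioc M z) := by
    intro e _
    refine (MeasureTheory.integrableOn_const hvol').indicator measurableSet_Ioc
  have hf : MeasureTheory.IntegrableOn f (Set.Ioc M z) := MeasureTheory.integrable_finsetSum _ hint
  obtain ⟨t, ht, hle⟩ := MeasureTheory.exists_le_setAverage hvol hvol' hf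
  refine ⟨t, ht.1, ht.2, ?_⟩
  have hI : ∫ x in Set.Ioc M z, f x = ∑ e ∈ s, (min (max (b e) M) z - min (max (a e) M) z) := by
    rw [MeasureTheory.integral_finsetSum _ hint]
    refine Finset.sum_congr rfl fun e he => ?_
    rw [MeasureTheory.integral_indicator measurableSet_Ioc,
      MeasureTheory.Measure.restrict_restrict measurableSet_Ioc, Set.Ioc_inter_Ioc]
    have h := hab e he
    simp only [MeasureTheory.integral_const, MeasureTheory.measureReal_restrict_apply_univ,
      Real.volume_real_Ioc, smul_eq_mul, mul_one]
    simp only [max_def, min_def]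
    split_ifs <;> linarith
  rw [MeasureTheory.setAverage_eq, hI, Real.volume_real_Ioc_of_le hMz.le, smul_eq_mul] at hle
  have hpos : 0 < z - M := by linarith
  have h2 := mul_le_mul_of_nonneg_left hle hpos.le
  rw [mul_inv_cancel_left₀ hpos.ne'] at h2
  refine le_trans (le_of_eq ?_) h2
  simp only [f, Finset.mul_sum, Set.indicator_apply, Set.mem_Ioc, mul_ite, mul_one, mul_zero]

/-- The set `Z` grows by a new maximum `M`: the previous rounding is kept below a threshold between the
previous maximum and `M`, and everything above it is rounded to `M`. The bound truncates the intervals at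
`M`, since their parts above `M` are not charged by the steps before. -/
lemma exists_rounding_aux {ι : Type*} (s : Finset ι) (a b : ι → ℝ) (hab : ∀ e ∈ s, a e ≤ b e)
    (Z : Finset ℝ) : ∀ M ∈ Z, (∀ x ∈ Z, x ≤ M) →
    ∃ φ : ℝ → ℝ, Monotone φ ∧ (∀ x, φ x ∈ Z) ∧ (∀ z ∈ Z, φ z = z) ∧
      ∑ e ∈ s, (φ (b e) - φ (a e)) ≤ ∑ e ∈ s, (min (b e) M - min (a e) M) := by
  classical
  induction Z using Finset.induction_on_max with
  | empty => intro M hM; simp at hM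
  | insert z Z hz ih =>
    intro M hM hmax
    have hMz : M = z := by
      rcases Finset.mem_insert.1 hM with h | h
      · exact h
      · exact absurd (hmax z (Finset.mem_insert_self _ _)) (not_le.2 (hz M h))
    subst hMz
    rcases Z.eq_empty_or_nonempty with rfl | hne
    · refine ⟨fun _ => M, monotone_const, by simp, by simp, ?_⟩
      refine Finset.sum_le_sum fun e he => ?_
      have := min_le_min_right M (hab e he)
      simp only [sub_self]; linarith
    · obtain ⟨φ, hmono, hmem, hfix, hsum⟩ := ih (Z.max' hne) (Z.max'_mem hne)
        fun x hx => Z.le_max' x hx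
      set m := Z.max' hne with hm
      have hmM : m < M := hz m (Z.max'_mem hne)
      have hφm : ∀ x, m ≤ x → φ x = m := fun x hx =>
        le_antisymm (Z.le_max' _ (hmem x)) (by rw [← hfix m (Z.max'_mem hne)]; exact hmono hx)
      obtain ⟨t, ht1, ht2, ht⟩ := exists_threshold s a b hab hmM
      refine ⟨fun x => if x < t then φ x else M, ?_, ?_, ?_, ?_⟩
      · intro x y hxy
        dsimp only
        split_ifs with h1 h2
        · exact hmono hxy
        · exact (hz _ (hmem x)).le
        · linarith
        · exact le_rfl
      · intro x
        dsimp only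
        split_ifs
        · exact Finset.mem_insert_of_mem (hmem x)
        · exact Finset.mem_insert_self _ _
      · intro x hx
        dsimp only
        rcases Finset.mem_insert.1 hx with rfl | hx
        · simp [not_lt.2 ht2]
        · rw [if_pos (lt_of_le_of_lt (Z.le_max' _ hx) ht1), hfix x hx]
      · have key : ∀ e ∈ s, ((if b e < t then φ (b e) else M) - (if a e < t then φ (a e) else M)) =
            (φ (b e) - φ (a e)) + (if a e < t ∧ t ≤ b e then M - m else 0) := by
          intro e he
          have h := hab e he
          by_cases h1 : b e < t
          · have h2 : a e < t := lt_of_le_of_lt h h1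
            simp [h1, h2, not_le.2 h1]
          · have h1' := not_lt.1 h1
            rw [hφm (b e) (by linarith)]
            by_cases h2 : a e < t
            · simp [h1, h2, h1']
            · rw [hφm (a e) (by linarith)]
              simp [h1, h2]
        rw [Finset.sum_congr rfl key, Finset.sum_add_distrib]
        refine (add_le_add hsum ht).trans (le_of_eq ?_)
        rw [← Finset.sum_add_distrib]
        refine Finset.sum_congr rfl fun e _ => ?_
        -- the truncations at `m` and to `[m, M]` add up to the truncation at `M`
        have aux : ∀ x : ℝ, min x m + min (max x m) M = min x M + m := by
          intro x
          rcases le_total x m with h1 | h1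
          · rw [min_eq_left h1, max_eq_right h1, min_eq_left hmM.le, min_eq_left (h1.trans hmM.le)]
          · rw [min_eq_right h1, max_eq_left h1]; ring
        linarith [aux (b e), aux (a e)]

/-- Intervals can be rounded to a finite set `Z` by a monotone map that fixes `Z`, without
increasing their total length. -/
lemma exists_rounding {ι : Type*} (s : Finset ι) (a b : ι → ℝ) (hab : ∀ e ∈ s, a e ≤ b e)
    {Z : Finset ℝ} (hZ : Z.Nonempty) :
    ∃ φ : ℝ → ℝ, Monotone φ ∧ (∀ x, φ x ∈ Z) ∧ (∀ z ∈ Z, φ z = z) ∧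
      ∑ e ∈ s, (φ (b e) - φ (a e)) ≤ ∑ e ∈ s, (b e - a e) := by
  obtain ⟨φ, h1, h2, h3, h4⟩ := exists_rounding_aux s a b hab Z (Z.max' hZ) (Z.max'_mem hZ)
    fun x hx => Z.le_max' x hx
  refine ⟨φ, h1, h2, h3, h4.trans (Finset.sum_le_sum fun e he => ?_)⟩
  have h := hab e he
  rcases le_total (b e) (Z.max' hZ) with h5 | h5 <;> rcases le_total (a e) (Z.max' hZ) with h6 | h6 <;>
    simp only [h5, h6, min_eq_left, min_eq_right] <;> linarith

/-! ### Extents of edges and monotone walks -/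

/-- The smaller value of the coordinate `f` at the endpoints of an edge. -/
noncomputable def edgeLo (f : Pt → ℝ) : Sym2 Pt → ℝ :=
  Sym2.lift ⟨fun p q => min (f p) (f q), fun _ _ => min_comm _ _⟩

/-- The larger value of the coordinate `f` at the endpoints of an edge. -/
noncomputable def edgeHi (f : Pt → ℝ) : Sym2 Pt → ℝ :=
  Sym2.lift ⟨fun p q => max (f p) (f q), fun _ _ => max_comm _ _⟩

lemma edgeLo_mk (f : Pt → ℝ) (p q : Pt) : edgeLo f s(p, q) = min (f p) (f q) := rfl

lemma edgeHi_mk (f : Pt → ℝ) (p q : Pt) : edgeHi f s(p, q) = max (f p) (f q) := rfl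

lemma edgeLength_mk (p q : Pt) : edgeLength s(p, q) = |p.1 - q.1| + |p.2 - q.2| := rfl

lemma edgeLo_le_edgeHi (f : Pt → ℝ) (e : Sym2 Pt) : edgeLo f e ≤ edgeHi f e := by
  induction e with
  | _ p q => exact min_le_max

lemma edgeLength_eq_extents (e : Sym2 Pt) :
    edgeLength e =
      (edgeHi Prod.fst e - edgeLo Prod.fst e) + (edgeHi Prod.snd e - edgeLo Prod.snd e) := by
  induction e with
  | _ p q => rw [edgeLength_mk, edgeLo_mk, edgeLo_mk, edgeHi_mk, edgeHi_mk, max_sub_min_eq_abs',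
      max_sub_min_eq_abs']

namespace RectilinearGraph

variable {F : RectilinearGraph}

lemma adj_iff {p q : Pt} : F.graph.Adj p q ↔ s(p, q) ∈ F.edges ∧ p ≠ q := by
  simp [graph, SimpleGraph.fromEdgeSet_adj]

lemma walkLength_nil {p : Pt} : F.walkLength (SimpleGraph.Walk.nil : F.graph.Walk p p) = 0 := by
  simp [walkLength]

lemma walkLength_cons {p q r : Pt} (h : F.graph.Adj p q) (w : F.graph.Walk q r) :
    F.walkLength (w.cons h) = edgeLength s(p, q) + F.walkLength w := by
  simp [walkLength]

lemma walkLength_concat {p q r : Pt} (w : F.graph.Walk p q) (h : F.graph.Adj q r) :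
    F.walkLength (w.concat h) = F.walkLength w + edgeLength s(q, r) := by
  simp [walkLength, SimpleGraph.Walk.edges_concat]

lemma sub_le_walkLength {u v : Pt} (w : F.graph.Walk u v) :
    (v.1 - u.1) + (v.2 - u.2) ≤ F.walkLength w := by
  induction w with
  | nil => simp [walkLength_nil]
  | @cons a b c h w ih =>
    rw [walkLength_cons, edgeLength_mk]
    linarith [neg_abs_le (a.1 - b.1), neg_abs_le (a.2 - b.2)]

/-- A walk whose length is the coordinate difference of its ends only goes right and up, so a
property that is preserved by such steps holds at its end if it holds at its start. -/
lemma of_walkLength_eq {Q : Pt → Prop}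
    (step : ∀ p q, s(p, q) ∈ F.edges → p.1 ≤ q.1 → p.2 ≤ q.2 → Q p → Q q)
    {u v : Pt} (w : F.graph.Walk u v) (hw : F.walkLength w = (v.1 - u.1) + (v.2 - u.2))
    (hu : Q u) : Q v := by
  induction w with
  | nil => exact hu
  | @cons a b c h w ih =>
    rw [walkLength_cons, edgeLength_mk] at hw
    have h1 := sub_le_walkLength w
    have h2 := neg_abs_le (a.1 - b.1)
    have h3 := neg_abs_le (a.2 - b.2)
    have h4 := abs_nonneg (a.1 - b.1)
    have h5 := abs_nonneg (a.2 - b.2)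
    exact ih (by linarith) (step a b (adj_iff.1 h).1 (by linarith) (by linarith) hu)

end RectilinearGraph

/-! ### The sweep and its states -/

/-- The data of a left-to-right sweep: the `i`-th terminal, for `i < N`, is `(X i, Z i)`, and it is
a root if `isRoot i`; the `h` horizontal lines have the heights `Y 0, …, Y (h - 1)`.  The sweep
visits the nodes `t = i * h + j`, where `i < N` and `j < h`, in increasing order; the node `t` is the
point `(X i, Y j)`.  Several terminals in one column give several copies of that column. -/
structure Sweep where
  N : ℕ
  h : ℕ
  X : ℕ → ℝ
  Z : ℕ → ℝ
  isRoot : ℕ → Bool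
  Y : ℕ → ℝ

namespace Sweep

/-- The sweep `D` belongs to the instance `(P, R)`: the terminals are in lexicographic order, and
the lines are exactly the horizontal lines through terminals, from bottom to top. -/
structure Valid (D : Sweep) (P R : Finset Pt) : Prop where
  lex : ∀ i i', i < i' → i' < D.N → D.X i < D.X i' ∨ (D.X i = D.X i' ∧ D.Z i < D.Z i')
  Y_lt : ∀ j j', j < j' → j' < D.h → D.Y j < D.Y j'
  row : ∀ i < D.N, ∃ j < D.h, D.Y j = D.Z i
  row_used : ∀ j < D.h, ∃ i < D.N, D.Z i = D.Y j
  mem_P : ∀ q, q ∈ P ↔ ∃ i < D.N, D.isRoot i = false ∧ (D.X i, D.Z i) = q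
  mem_R : ∀ q, q ∈ R ↔ ∃ i < D.N, D.isRoot i = true ∧ (D.X i, D.Z i) = q

variable (D : Sweep)

/-- The position of the node `t`. -/
def pt (t : ℕ) : Pt := (D.X (t / D.h), D.Y (t % D.h))

/-- The distance from the node `t` to the previous copy of a column; it is zero between copies of
the same column and, by truncated subtraction, in the first one. -/
noncomputable def dx (t : ℕ) : ℝ := D.X (t / D.h) - D.X (t / D.h - 1)

/-- The distance from the node `t` to the line below it (zero on the lowest line). -/
noncomputable def dy (t : ℕ) : ℝ := D.Y (t % D.h) - D.Y (t % D.h - 1)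

/-- The terminal that belongs to the current copy of the column is a root at the node `t`. -/
def RootAt (t : ℕ) : Prop := D.isRoot (t / D.h) = true ∧ D.Y (t % D.h) = D.Z (t / D.h)

/-- The terminal that belongs to the current copy of the column is a point at the node `t`. -/
def PointAt (t : ℕ) : Prop := D.isRoot (t / D.h) = false ∧ D.Y (t % D.h) = D.Z (t / D.h)

/-- The node `t` is connected without a new edge: it is a root, or it is a further copy of a
connected node; `l` says that the node to the left is connected. -/
def Free (t : ℕ) (l : Prop) : Prop := D.RootAt t ∨ (D.dx t = 0 ∧ l)

/-- The decision `d` is allowed at the node `t` (`0`: no edge, `1`: an edge to the left, `2`: an edge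
downwards), where `l` and `b` say that the node to the left and below are connected. -/
def Legal (t : ℕ) (l b : Prop) (d : ℕ) : Prop :=
  (d = 0 ∧ (D.PointAt t → D.Free t l)) ∨ (d = 1 ∧ l ∧ ¬ D.Free t l) ∨ (d = 2 ∧ b ∧ ¬ D.Free t l)

/-- The length of the edge chosen by the decision `d` at the node `t`. -/
noncomputable def cost (t d : ℕ) : ℝ := if d = 1 then D.dx t else if d = 2 then D.dy t else 0

end Sweep

/-- The set coded by `S` with the element `j` added. -/
def setBit (S j : ℕ) : ℕ := if S.testBit j then S else S + 2 ^ j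

/-- The set coded by `S` with the element `j` removed. -/
def clearBit (S j : ℕ) : ℕ := if S.testBit j then S - 2 ^ j else S

lemma testBit_add_two_pow {S j : ℕ} (hS : S.testBit j = false) (k : ℕ) :
    (S + 2 ^ j).testBit k = (decide (k = j) || S.testBit k) := by
  rw [← Nat.mod_add_div S (2 ^ j)]
  have hdiv : (S / 2 ^ j) % 2 = 0 := by
    rw [Nat.testBit_eq_decide_div_mod_eq] at hS
    have := Nat.mod_two_eq_zero_or_one (S / 2 ^ j)
    simp at hS; omega
  obtain ⟨m, hm⟩ : ∃ m, S / 2 ^ j = 2 * m := ⟨S / 2 ^ j / 2, by omega⟩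
  have hlt : S % 2 ^ j < 2 ^ j := Nat.mod_lt _ (by positivity)
  rw [hm, show S % 2 ^ j + 2 ^ j * (2 * m) + 2 ^ j = 2 ^ j * (2 * m + 1) + S % 2 ^ j by ring,
    show S % 2 ^ j + 2 ^ j * (2 * m) = 2 ^ j * (2 * m) + S % 2 ^ j by ring,
    Nat.testBit_two_pow_mul_add _ hlt, Nat.testBit_two_pow_mul_add _ hlt]
  rcases lt_trichotomy k j with h | rfl | h
  · simp [h, h.ne]
  · simp
  · obtain ⟨n, rfl⟩ : ∃ n, k = j + (n + 1) := ⟨k - j - 1, by omega⟩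
    simp [Nat.testBit_succ, Nat.mul_add_div]

lemma testBit_setBit (S j k : ℕ) :
    (setBit S j).testBit k = (decide (k = j) || S.testBit k) := by
  unfold setBit
  split_ifs with h
  · by_cases hk : k = j <;> simp [hk, h]
  · exact testBit_add_two_pow (by simpa using h) k

lemma testBit_clearBit (S j k : ℕ) :
    (clearBit S j).testBit k = (!decide (k = j) && S.testBit k) := by
  unfold clearBit
  split_ifs with h
  · have hle : 2 ^ j ≤ S := Nat.ge_two_pow_of_testBit h
    have hc : (S - 2 ^ j).testBit j = false := by
      have := Nat.testBit_two_pow_add_eq (S - 2 ^ j) j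
      rw [show 2 ^ j + (S - 2 ^ j) = S by omega, h] at this
      simpa using this.symm
    have := testBit_add_two_pow hc k
    rw [Nat.sub_add_cancel hle] at this
    rw [this]
    by_cases hk : k = j
    · subst hk; simp [hc]
    · simp [hk]
  · by_cases hk : k = j <;> simp [hk, h]

lemma setBit_lt {S j h : ℕ} (hS : S < 2 ^ h) (hj : j < h) : setBit S j < 2 ^ h := by
  refine Nat.lt_pow_two_of_testBit _ fun k hk => ?_
  rw [testBit_setBit, Nat.testBit_lt_two_pow (hS.trans_le (Nat.pow_le_pow_right (by norm_num) hk))]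
  simp; omega

lemma clearBit_le (S j : ℕ) : clearBit S j ≤ S := by
  unfold clearBit
  split_ifs
  · exact Nat.sub_le _ _
  · exact le_rfl

lemma testBit_ne_of_clearBit_eq {S j u : ℕ} (h : clearBit u j = S) : S.testBit j = false := by
  rw [← h, testBit_clearBit]; simp

lemma eq_or_eq_of_clearBit_eq {S j u : ℕ} (h : clearBit u j = S) : u = S ∨ u = S + 2 ^ j := by
  unfold clearBit at h
  split_ifs at h with h'
  · have := Nat.ge_two_pow_of_testBit h'
    omega
  · exact Or.inl h

namespace Sweep

variable (D : Sweep)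

/-- The next state: the state `S` codes the set of the rows on which the node visited last is
connected. -/
noncomputable def next (t S d : ℕ) : ℕ :=
  open Classical in
  if d ≠ 0 ∨ D.Free t (S.testBit (t % D.h)) then setBit S (t % D.h) else clearBit S (t % D.h)

/-- In the state `S`, the node below the node `t` is connected. -/
def Down (t S : ℕ) : Prop := 0 < t % D.h ∧ S.testBit (t % D.h - 1)

/-- `S` is the sequence of states of a sweep that starts from the empty set and makes the legal
decisions `d`. -/
def IsStateRun (S d : ℕ → ℕ) : Prop :=
  S 0 = 0 ∧ ∀ t < D.N * D.h,
    D.Legal t ((S t).testBit (t % D.h)) (D.Down t (S t)) (d t) ∧ S (t + 1) = D.next t (S t) (d t)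

/-- The predicate `A` says which nodes are connected under the legal decisions `d`. -/
def IsRun (A : ℕ → Prop) (d : ℕ → ℕ) : Prop :=
  ∀ t < D.N * D.h,
    D.Legal t (0 < t / D.h ∧ A (t - D.h)) (0 < t % D.h ∧ A (t - 1)) (d t) ∧
    (A t ↔ d t ≠ 0 ∨ D.Free t (0 < t / D.h ∧ A (t - D.h)))

variable {D}

lemma testBit_next_self (t S d : ℕ) :
    (D.next t S d).testBit (t % D.h) ↔ d ≠ 0 ∨ D.Free t (S.testBit (t % D.h)) := by
  unfold next
  split_ifs with h
  · simp only [testBit_setBit]; simpa using h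
  · simp only [testBit_clearBit]; simpa using h

lemma testBit_next_of_ne {t S d k : ℕ} (hk : k ≠ t % D.h) :
    (D.next t S d).testBit k = S.testBit k := by
  unfold next
  split_ifs with h
  · simp [testBit_setBit, hk]
  · simp [testBit_clearBit, hk]

/-- The bits of a state that is updated one row at a time are the bits set at the last `h` nodes. -/
lemma testBit_state {T : ℕ} {S : ℕ → ℕ} {d : ℕ → ℕ} (h0 : S 0 = 0) (hh : 0 < D.h)
    (hS : ∀ t < T, S (t + 1) = D.next t (S t) (d t)) {t : ℕ} (ht : t < T) :
    ((S t).testBit (t % D.h) ↔ 0 < t / D.h ∧ (S (t - D.h + 1)).testBit ((t - D.h) % D.h)) ∧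
    (D.Down t (S t) ↔ 0 < t % D.h ∧ (S (t - 1 + 1)).testBit ((t - 1) % D.h)) := by
  constructor
  · have key : ∀ n s, s + n = t → n < D.h → (S t).testBit (t % D.h) = (S s).testBit (t % D.h) := by
      intro n
      induction n with
      | zero => intro s hs _; simp at hs; rw [hs]
      | succ n ih =>
        intro s hs hn
        rw [ih (s + 1) (by omega) (by omega), hS s (by omega), testBit_next_of_ne]
        intro hmod
        have h1 : n + 1 ≡ 0 [MOD D.h] := by
          have : s + (n + 1) ≡ s + 0 [MOD D.h] := by rw [hs]; exact hmod
          exact Nat.ModEq.add_left_cancel' s this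
        have := Nat.le_of_dvd (Nat.succ_pos n) ((Nat.modEq_zero_iff_dvd).1 h1)
        omega
    by_cases hlt : t < D.h
    · have hz := key t 0 (by omega) hlt
      rw [hz, h0, Nat.div_eq_of_lt hlt]
      simp
    · have hle : D.h ≤ t := not_lt.1 hlt
      rw [key (D.h - 1) (t - D.h + 1) (by omega) (by omega)]
      have : (t - D.h) % D.h = t % D.h := by
        conv_rhs => rw [← Nat.sub_add_cancel hle]
        simp
      rw [this]
      simp [Nat.div_pos hle hh]
  · unfold Down
    refine and_congr_right fun hpos => ?_
    have ht0 : 0 < t := Nat.pos_of_ne_zero fun h => by simp [h] at hpos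
    rw [Nat.sub_add_cancel ht0]
    have : (t - 1) % D.h = t % D.h - 1 := by
      have h1 := Nat.mod_lt t hh
      have h2 := Nat.div_add_mod t D.h
      have h3 : t - 1 = (t % D.h - 1) + D.h * (t / D.h) := by omega
      rw [h3, Nat.add_mul_mod_self_left, Nat.mod_eq_of_lt (by omega)]
    rw [this]

lemma IsStateRun.isRun {S d : ℕ → ℕ} (hh : 0 < D.h) (hS : D.IsStateRun S d) :
    D.IsRun (fun t => (S (t + 1)).testBit (t % D.h)) d := by
  intro t ht
  obtain ⟨h1, h2⟩ := testBit_state hS.1 hh (fun t ht => (hS.2 t ht).2) ht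
  have h3 := hS.2 t ht
  dsimp only
  rw [← h1, ← h2]
  refine ⟨h3.1, ?_⟩
  rw [h3.2, testBit_next_self]

variable {P R : Finset Pt}

lemma Valid.X_mono (hD : D.Valid P R) {i i' : ℕ} (h : i ≤ i') (hN : i' < D.N) : D.X i ≤ D.X i' := by
  rcases h.eq_or_lt with rfl | h
  · exact le_rfl
  · rcases hD.lex i i' h hN with h | h
    · exact h.le
    · exact h.1.le

lemma Valid.Y_mono (hD : D.Valid P R) {j j' : ℕ} (h : j ≤ j') (hh : j' < D.h) : D.Y j ≤ D.Y j' := by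
  rcases h.eq_or_lt with rfl | h
  · exact le_rfl
  · exact (hD.Y_lt j j' h hh).le

lemma Valid.Y_inj (hD : D.Valid P R) {j j' : ℕ} (hj : j < D.h) (hj' : j' < D.h)
    (h : D.Y j = D.Y j') : j = j' := by
  rcases lt_trichotomy j j' with h1 | h1 | h1
  · exact absurd h (hD.Y_lt _ _ h1 hj').ne
  · exact h1
  · exact absurd h (hD.Y_lt _ _ h1 hj).ne'

lemma Valid.le_of_Y_le (hD : D.Valid P R) {j j' : ℕ} (hj : j < D.h) (h : D.Y j ≤ D.Y j') :
    j ≤ j' := by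
  by_contra h1
  exact absurd h (not_le.2 (hD.Y_lt _ _ (not_le.1 h1) hj))

lemma Valid.N_pos (hD : D.Valid P R) (hI : IsInstance P R) : 0 < D.N := by
  obtain ⟨i, hi, -⟩ := (hD.mem_R _).1 hI.origin_mem
  omega

lemma Valid.h_pos (hD : D.Valid P R) (hI : IsInstance P R) : 0 < D.h := by
  obtain ⟨j, hj, -⟩ := hD.row 0 (hD.N_pos hI)
  omega

lemma Valid.dx_nonneg (hD : D.Valid P R) {t : ℕ} (ht : t < D.N * D.h) : 0 ≤ D.dx t :=
  sub_nonneg.2 (hD.X_mono (Nat.sub_le _ _) (Nat.div_lt_of_lt_mul (by rwa [mul_comm])))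

lemma Valid.dy_nonneg (hD : D.Valid P R) (hh : 0 < D.h) (t : ℕ) : 0 ≤ D.dy t :=
  sub_nonneg.2 (hD.Y_mono (Nat.sub_le _ _) (Nat.mod_lt _ hh))

lemma mul_add_lt {i j : ℕ} (hi : i < D.N) (hj : j < D.h) : i * D.h + j < D.N * D.h := by
  calc i * D.h + j < i * D.h + D.h := by omega
    _ = (i + 1) * D.h := by ring
    _ ≤ D.N * D.h := Nat.mul_le_mul_right _ hi

lemma mul_add_div' {i j : ℕ} (hj : j < D.h) : (i * D.h + j) / D.h = i := by
  rw [mul_comm, Nat.mul_add_div (by omega), Nat.div_eq_of_lt hj, add_zero]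

lemma mul_add_mod' {i j : ℕ} (hj : j < D.h) : (i * D.h + j) % D.h = j := by
  rw [mul_comm, Nat.mul_add_mod, Nat.mod_eq_of_lt hj]

lemma exists_eq_mul_add {t : ℕ} (ht : t < D.N * D.h) :
    ∃ i j, i < D.N ∧ j < D.h ∧ t = i * D.h + j := by
  have hh : 0 < D.h := Nat.pos_of_ne_zero fun h => by simp [h] at ht
  exact ⟨t / D.h, t % D.h, Nat.div_lt_of_lt_mul (by rwa [mul_comm]), Nat.mod_lt _ hh,
    by rw [mul_comm, Nat.div_add_mod]⟩

/-- A connected node stays connected in the further copies of its column. -/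
lemma IsRun.keep (hD : D.Valid P R) {A : ℕ → Prop} {d : ℕ → ℕ} (hA : D.IsRun A d) {i i' j : ℕ}
    (hi : i ≤ i') (hi' : i' < D.N) (hj : j < D.h) (hX : D.X i = D.X i') (h : A (i * D.h + j)) :
    A (i' * D.h + j) := by
  induction i', hi using Nat.le_induction with
  | base => exact h
  | succ i' hi ih =>
    have h1 := hD.X_mono hi (by omega)
    have h2 := hD.X_mono (Nat.le_succ i') hi'
    refine ((hA _ (mul_add_lt hi' hj)).2).2 (Or.inr (Or.inr ⟨?_, ?_, ?_⟩))
    · rw [dx, mul_add_div' hj]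
      simp only [Nat.add_sub_cancel]
      linarith
    · rw [mul_add_div' hj]; omega
    · have := ih (by omega) (by linarith)
      rwa [show (i' + 1) * D.h + j - D.h = i' * D.h + j by rw [add_mul]; omega]

/-- Every node position gets at most one edge to the left or downwards. -/
lemma IsRun.eq_of_pt_eq (hD : D.Valid P R) {A : ℕ → Prop} {d : ℕ → ℕ} (hA : D.IsRun A d) {t t' : ℕ}
    (ht : t < D.N * D.h) (ht' : t' < D.N * D.h) (hd : d t ≠ 0) (hd' : d t' ≠ 0)
    (h : D.pt t = D.pt t') : t = t' := by
  wlog hlt : t < t' generalizing t t'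
  · rcases (not_lt.1 hlt).eq_or_lt with h1 | h1
    · exact h1.symm
    · exact (this ht' ht hd' hd h.symm h1).symm
  exfalso
  obtain ⟨i, j, hi, hj, rfl⟩ := exists_eq_mul_add ht
  obtain ⟨i', j', hi', hj', rfl⟩ := exists_eq_mul_add ht'
  simp only [pt, mul_add_div' hj, mul_add_div' hj', mul_add_mod' hj, mul_add_mod' hj',
    Prod.mk.injEq] at h
  obtain rfl := hD.Y_inj hj hj' h.2
  have hii : i < i' := by
    by_contra hc
    have := Nat.mul_le_mul_right D.h (not_lt.1 hc)
    omega
  obtain ⟨k, rfl⟩ : ∃ k, i' = k + 1 := ⟨i' - 1, by omega⟩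
  have h1 := hD.X_mono (show i ≤ k by omega) (by omega)
  have h2 := hD.X_mono (Nat.le_succ k) hi'
  have hk : A (k * D.h + j) := hA.keep hD (show i ≤ k by omega) (by omega) hj (by linarith [h.1])
    ((hA _ ht).2.2 (Or.inl hd))
  have hfree : D.Free ((k + 1) * D.h + j) (0 < ((k + 1) * D.h + j) / D.h ∧
      A ((k + 1) * D.h + j - D.h)) := by
    refine Or.inr ⟨?_, ?_, ?_⟩
    · rw [dx, mul_add_div' hj]
      simp only [Nat.add_sub_cancel]
      linarith [h.1]
    · rw [mul_add_div' hj]; omega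
    · rwa [show (k + 1) * D.h + j - D.h = k * D.h + j by rw [add_mul]; omega]
  rcases (hA _ ht').1 with h3 | h3 | h3
  · exact hd' h3.1
  · exact h3.2.2 hfree
  · exact h3.2.2 hfree

end Sweep

/-! ### Every forest is at least as expensive as some sweep -/

namespace Sweep

variable {D : Sweep} {P R : Finset Pt}

/-- The greedy decision that connects the node `t` whenever an edge allowed by `H` or `V` does. -/
noncomputable def greedy (D : Sweep) (H V : ℕ → Prop) (t S : ℕ) : ℕ :=
  open Classical in
  if D.Free t (S.testBit (t % D.h)) then 0 else if S.testBit (t % D.h) ∧ H t then 1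
  else if D.Down t S ∧ V t then 2 else 0

/-- The states that the greedy decisions lead to. -/
noncomputable def greedyState (D : Sweep) (H V : ℕ → Prop) : ℕ → ℕ
  | 0 => 0
  | t + 1 => D.next t (greedyState D H V t) (D.greedy H V t (greedyState D H V t))

/-- The nodes that the greedy decisions connect. -/
def GreedyAlive (D : Sweep) (H V : ℕ → Prop) (t : ℕ) : Prop :=
  (D.greedyState H V (t + 1)).testBit (t % D.h)

/-- The greedy decisions connect a node exactly if it is free or an allowed edge leads to it from a
connected node. -/
lemma greedyAlive_iff {H V : ℕ → Prop} (hh : 0 < D.h) (t : ℕ) :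
    D.GreedyAlive H V t ↔ D.Free t (0 < t / D.h ∧ D.GreedyAlive H V (t - D.h)) ∨
      ((0 < t / D.h ∧ D.GreedyAlive H V (t - D.h)) ∧ H t) ∨
      ((0 < t % D.h ∧ D.GreedyAlive H V (t - 1)) ∧ V t) := by
  obtain ⟨h1, h2⟩ := testBit_state (D := D) (T := t + 1) (S := D.greedyState H V)
    (d := fun t => D.greedy H V t (D.greedyState H V t)) rfl hh (fun _ _ => rfl) (Nat.lt_succ_self t)
  unfold GreedyAlive
  rw [← h1, ← h2]
  change (D.next t _ _).testBit _ = true ↔ _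
  rw [testBit_next_self]
  unfold greedy
  split_ifs with h3 h4 h5
  · simp [h3]
  · simp [h4]
  · simp [h5]
  · simp [h3, h4, h5]

/-- The greedy decisions are legal if they connect all points. -/
lemma isStateRun_greedy {H V : ℕ → Prop}
    (hP : ∀ t < D.N * D.h, D.PointAt t → D.GreedyAlive H V t) :
    D.IsStateRun (D.greedyState H V) (fun t => D.greedy H V t (D.greedyState H V t)) := by
  refine ⟨rfl, fun t ht => ⟨?_, rfl⟩⟩
  change D.Legal t _ _ (D.greedy H V t (D.greedyState H V t))
  have h1 := hP t ht
  unfold GreedyAlive at h1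
  change _ → (D.next t _ _).testBit _ = true at h1
  rw [testBit_next_self] at h1
  revert h1
  unfold greedy Legal
  split_ifs with h3 h4 h5
  · intro _; exact Or.inl ⟨rfl, fun _ => h3⟩
  · intro _; exact Or.inr (Or.inl ⟨rfl, h4.1, h3⟩)
  · intro _; exact Or.inr (Or.inr ⟨rfl, h5.1, h3⟩)
  · intro h1; exact Or.inl ⟨rfl, fun hp => by simpa using h1 hp⟩

section closure

variable {H V : ℕ → Prop} {i j : ℕ}

lemma greedyAlive_root (hj : j < D.h) (hr : D.isRoot i = true) (hY : D.Y j = D.Z i) :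
    D.GreedyAlive H V (i * D.h + j) :=
  (greedyAlive_iff (by omega) _).2 (Or.inl (Or.inl ⟨by rwa [mul_add_div' hj],
    by rwa [mul_add_div' hj, mul_add_mod' hj]⟩))

lemma greedyAlive_left_iff (hj : j < D.h) :
    (0 < ((i + 1) * D.h + j) / D.h ∧ D.GreedyAlive H V ((i + 1) * D.h + j - D.h)) ↔
      D.GreedyAlive H V (i * D.h + j) := by
  rw [mul_add_div' hj, show (i + 1) * D.h + j - D.h = i * D.h + j by rw [add_mul]; omega]
  simp

lemma greedyAlive_keep (hj : j < D.h) (hX : D.X i = D.X (i + 1))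
    (h : D.GreedyAlive H V (i * D.h + j)) : D.GreedyAlive H V ((i + 1) * D.h + j) := by
  refine (greedyAlive_iff (by omega) _).2 (Or.inl (Or.inr ⟨?_, (greedyAlive_left_iff hj).2 h⟩))
  simp [dx, mul_add_div' hj, hX]

lemma greedyAlive_right (hj : j < D.h) (hH : H ((i + 1) * D.h + j))
    (h : D.GreedyAlive H V (i * D.h + j)) : D.GreedyAlive H V ((i + 1) * D.h + j) :=
  (greedyAlive_iff (by omega) _).2 (Or.inr (Or.inl ⟨(greedyAlive_left_iff hj).2 h, hH⟩))

lemma greedyAlive_up (hj : j + 1 < D.h) (hV : V (i * D.h + (j + 1)))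
    (h : D.GreedyAlive H V (i * D.h + j)) : D.GreedyAlive H V (i * D.h + (j + 1)) := by
  refine (greedyAlive_iff (by omega) _).2 (Or.inr (Or.inr ⟨⟨?_, h⟩, hV⟩))
  rw [mul_add_mod' hj]; omega

end closure

/-- Some sweep is legal: connect everything. -/
lemma exists_isStateRun (hI : IsInstance P R) (hD : D.Valid P R) : ∃ S d, D.IsStateRun S d := by
  have hh := hD.h_pos hI
  refine ⟨_, _, isStateRun_greedy (H := fun _ => True) (V := fun _ => True) fun t ht hp => ?_⟩
  clear hp
  obtain ⟨i, j, hi, hj, rfl⟩ := exists_eq_mul_add ht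
  have hquad : ∀ i < D.N, 0 ≤ D.X i ∧ 0 ≤ D.Z i := by
    intro i hi
    refine hI.quadrant (D.X i, D.Z i) ?_
    rw [Finset.mem_union, hD.mem_P, hD.mem_R]
    cases hr : D.isRoot i
    · exact Or.inl ⟨i, hi, hr, rfl⟩
    · exact Or.inr ⟨i, hi, hr, rfl⟩
  obtain ⟨i0, hi0, hr0, h0⟩ := (hD.mem_R _).1 hI.origin_mem
  simp only [Prod.mk.injEq] at h0
  have h00 : i0 = 0 := by
    by_contra hne
    have := hquad 0 (by omega)
    rcases hD.lex 0 i0 (by omega) hi0 with h | h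
    · linarith [h0.1]
    · linarith [h0.2, h.2]
  subst h00
  obtain ⟨j0, hj0, hY0⟩ := hD.row 0 hi0
  have h00 : j0 = 0 := by
    by_contra hne
    have h1 := hD.Y_lt 0 j0 (by omega) hj0
    obtain ⟨k, hk, hkY⟩ := hD.row_used 0 hh
    linarith [(hquad k hk).2, h0.2]
  subst h00
  have hcol : ∀ j < D.h, D.GreedyAlive (fun _ => True) (fun _ => True) (0 * D.h + j) := by
    intro j
    induction j with
    | zero => intro _; exact greedyAlive_root hh hr0 hY0
    | succ j ih => intro hj; exact greedyAlive_up hj trivial (ih (by omega))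
  clear hi ht
  induction i with
  | zero => exact hcol j hj
  | succ i ih => exact greedyAlive_right hj trivial ih

/-- The horizontal unit edge to the left of the node `t` is covered by an edge of `F` after
rounding. -/
def CoverH (D : Sweep) (F : RectilinearGraph) (φ ψ : ℝ → ℝ) (t : ℕ) : Prop :=
  ∃ e ∈ F.edges, ψ (edgeLo Prod.snd e) = D.Y (t % D.h) ∧
    φ (edgeLo Prod.fst e) ≤ D.X (t / D.h - 1) ∧ D.X (t / D.h) ≤ φ (edgeHi Prod.fst e)

/-- The vertical unit edge below the node `t` is covered by an edge of `F` after rounding. -/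
def CoverV (D : Sweep) (F : RectilinearGraph) (φ ψ : ℝ → ℝ) (t : ℕ) : Prop :=
  ∃ e ∈ F.edges, φ (edgeLo Prod.fst e) = D.X (t / D.h) ∧
    ψ (edgeLo Prod.snd e) ≤ D.Y (t % D.h - 1) ∧ D.Y (t % D.h) ≤ ψ (edgeHi Prod.snd e)

/-- The rounded image of a monotone path of `F` that starts at a root consists of connected nodes.
The path may enter a column at a height above all its terminals, so the claim is about those copies
of the column that come after all terminals preceding the node. -/
lemma greedyAlive_of_cover (hD : D.Valid P R) {F : RectilinearGraph}
    (hF : IsRSFA P R F) {φ ψ : ℝ → ℝ} (hφ : Monotone φ) (hψ : Monotone ψ)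
    (hφX : ∀ x, ∃ i < D.N, D.X i = φ x) (hψY : ∀ y, ∃ j < D.h, D.Y j = ψ y)
    (hφ' : ∀ i < D.N, φ (D.X i) = D.X i) (hψ' : ∀ j < D.h, ψ (D.Y j) = D.Y j)
    {t : ℕ} (ht : t < D.N * D.h) (hp : D.PointAt t) :
    D.GreedyAlive (D.CoverH F φ ψ) (D.CoverV F φ ψ) t := by
  obtain ⟨i, j, hi, hj, rfl⟩ := exists_eq_mul_add ht
  have hp1 := hp.1
  have hp2 := hp.2
  rw [mul_add_div' hj] at hp1 hp2
  rw [mul_add_mod' hj] at hp2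
  set p : Pt := (D.X i, D.Z i) with hpdef
  have hpP : p ∈ P := (hD.mem_P _).2 ⟨i, hi, hp1, rfl⟩
  obtain ⟨r, hr, hreach, hall⟩ := hF.rooted p (hF.spanning (Finset.mem_union_left _ hpP))
  obtain ⟨w, -, hw⟩ := hall p hpP hreach
  have hZ : ∀ i < D.N, ψ (D.Z i) = D.Z i := by
    intro i hi
    obtain ⟨j, hj, hY⟩ := hD.row i hi
    rw [← hY, hψ' j hj]
  let Q : Pt → Prop := fun v => ∀ i < D.N, ∀ j < D.h, D.X i = φ v.1 → D.Y j = ψ v.2 →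
    (∀ i' < D.N, i < i' → D.X i < D.X i' ∨ D.Y j < D.Z i') →
    D.GreedyAlive (D.CoverH F φ ψ) (D.CoverV F φ ψ) (i * D.h + j)
  have hkeep : ∀ i i', i ≤ i' → ∀ j < D.h, i' < D.N → D.X i = D.X i' →
      D.GreedyAlive (D.CoverH F φ ψ) (D.CoverV F φ ψ) (i * D.h + j) →
      D.GreedyAlive (D.CoverH F φ ψ) (D.CoverV F φ ψ) (i' * D.h + j) := by
    intro i i' hii j hj hi' hX h
    induction i', hii using Nat.le_induction with
    | base => exact h
    | succ i' hii ih =>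
      have h1 := hD.X_mono hii (by omega)
      have h2 := hD.X_mono (Nat.le_succ i') hi'
      exact greedyAlive_keep hj (by linarith) (ih (by omega) (by linarith))
  -- `Q` spreads along the edges of a monotone path from the root
  have hQp : Q p := by
    refine RectilinearGraph.of_walkLength_eq (Q := Q) ?_ w hw ?_
    · intro u v huv hu1 hu2 hQ i hi j hj hX hY hlast
      rcases F.axis_parallel u v huv with hx | hy
      · obtain ⟨j0, hj0, hY0⟩ := hψY u.2
        have hjj : j0 ≤ j := hD.le_of_Y_le hj0 (by rw [hY0, hY]; exact hψ hu2)
        have base := hQ i hi j0 hj0 (by rw [hX, hx]) hY0 fun i' hi' hii =>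
          (hlast i' hi' hii).imp_right fun h => lt_of_le_of_lt (hD.Y_mono hjj hj) h
        have step : ∀ k, j0 ≤ k → k ≤ j →
            D.GreedyAlive (D.CoverH F φ ψ) (D.CoverV F φ ψ) (i * D.h + k) := by
          intro k hk
          induction k, hk using Nat.le_induction with
          | base => intro _; exact base
          | succ k hk ih =>
            intro hkj
            refine greedyAlive_up (by omega) ⟨s(u, v), huv, ?_, ?_, ?_⟩ (ih (by omega))
            · rw [mul_add_div' (by omega), edgeLo_mk, min_eq_left hu1, hX, hx]
            · rw [mul_add_mod' (by omega), edgeLo_mk, min_eq_left hu2, ← hY0]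
              exact hD.Y_mono (by omega) (by omega)
            · rw [mul_add_mod' (by omega), edgeHi_mk, max_eq_right hu2, ← hY]
              exact hD.Y_mono (by omega) (by omega)
        exact step j hjj le_rfl
      · rcases (hφ hu1).eq_or_lt with heq | hlt
        · exact hQ i hi j hj (by rw [hX, heq]) (by rw [hY, hy]) hlast
        · obtain ⟨i1, hi1, hX1⟩ := hφX u.1
          -- the last copy of the column of `u`
          obtain ⟨i0, hi0, hmax⟩ := Finset.exists_max_image
            ((Finset.range D.N).filter fun k => D.X k = φ u.1) id
            ⟨i1, by simp [hi1, hX1]⟩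
          simp only [Finset.mem_filter, Finset.mem_range, id] at hi0 hmax
          have hlast0 : ∀ i' < D.N, i0 < i' → D.X i0 < D.X i' := by
            intro i' hi' hii
            refine lt_of_le_of_ne (hD.X_mono hii.le hi') fun h => ?_
            have := hmax i' ⟨hi', by rw [← h, hi0.2]⟩
            omega
          have base := hQ i0 hi0.1 j hj hi0.2 (by rw [hY, hy]) fun i' hi' hii =>
            Or.inl (hlast0 i' hi' hii)
          have hii : i0 ≤ i := by
            by_contra hc
            have := hD.X_mono (not_le.1 hc).le hi0.1
            rw [hX, hi0.2] at this
            exact absurd hlt (not_lt.2 this)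
          have step : ∀ k, i0 ≤ k → k ≤ i →
              D.GreedyAlive (D.CoverH F φ ψ) (D.CoverV F φ ψ) (k * D.h + j) := by
            intro k hk
            induction k, hk using Nat.le_induction with
            | base => intro _; exact base
            | succ k hk ih =>
              intro hki
              refine greedyAlive_right hj ⟨s(u, v), huv, ?_, ?_, ?_⟩ (ih (by omega))
              · rw [mul_add_mod' hj, edgeLo_mk, min_eq_left hu2, hY, hy]
              · rw [mul_add_div' hj, edgeLo_mk, min_eq_left hu1, ← hi0.2]
                exact hD.X_mono (by omega) (by omega)
              · rw [mul_add_div' hj, edgeHi_mk, max_eq_right hu1, ← hX]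
                exact hD.X_mono hki hi
          exact step i hii le_rfl
    · intro i hi j hj hX hY hlast
      obtain ⟨i0, hi0, hroot, hri⟩ := (hD.mem_R r).1 hr
      rw [← hri] at hX hY
      simp only [hφ' i0 hi0, hZ i0 hi0] at hX hY
      have hii : i0 ≤ i := by
        by_contra hc
        rcases hlast i0 hi0 (not_le.1 hc) with h | h
        · exact h.ne hX
        · exact h.ne hY
      exact hkeep i0 i hii j hj hi hX.symm (greedyAlive_root hj hroot hY)
  refine hQp i hi j hj (hφ' i hi).symm (by rw [hp2, hZ i hi]) fun i' hi' hii => ?_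
  rw [hp2]
  exact (hD.lex i i' hii hi').imp_right And.right

/-- Disjoint gaps `[f (i - 1), f i]` inside `[a, b]` have total length at most `b - a`. -/
lemma sum_gaps_le {f : ℕ → ℝ} {n : ℕ} (hf : ∀ i i', i ≤ i' → i' < n → f i ≤ f i') (I : Finset ℕ) {a : ℝ} :
    ∀ b, a ≤ b → (∀ i ∈ I, i < n ∧ a ≤ f (i - 1) ∧ f i ≤ b) →
      ∑ i ∈ I, (f i - f (i - 1)) ≤ b - a := by
  induction I using Finset.induction_on_max with
  | empty => intro b hb _; simpa using hb
  | insert k I hk ih =>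
    intro b hb hI
    have hnot : k ∉ I := fun h => lt_irrefl _ (hk k h)
    rw [Finset.sum_insert hnot]
    obtain ⟨h1, h2, h3⟩ := hI k (Finset.mem_insert_self _ _)
    have := ih (f (k - 1)) h2 fun i hi => by
      obtain ⟨h4, h5, -⟩ := hI i (Finset.mem_insert_of_mem hi)
      have := hk i hi
      exact ⟨h4, h5, hf _ _ (by omega) (by omega)⟩
    linarith

lemma sum_cost_eq (d : ℕ → ℕ) (T : ℕ) :
    ∑ t ∈ Finset.range T, D.cost t (d t) =
      ∑ t ∈ (Finset.range T).filter (fun t => d t = 1), D.dx t +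
      ∑ t ∈ (Finset.range T).filter (fun t => d t = 2), D.dy t := by
  rw [Finset.sum_filter, Finset.sum_filter, ← Finset.sum_add_distrib]
  refine Finset.sum_congr rfl fun t _ => ?_
  unfold cost
  split_ifs with h1 h2 <;> first | omega | simp

open Classical in
/-- The unit edges chosen by a run are disjoint, so if they are covered by rounded edges of `F`, then
they are not longer than these. -/
lemma sum_cost_le_of_cover (hD : D.Valid P R) {F : RectilinearGraph} {φ ψ : ℝ → ℝ}
    (hφ : Monotone φ) (hψ : Monotone ψ) {A : ℕ → Prop} {d : ℕ → ℕ} (hA : D.IsRun A d)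
    (hH : ∀ t < D.N * D.h, d t = 1 → D.CoverH F φ ψ t)
    (hV : ∀ t < D.N * D.h, d t = 2 → D.CoverV F φ ψ t) :
    ∑ t ∈ Finset.range (D.N * D.h), D.cost t (d t) ≤
      ∑ e ∈ F.edges, (φ (edgeHi Prod.fst e) - φ (edgeLo Prod.fst e)) +
      ∑ e ∈ F.edges, (ψ (edgeHi Prod.snd e) - ψ (edgeLo Prod.snd e)) := by
  rw [sum_cost_eq]
  refine add_le_add ?_ ?_
  · choose! g hg using hH
    have hmaps : ∀ t ∈ (Finset.range (D.N * D.h)).filter (fun t => d t = 1), g t ∈ F.edges := by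
      intro t ht
      simp only [Finset.mem_filter, Finset.mem_range] at ht
      exact (hg t ht.1 ht.2).1
    rw [← Finset.sum_fiberwise_of_maps_to hmaps]
    refine Finset.sum_le_sum fun e he => ?_
    set I := ((Finset.range (D.N * D.h)).filter (fun t => d t = 1)).filter (fun t => g t = e) with hI
    have hmem : ∀ t ∈ I, t < D.N * D.h ∧ d t = 1 ∧ g t = e := by
      intro t ht
      simpa [hI, and_assoc] using ht
    have hinj : Set.InjOn (fun t => t / D.h) (I : Set ℕ) := by
      intro t ht t' ht' h
      obtain ⟨h1, h2, h3⟩ := hmem t ht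
      obtain ⟨h1', h2', h3'⟩ := hmem t' ht'
      refine hA.eq_of_pt_eq hD h1 h1' (by omega) (by omega) ?_
      have e1 := (hg t h1 h2).2.1
      have e2 := (hg t' h1' h2').2.1
      rw [h3] at e1
      rw [h3'] at e2
      dsimp only at h
      rw [pt, pt, ← e1, ← e2, h]
    have := sum_gaps_le (f := D.X) (n := D.N) (fun i i' h h' => hD.X_mono h h')
      (I.image fun t => t / D.h)
      (a := φ (edgeLo Prod.fst e)) (φ (edgeHi Prod.fst e)) (hφ (edgeLo_le_edgeHi _ _)) (by
        intro i hi
        obtain ⟨t, ht, rfl⟩ := Finset.mem_image.1 hi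
        obtain ⟨h1, h2, h3⟩ := hmem t ht
        have e1 := (hg t h1 h2).2.2
        rw [h3] at e1
        exact ⟨Nat.div_lt_of_lt_mul (by rwa [mul_comm]), e1⟩)
    rwa [Finset.sum_image hinj] at this
  · choose! g hg using hV
    have hmaps : ∀ t ∈ (Finset.range (D.N * D.h)).filter (fun t => d t = 2), g t ∈ F.edges := by
      intro t ht
      simp only [Finset.mem_filter, Finset.mem_range] at ht
      exact (hg t ht.1 ht.2).1
    rw [← Finset.sum_fiberwise_of_maps_to hmaps]
    refine Finset.sum_le_sum fun e he => ?_
    set I := ((Finset.range (D.N * D.h)).filter (fun t => d t = 2)).filter (fun t => g t = e) with hI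
    have hmem : ∀ t ∈ I, t < D.N * D.h ∧ d t = 2 ∧ g t = e := by
      intro t ht
      simpa [hI, and_assoc] using ht
    have hinj : Set.InjOn (fun t => t % D.h) (I : Set ℕ) := by
      intro t ht t' ht' h
      obtain ⟨h1, h2, h3⟩ := hmem t ht
      obtain ⟨h1', h2', h3'⟩ := hmem t' ht'
      refine hA.eq_of_pt_eq hD h1 h1' (by omega) (by omega) ?_
      have e1 := (hg t h1 h2).2.1
      have e2 := (hg t' h1' h2').2.1
      rw [h3] at e1
      rw [h3'] at e2
      dsimp only at h
      rw [pt, pt, ← e1, ← e2, h]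
    have := sum_gaps_le (f := D.Y) (n := D.h) (fun i i' h h' => hD.Y_mono h h')
      (I.image fun t => t % D.h)
      (a := ψ (edgeLo Prod.snd e)) (ψ (edgeHi Prod.snd e)) (hψ (edgeLo_le_edgeHi _ _)) (by
        intro i hi
        obtain ⟨t, ht, rfl⟩ := Finset.mem_image.1 hi
        obtain ⟨h1, h2, h3⟩ := hmem t ht
        have e1 := (hg t h1 h2).2.2
        rw [h3] at e1
        exact ⟨Nat.mod_lt _ (Nat.pos_of_ne_zero fun h => by simp [h] at h1), e1⟩)
    rwa [Finset.sum_image hinj] at this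

/-- For each forest some sweep connects all points at no greater cost. -/
lemma exists_isStateRun_cost_le (hI : IsInstance P R) (hD : D.Valid P R) {F : RectilinearGraph}
    (hF : IsRSFA P R F) :
    ∃ S d, D.IsStateRun S d ∧ ∑ t ∈ Finset.range (D.N * D.h), D.cost t (d t) ≤ F.weight := by
  classical
  have hN := hD.N_pos hI
  have hh := hD.h_pos hI
  obtain ⟨φ, hφ, hφX, hφ', hφs⟩ := exists_rounding F.edges (edgeLo Prod.fst) (edgeHi Prod.fst)
    (fun e _ => edgeLo_le_edgeHi _ e) (Z := (Finset.range D.N).image D.X)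
    ⟨D.X 0, Finset.mem_image_of_mem _ (Finset.mem_range.2 hN)⟩
  obtain ⟨ψ, hψ, hψY, hψ', hψs⟩ := exists_rounding F.edges (edgeLo Prod.snd) (edgeHi Prod.snd)
    (fun e _ => edgeLo_le_edgeHi _ e) (Z := (Finset.range D.h).image D.Y)
    ⟨D.Y 0, Finset.mem_image_of_mem _ (Finset.mem_range.2 hh)⟩
  simp only [Finset.mem_image, Finset.mem_range, forall_exists_index, and_imp,
    forall_apply_eq_imp_iff₂] at hφX hφ' hψY hψ'
  have hrun := isStateRun_greedy (H := D.CoverH F φ ψ) (V := D.CoverV F φ ψ)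
    fun t ht hp => greedyAlive_of_cover hD hF hφ hψ hφX hψY hφ' hψ' ht hp
  refine ⟨_, _, hrun, ?_⟩
  have hcost := sum_cost_le_of_cover hD hφ hψ (hrun.isRun hh) (F := F) ?_ ?_
  · refine hcost.trans ((add_le_add hφs hψs).trans (le_of_eq ?_))
    rw [RectilinearGraph.weight, ← Finset.sum_add_distrib]
    exact Finset.sum_congr rfl fun e _ => (edgeLength_eq_extents e).symm
  · intro t _ h
    unfold greedy at h
    split_ifs at h with h1 h2 <;> first | exact h2.2 | omega
  · intro t _ h
    unfold greedy at h
    split_ifs at h with h1 h2 h3 <;> first | exact h3.2 | omega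

end Sweep

/-! ### Every sweep builds a forest -/

namespace Sweep

variable {D : Sweep} {P R : Finset Pt}

/-- `q` lies on a column and on a horizontal line of the sweep. -/
def IsNode (D : Sweep) (q : Pt) : Prop := (∃ i < D.N, D.X i = q.1) ∧ ∃ j < D.h, D.Y j = q.2

/-- The segment from `p` to `q` goes right or up and does not cross a column or a horizontal line,
respectively, of the sweep. -/
def IsUnitEdge (D : Sweep) (p q : Pt) : Prop :=
  (p.2 = q.2 ∧ p.1 < q.1 ∧ ∀ i < D.N, D.X i ≤ p.1 ∨ q.1 ≤ D.X i) ∨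
  (p.1 = q.1 ∧ p.2 < q.2 ∧ ∀ j < D.h, D.Y j ≤ p.2 ∨ q.2 ≤ D.Y j)

lemma IsUnitEdge.le {p q : Pt} (h : D.IsUnitEdge p q) : p ≤ q := by
  rcases h with h | h
  · exact ⟨h.2.1.le, h.1.le⟩
  · exact ⟨h.1.le, h.2.1.le⟩

lemma IsUnitEdge.rank_lt {p q : Pt} (h : D.IsUnitEdge p q) : p.1 + p.2 < q.1 + q.2 := by
  rcases h with h | h <;> linarith [h.1, h.2.1]

lemma IsUnitEdge.eq_or_eq_of_mem {p q z : Pt} (h : D.IsUnitEdge p q) (hz : D.IsNode z)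
    (hzs : z ∈ segment ℝ p q) : z = p ∨ z = q := by
  obtain ⟨⟨h1, h2⟩, h3, h4⟩ := segment_subset_Icc h.le hzs
  obtain ⟨⟨i, hi, hX⟩, j, hj, hY⟩ := hz
  rcases h with ⟨e, -, h⟩ | ⟨e, -, h⟩
  · rcases h i hi with h | h
    · exact Or.inl (Prod.ext (by linarith) (by linarith))
    · exact Or.inr (Prod.ext (by linarith) (by linarith))
  · rcases h j hj with h | h
    · exact Or.inl (Prod.ext (by linarith) (by linarith))
    · exact Or.inr (Prod.ext (by linarith) (by linarith))

/-- Two unit edges between nodes can only meet in a node, and a unit edge has no node in its interior. -/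
lemma IsUnitEdge.meet {p q p' q' z : Pt} (h : D.IsUnitEdge p q) (h' : D.IsUnitEdge p' q')
    (hp : D.IsNode p) (hq : D.IsNode q) (hp' : D.IsNode p') (hq' : D.IsNode q')
    (hne : (p, q) ≠ (p', q')) (hz : z ∈ segment ℝ p q) (hz' : z ∈ segment ℝ p' q') :
    (z = p ∨ z = q) ∧ (z = p' ∨ z = q') := by
  suffices hN : D.IsNode z from ⟨h.eq_or_eq_of_mem hN hz, h'.eq_or_eq_of_mem hN hz'⟩
  obtain ⟨⟨h1, h2⟩, h3, h4⟩ := segment_subset_Icc h.le hz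
  obtain ⟨⟨h1', h2'⟩, h3', h4'⟩ := segment_subset_Icc h'.le hz'
  obtain ⟨⟨ip, hip, hXp⟩, jp, hjp, hYp⟩ := hp
  obtain ⟨⟨iq, hiq, hXq⟩, jq, hjq, hYq⟩ := hq
  obtain ⟨⟨ip', hip', hXp'⟩, jp', hjp', hYp'⟩ := hp'
  obtain ⟨⟨iq', hiq', hXq'⟩, jq', hjq', hYq'⟩ := hq'
  rcases h with ⟨e, l, h⟩ | ⟨e, l, h⟩ <;> rcases h' with ⟨e', l', h'⟩ | ⟨e', l', h'⟩
  · refine ⟨?_, jp, hjp, by linarith⟩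
    rcases h ip' hip' with a | a
    · rcases h' ip hip with b | b
      · exfalso
        have h5 : p.1 = p'.1 := by linarith
        have h6 : q.1 = q'.1 := by
          rcases h iq' hiq' with c | c
          · linarith
          · rcases h' iq hiq with c' | c' <;> linarith
        exact hne (Prod.ext (Prod.ext h5 (by simp only; linarith))
          (Prod.ext h6 (by simp only; linarith)))
      · exact ⟨ip, hip, by linarith⟩
    · exact ⟨iq, hiq, by linarith⟩
  · exact ⟨⟨ip', hip', by linarith⟩, jp, hjp, by linarith⟩
  · exact ⟨⟨ip, hip, by linarith⟩, jp', hjp', by linarith⟩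
  · refine ⟨⟨ip, hip, by linarith⟩, ?_⟩
    rcases h jp' hjp' with a | a
    · rcases h' jp hjp with b | b
      · exfalso
        have h5 : p.2 = p'.2 := by linarith
        have h6 : q.2 = q'.2 := by
          rcases h jq' hjq' with c | c
          · linarith
          · rcases h' jq hjq with c' | c' <;> linarith
        exact hne (Prod.ext (Prod.ext (by simp only; linarith) h5)
          (Prod.ext (by simp only; linarith) h6))
      · exact ⟨jp, hjp, by linarith⟩
    · exact ⟨jq, hjq, by linarith⟩

/-- `E` lists edges `(u, v)` of the grid from a parent `u` to its child `v`: no child has two parents,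
and each parent is a root or a child itself. -/
structure IsParentList (D : Sweep) (R : Finset Pt) (E : List (Pt × Pt)) : Prop where
  unit : ∀ e ∈ E, D.IsUnitEdge e.1 e.2
  node : ∀ e ∈ E, D.IsNode e.1 ∧ D.IsNode e.2
  root_node : ∀ r ∈ R, D.IsNode r
  nodup : (E.map Prod.snd).Nodup
  parent : ∀ e ∈ E, e.1 ∈ R ∨ ∃ e' ∈ E, e'.2 = e.1

namespace IsParentList

variable {E : List (Pt × Pt)}

lemma parent_unique (hE : D.IsParentList R E) {u u' v : Pt} (h : (u, v) ∈ E) (h' : (u', v) ∈ E) :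
    u = u' :=
  congrArg Prod.fst (List.inj_on_of_nodup_map hE.nodup h h' rfl)

lemma mk_mem_iff {p q : Pt} :
    s(p, q) ∈ E.map (fun e => s(e.1, e.2)) ↔ (p, q) ∈ E ∨ (q, p) ∈ E := by
  simp only [List.mem_map, Sym2.eq_iff]
  constructor
  · rintro ⟨⟨a, b⟩, h, ⟨rfl, rfl⟩ | ⟨rfl, rfl⟩⟩
    · exact Or.inl h
    · exact Or.inr h
  · rintro (h | h)
    · exact ⟨(p, q), h, Or.inl ⟨rfl, rfl⟩⟩
    · exact ⟨(q, p), h, Or.inr ⟨rfl, rfl⟩⟩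

open Classical in
/-- The plane graph whose edges are listed by `E`. -/
noncomputable def forest (hE : D.IsParentList R E) : RectilinearGraph where
  verts := R ∪ ((E.map Prod.fst).toFinset ∪ (E.map Prod.snd).toFinset)
  edges := (E.map fun e => s(e.1, e.2)).toFinset
  endpoints_mem := by
    intro p q h
    rw [List.mem_toFinset, mk_mem_iff] at h
    simp only [Finset.mem_union, List.mem_toFinset, List.mem_map]
    rcases h with h | h
    · exact ⟨Or.inr (Or.inl ⟨_, h, rfl⟩), Or.inr (Or.inr ⟨_, h, rfl⟩)⟩
    · exact ⟨Or.inr (Or.inr ⟨_, h, rfl⟩), Or.inr (Or.inl ⟨_, h, rfl⟩)⟩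
  ne_of_edge := by
    rintro p q h rfl
    rw [List.mem_toFinset, mk_mem_iff] at h
    exact lt_irrefl _ (hE.unit (p, p) (by tauto)).rank_lt
  axis_parallel := by
    intro p q h
    rw [List.mem_toFinset, mk_mem_iff] at h
    rcases h with h | h <;> rcases hE.unit _ h with h | h
    · exact Or.inr h.1
    · exact Or.inl h.1
    · exact Or.inr h.1.symm
    · exact Or.inl h.1.symm
  edges_meet := by
    have key : ∀ e ∈ E, ∀ e' ∈ E, s(e.1, e.2) ≠ s(e'.1, e'.2) → ∀ z, z ∈ segment ℝ e.1 e.2 →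
        z ∈ segment ℝ e'.1 e'.2 → (z = e.1 ∨ z = e.2) ∧ (z = e'.1 ∨ z = e'.2) := by
      intro e he e' he' hne z hz hz'
      refine (hE.unit e he).meet (hE.unit e' he') (hE.node e he).1 (hE.node e he).2
        (hE.node e' he').1 (hE.node e' he').2 (fun h => hne ?_) hz hz'
      rw [show e = e' from h]
    intro p q p' q' h h' hne z hz hz'
    rw [List.mem_toFinset, mk_mem_iff] at h h'
    rcases h with h | h <;> rcases h' with h' | h'
    · exact key _ h _ h' hne z hz hz'
    · have := key _ h _ h' (by rwa [Sym2.eq_swap (a := q')]) z hz (by rwa [segment_symm])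
      exact ⟨this.1, this.2.symm⟩
    · have := key _ h _ h' (by rwa [Sym2.eq_swap (a := q)]) z (by rwa [segment_symm]) hz'
      exact ⟨this.1.symm, this.2⟩
    · have := key _ h _ h' (by rwa [Sym2.eq_swap (a := q), Sym2.eq_swap (a := q')]) z
        (by rwa [segment_symm]) (by rwa [segment_symm])
      exact ⟨this.1.symm, this.2.symm⟩
  vertex_on_edge := by
    intro p q h z hz hzs
    have hN : D.IsNode z := by
      simp only [Finset.mem_union, List.mem_toFinset, List.mem_map] at hz
      rcases hz with hz | ⟨e, he, rfl⟩ | ⟨e, he, rfl⟩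
      · exact hE.root_node z hz
      · exact (hE.node e he).1
      · exact (hE.node e he).2
    rw [List.mem_toFinset, mk_mem_iff] at h
    rcases h with h | h
    · exact (hE.unit _ h).eq_or_eq_of_mem hN hzs
    · exact ((hE.unit _ h).eq_or_eq_of_mem hN (by rwa [segment_symm])).symm

lemma adj_forest_iff (hE : D.IsParentList R E) {p q : Pt} :
    hE.forest.graph.Adj p q ↔ (p, q) ∈ E ∨ (q, p) ∈ E := by
  rw [RectilinearGraph.adj_iff]
  constructor
  · intro h
    rw [← mk_mem_iff]
    simpa [forest] using h.1
  · intro h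
    have h' : s(p, q) ∈ hE.forest.edges := by
      rw [← mk_mem_iff] at h
      exact List.mem_toFinset.2 h
    exact ⟨h', hE.forest.ne_of_edge p q h'⟩

/-- A highest vertex of a cycle would have two parents. -/
lemma isAcyclic_forest (hE : D.IsParentList R E) : hE.forest.graph.IsAcyclic := by
  classical
  intro v c hc
  obtain ⟨u, hu, hmax⟩ := Finset.exists_max_image c.support.toFinset (fun q : Pt => q.1 + q.2)
    ⟨v, by simp⟩
  rw [List.mem_toFinset] at hu
  have hc' := hc.rotate (c := c) hu
  have hsub : ∀ w ∈ (c.rotate u hu).support, w.1 + w.2 ≤ u.1 + u.2 := by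
    intro w hw
    exact hmax w (by simpa using hw)
  have hnil : ¬ (c.rotate u hu).Nil := hc'.not_nil
  have par : ∀ w, hE.forest.graph.Adj u w → w.1 + w.2 ≤ u.1 + u.2 → (w, u) ∈ E := by
    intro w hw hle
    rcases (hE.adj_forest_iff).1 hw with h | h
    · exact absurd (hE.unit _ h).rank_lt (not_lt.2 hle)
    · exact h
  refine hc'.snd_ne_penultimate (hE.parent_unique
    (par _ (SimpleGraph.Walk.adj_snd hnil) (hsub _ ?_))
    (par _ (SimpleGraph.Walk.adj_penultimate hnil).symm (hsub _ ?_)))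
  · exact SimpleGraph.Walk.getVert_mem_support _ _
  · exact SimpleGraph.Walk.getVert_mem_support _ _

/-- Every vertex descends from a root without a parent. -/
lemma exists_root (hE : D.IsParentList R E) (v : Pt) (hv : v ∈ R ∨ ∃ e ∈ E, e.2 = v) :
    ∃ r ∈ R, (∀ u, (u, r) ∉ E) ∧ Relation.ReflTransGen (fun u w => (u, w) ∈ E) r v := by
  classical
  -- a lowest vertex among the ancestors of `v`
  let S := (R ∪ ((E.map Prod.fst).toFinset ∪ (E.map Prod.snd).toFinset)).filter
    fun u => Relation.ReflTransGen (fun u w => (u, w) ∈ E) u v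
  have hvS : v ∈ S := by
    simp only [S, Finset.mem_filter, Finset.mem_union, List.mem_toFinset, List.mem_map]
    exact ⟨hv.imp_right Or.inr, Relation.ReflTransGen.refl⟩
  obtain ⟨r, hr, hmin⟩ := Finset.exists_min_image S (fun q : Pt => q.1 + q.2) ⟨v, hvS⟩
  have hno : ∀ u, (u, r) ∉ E := by
    intro u hu
    have huS : u ∈ S := by
      simp only [S, Finset.mem_filter, Finset.mem_union, List.mem_toFinset, List.mem_map]
      exact ⟨Or.inr (Or.inl ⟨_, hu, rfl⟩), Relation.ReflTransGen.head hu (Finset.mem_filter.1 hr).2⟩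
    exact absurd (hE.unit _ hu).rank_lt (not_lt.2 (hmin u huS))
  refine ⟨r, ?_, hno, (Finset.mem_filter.1 hr).2⟩
  have hr1 := (Finset.mem_filter.1 hr).1
  simp only [Finset.mem_union, List.mem_toFinset, List.mem_map] at hr1
  rcases hr1 with h | ⟨e, he, rfl⟩ | ⟨e, he, rfl⟩
  · exact h
  · rcases hE.parent e he with h | ⟨e', he', h⟩
    · exact h
    · exact absurd (by rw [← h]; exact he') (hno e'.1)
  · exact absurd he (hno e.1)

/-- A vertex without a parent is an ancestor of each vertex of its component. -/
lemma reflTransGen_of_reachable (hE : D.IsParentList R E) {r v : Pt} (hr : ∀ u, (u, r) ∉ E)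
    (h : hE.forest.graph.Reachable r v) :
    Relation.ReflTransGen (fun u w => (u, w) ∈ E) r v := by
  rw [SimpleGraph.reachable_iff_reflTransGen] at h
  induction h with
  | refl => exact Relation.ReflTransGen.refl
  | @tail b c _ hbc ih =>
    rcases hE.adj_forest_iff.1 hbc with h | h
    · exact ih.tail h
    · cases ih with
      | refl => exact absurd h (hr c)
      | @tail a _ hab hb => rwa [hE.parent_unique h hb]

/-- A descent goes right and up, so that it repeats no vertex and its length telescopes. -/
lemma exists_isPath (hE : D.IsParentList R E) {r v : Pt}
    (h : Relation.ReflTransGen (fun u w => (u, w) ∈ E) r v) :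
    ∃ w : hE.forest.graph.Walk r v, w.IsPath ∧
      hE.forest.walkLength w = (v.1 - r.1) + (v.2 - r.2) ∧
      ∀ u ∈ w.support, u.1 + u.2 ≤ v.1 + v.2 := by
  induction h with
  | refl =>
    exact ⟨SimpleGraph.Walk.nil, by simp, by rw [RectilinearGraph.walkLength_nil]; ring, by simp⟩
  | @tail b c _ hbc ih =>
    obtain ⟨w, h1, h2, h3⟩ := ih
    have hlt := (hE.unit _ hbc).rank_lt
    have hle : b ≤ c := (hE.unit _ hbc).le
    have hadj : hE.forest.graph.Adj b c := hE.adj_forest_iff.2 (Or.inl hbc)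
    refine ⟨w.concat hadj, h1.concat (fun hc => ?_) hadj, ?_, ?_⟩
    · linarith [h3 c hc]
    · rw [RectilinearGraph.walkLength_concat, h2, edgeLength_mk, abs_sub_comm b.1, abs_sub_comm b.2,
        abs_of_nonneg (sub_nonneg.2 hle.1), abs_of_nonneg (sub_nonneg.2 hle.2)]
      ring
    · intro u hu
      rw [SimpleGraph.Walk.support_concat, List.mem_append,
        List.mem_singleton] at hu
      rcases hu with hu | rfl
      · linarith [h3 u hu]
      · exact le_rfl

lemma isRSFA_forest (hE : D.IsParentList R E) (hP : ∀ p ∈ P, p ∈ R ∨ ∃ e ∈ E, e.2 = p) :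
    IsRSFA P R hE.forest := by
  classical
  refine ⟨hE.isAcyclic_forest, ?_, ?_⟩
  · intro q hq
    simp only [forest, Finset.mem_union, List.mem_toFinset, List.mem_map] at hq ⊢
    rcases hq with hq | hq
    · exact (hP q hq).imp_right Or.inr
    · exact Or.inl hq
  · intro v hv
    simp only [forest, Finset.mem_union, List.mem_toFinset, List.mem_map] at hv
    have hv' : v ∈ R ∨ ∃ e ∈ E, e.2 = v := by
      rcases hv with h | ⟨e, he, rfl⟩ | h
      · exact Or.inl h
      · exact hE.parent e he
      · exact Or.inr h
    obtain ⟨r, hr, hno, hrv⟩ := hE.exists_root v hv'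
    obtain ⟨w, -⟩ := hE.exists_isPath hrv
    refine ⟨r, hr, ⟨w⟩, fun p _ hp => ?_⟩
    obtain ⟨w', h1, h2, -⟩ := hE.exists_isPath (hE.reflTransGen_of_reachable hno hp)
    exact ⟨w', h1, h2⟩

lemma nodup_map_mk (hE : D.IsParentList R E) : (E.map fun e => s(e.1, e.2)).Nodup := by
  refine List.Nodup.map_on ?_ (List.Nodup.of_map _ hE.nodup)
  intro e he e' he' h
  rcases Sym2.eq_iff.1 h with h | h
  · exact Prod.ext h.1 h.2
  · have h1 := (hE.unit e he).rank_lt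
    have h2 := (hE.unit e' he').rank_lt
    rw [h.1, h.2] at h1
    linarith

lemma listsEdges_forest (hE : D.IsParentList R E) : ListsEdges E hE.forest :=
  ⟨hE.nodup_map_mk, fun _ => List.mem_toFinset⟩

lemma weight_forest (hE : D.IsParentList R E) :
    hE.forest.weight = (E.map fun e => (e.2.1 - e.1.1) + (e.2.2 - e.1.2)).sum := by
  classical
  rw [RectilinearGraph.weight, forest, List.sum_toFinset _ hE.nodup_map_mk, List.map_map]
  congr 1
  refine List.map_congr_left fun e he => ?_
  have hle : e.1 ≤ e.2 := (hE.unit e he).le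
  rw [Function.comp_apply, edgeLength_mk, abs_sub_comm, abs_sub_comm e.1.2,
    abs_of_nonneg (sub_nonneg.2 hle.1), abs_of_nonneg (sub_nonneg.2 hle.2)]

end IsParentList

/-- The other endpoint of the edge that the decision `d ≠ 0` chooses at the node `t`. -/
noncomputable def parentPt (D : Sweep) (t d : ℕ) : Pt :=
  if d = 1 then (D.X (t / D.h - 1), D.Y (t % D.h)) else (D.X (t / D.h), D.Y (t % D.h - 1))

/-- The edges chosen by the decisions `d` at the first nodes, the latest first. -/
noncomputable def chosen (D : Sweep) (d : ℕ → ℕ) : ℕ → List (Pt × Pt)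
  | 0 => []
  | t + 1 => if d t = 0 then chosen D d t else (D.parentPt t (d t), D.pt t) :: chosen D d t

lemma mem_chosen {d : ℕ → ℕ} {T : ℕ} {e : Pt × Pt} :
    e ∈ D.chosen d T ↔ ∃ t < T, d t ≠ 0 ∧ e = (D.parentPt t (d t), D.pt t) := by
  induction T with
  | zero => simp [chosen]
  | succ T ih =>
    rw [chosen]
    constructor
    · intro h
      split_ifs at h with h0
      · obtain ⟨t, ht, h1⟩ := ih.1 h
        exact ⟨t, by omega, h1⟩
      · rcases List.mem_cons.1 h with h | h
        · exact ⟨T, by omega, h0, h⟩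
        · obtain ⟨t, ht, h1⟩ := ih.1 h
          exact ⟨t, by omega, h1⟩
    · rintro ⟨t, ht, h1, h2⟩
      rcases Nat.lt_succ_iff_lt_or_eq.1 ht with ht | rfl
      · have := ih.2 ⟨t, ht, h1, h2⟩
        split_ifs
        · exact this
        · exact List.mem_cons_of_mem _ this
      · rw [if_neg h1, h2]
        exact List.mem_cons_self

namespace IsRun

variable {A : ℕ → Prop} {d : ℕ → ℕ}

lemma nodup_chosen (hD : D.Valid P R) (hA : D.IsRun A d) {T : ℕ} (hT : T ≤ D.N * D.h) :
    ((D.chosen d T).map Prod.snd).Nodup := by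
  induction T with
  | zero => simp [chosen]
  | succ T ih =>
    rw [chosen]
    split_ifs with h0
    · exact ih (by omega)
    · rw [List.map_cons, List.nodup_cons]
      refine ⟨fun h => ?_, ih (by omega)⟩
      obtain ⟨e, he, heq⟩ := List.mem_map.1 h
      obtain ⟨t, ht, h1, rfl⟩ := mem_chosen.1 he
      have := hA.eq_of_pt_eq hD (show t < _ by omega) (show T < _ by omega) h1 h0 heq
      omega

/-- A connected node that is not a root and has no edge of its own is a copy of a connected node of the
previous copy of its column. -/
lemma mem_root_or_child (hD : D.Valid P R) (hA : D.IsRun A d) {t : ℕ} (ht : t < D.N * D.h)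
    (h : A t) : D.pt t ∈ R ∨ ∃ e ∈ D.chosen d (D.N * D.h), e.2 = D.pt t := by
  induction t using Nat.strong_induction_on with
  | _ t ih =>
    have hdiv : t / D.h < D.N := Nat.div_lt_of_lt_mul (by rwa [mul_comm])
    rcases (hA t ht).2.1 h with h1 | h1 | ⟨h1, h2, h3⟩
    · exact Or.inr ⟨_, mem_chosen.2 ⟨t, ht, h1, rfl⟩, rfl⟩
    · left
      rw [hD.mem_R]
      exact ⟨t / D.h, hdiv, h1.1, by rw [pt, h1.2]⟩
    · have hh : 0 < D.h := Nat.pos_of_ne_zero fun h => by simp [h] at ht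
      have hle : D.h ≤ t := (Nat.div_pos_iff.1 h2).2
      have := ih (t - D.h) (by omega) (by omega) h3
      have hpt : D.pt (t - D.h) = D.pt t := by
        obtain ⟨s, rfl⟩ : ∃ s, t = s + D.h := ⟨t - D.h, by omega⟩
        rw [dx, Nat.add_div_right _ hh] at h1
        simp only [Nat.add_sub_cancel, pt, Nat.add_mod_right, Nat.add_div_right _ hh] at h1 ⊢
        rw [Prod.mk.injEq]
        exact ⟨(sub_eq_zero.1 h1).symm, rfl⟩
      rwa [hpt] at this

lemma isParentList (hI : IsInstance P R) (hD : D.Valid P R) (hA : D.IsRun A d) :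
    D.IsParentList R (D.chosen d (D.N * D.h)) := by
  have hh := hD.h_pos hI
  have key : ∀ t < D.N * D.h, d t ≠ 0 →
      D.IsUnitEdge (D.parentPt t (d t)) (D.pt t) ∧ D.IsNode (D.parentPt t (d t)) ∧
      ∃ s < D.N * D.h, A s ∧ D.parentPt t (d t) = D.pt s := by
    intro t ht hd
    obtain ⟨i, j, hi, hj, rfl⟩ := exists_eq_mul_add ht
    rcases (hA _ ht).1 with h | ⟨h1, h2, h3⟩ | ⟨h1, h2, h3⟩
    · exact absurd h.1 hd
    · rw [mul_add_div' hj] at h2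
      obtain ⟨k, rfl⟩ : ∃ k, i = k + 1 := ⟨i - 1, by omega⟩
      have hpar : D.parentPt ((k + 1) * D.h + j) (d ((k + 1) * D.h + j)) = (D.X k, D.Y j) := by
        rw [parentPt, if_pos h1, mul_add_div' hj, mul_add_mod' hj, Nat.add_sub_cancel]
      have hdx : D.dx ((k + 1) * D.h + j) ≠ 0 := fun h0 => h3 (Or.inr ⟨h0, by
        rw [mul_add_div' hj]; exact h2⟩)
      have hX := hD.X_mono (Nat.le_succ k) hi
      rw [dx, mul_add_div' hj, Nat.add_sub_cancel] at hdx
      rw [hpar]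
      refine ⟨Or.inl ⟨?_, ?_, ?_⟩, ⟨⟨k, by omega, rfl⟩, j, hj, rfl⟩, k * D.h + j,
        mul_add_lt (by omega) hj, ?_, ?_⟩
      · simp [pt, mul_add_mod' hj]
      · simp only [pt, mul_add_div' hj]
        exact lt_of_le_of_ne hX fun h => hdx (by rw [h, sub_self])
      · intro i' hi'
        simp only [pt, mul_add_div' hj]
        rcases Nat.lt_or_ge k i' with h | h
        · exact Or.inr (hD.X_mono h hi')
        · exact Or.inl (hD.X_mono h (by omega))
      · have := h2.2
        rwa [show (k + 1) * D.h + j - D.h = k * D.h + j by rw [add_mul]; omega] at this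
      · rw [pt, mul_add_div' hj, mul_add_mod' hj]
    · rw [mul_add_mod' hj] at h2
      obtain ⟨k, rfl⟩ : ∃ k, j = k + 1 := ⟨j - 1, by omega⟩
      have hk : k < D.h := by omega
      have hpar : D.parentPt (i * D.h + (k + 1)) (d (i * D.h + (k + 1))) = (D.X i, D.Y k) := by
        rw [parentPt, if_neg (by omega), mul_add_div' hj, mul_add_mod' hj, Nat.add_sub_cancel]
      rw [hpar]
      refine ⟨Or.inr ⟨?_, ?_, ?_⟩, ⟨⟨i, by omega, rfl⟩, k, hk, rfl⟩, i * D.h + k,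
        mul_add_lt hi hk, h2.2, ?_⟩
      · simp [pt, mul_add_div' hj]
      · simp only [pt, mul_add_mod' hj]
        exact hD.Y_lt _ _ (Nat.lt_succ_self k) hj
      · intro j' hj'
        simp only [pt, mul_add_mod' hj]
        rcases Nat.lt_or_ge k j' with h | h
        · exact Or.inr (hD.Y_mono h hj')
        · exact Or.inl (hD.Y_mono h hk)
      · rw [pt, mul_add_div' hk, mul_add_mod' hk]
  refine ⟨?_, ?_, ?_, hA.nodup_chosen hD le_rfl, ?_⟩
  · intro e he
    obtain ⟨t, ht, h1, rfl⟩ := mem_chosen.1 he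
    exact (key t ht h1).1
  · intro e he
    obtain ⟨t, ht, h1, rfl⟩ := mem_chosen.1 he
    exact ⟨(key t ht h1).2.1, ⟨t / D.h, Nat.div_lt_of_lt_mul (by rwa [mul_comm]), rfl⟩,
      t % D.h, Nat.mod_lt _ hh, rfl⟩
  · intro r hr
    obtain ⟨i, hi, -, rfl⟩ := (hD.mem_R r).1 hr
    exact ⟨⟨i, hi, rfl⟩, hD.row i hi⟩
  · intro e he
    obtain ⟨t, ht, h1, rfl⟩ := mem_chosen.1 he
    obtain ⟨s, hs, hAs, heq⟩ := (key t ht h1).2.2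
    simp only [heq]
    exact hA.mem_root_or_child hD hs hAs

lemma sum_chosen (hA : D.IsRun A d) {T : ℕ} (hT : T ≤ D.N * D.h) :
    ((D.chosen d T).map fun e => (e.2.1 - e.1.1) + (e.2.2 - e.1.2)).sum =
      ∑ t ∈ Finset.range T, D.cost t (d t) := by
  induction T with
  | zero => simp [chosen]
  | succ T ih =>
    rw [chosen, Finset.sum_range_succ, ← ih (by omega)]
    rcases (hA T (by omega)).1 with ⟨h, -⟩ | ⟨h, -⟩ | ⟨h, -⟩
    · simp [h, cost]
    · simp [h, cost, parentPt, pt, dx, add_comm]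
    · simp [h, cost, parentPt, pt, dy, add_comm]

end IsRun

/-- A legal sweep builds a forest whose weight is the cost of the sweep. -/
lemma IsStateRun.exists_forest (hI : IsInstance P R) (hD : D.Valid P R) {S d : ℕ → ℕ}
    (hS : D.IsStateRun S d) :
    ∃ F, ListsEdges (D.chosen d (D.N * D.h)) F ∧ IsRSFA P R F ∧
      F.weight = ∑ t ∈ Finset.range (D.N * D.h), D.cost t (d t) := by
  have hA := hS.isRun (hD.h_pos hI)
  have hE := hA.isParentList hI hD
  refine ⟨hE.forest, hE.listsEdges_forest, hE.isRSFA_forest fun p hp => ?_, ?_⟩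
  · obtain ⟨i, hi, hpt, rfl⟩ := (hD.mem_P p).1 hp
    obtain ⟨j, hj, hY⟩ := hD.row i hi
    have ht := mul_add_lt hi hj
    have hpoint : D.PointAt (i * D.h + j) := by
      rw [PointAt, mul_add_div' hj, mul_add_mod' hj]
      exact ⟨hpt, hY⟩
    have := hA.mem_root_or_child hD ht ((hA _ ht).2.2 (by
      rcases (hA _ ht).1 with h | h | h
      · exact Or.inr (h.2 hpoint)
      · exact Or.inl (by omega)
      · exact Or.inl (by omega)))
    rwa [pt, mul_add_div' hj, mul_add_mod' hj, hY] at this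
  · rw [hE.weight_forest, hA.sum_chosen le_rfl]

end Sweep

/-! ### Dynamic programming over the states -/

/-- The candidate value that buys an edge of length `w` before continuing with the value `v`, if it is
feasible and better than the value `x`.  The first component of a value is the cost, where a negative
number stands for infeasibility; the second component is the sequence of decisions, coded as a
fraction in base three. -/
noncomputable def relax (v x : ℝ × ℝ) (w : ℝ) (k : ℕ) : ℝ × ℝ :=
  open Classical in
  if 0 ≤ v.1 ∧ ¬ (0 ≤ x.1 ∧ x.1 ≤ v.1 + w) then (v.1 + w, (v.2 + k) / 3) else x

lemma relax_of_le {v x : ℝ × ℝ} {w : ℝ} {k : ℕ} (h : 0 ≤ v.1 → 0 ≤ x.1 ∧ x.1 ≤ v.1 + w) :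
    relax v x w k = x :=
  if_neg fun h' => h'.2 (h h'.1)

lemma relax_le_left {v x : ℝ × ℝ} {w : ℝ} {k : ℕ} (hw : 0 ≤ w) (hv : 0 ≤ v.1) :
    0 ≤ (relax v x w k).1 ∧ (relax v x w k).1 ≤ v.1 + w := by
  unfold relax
  split_ifs with h
  · exact ⟨by simp only; linarith, le_rfl⟩
  · by_contra h'
    exact h ⟨hv, h'⟩

lemma relax_le_right {v x : ℝ × ℝ} {w : ℝ} {k : ℕ} (hw : 0 ≤ w) (hx : 0 ≤ x.1) :
    0 ≤ (relax v x w k).1 ∧ (relax v x w k).1 ≤ x.1 := by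
  unfold relax
  split_ifs with h
  · refine ⟨by simp only; linarith [h.1], ?_⟩
    have : v.1 + w < x.1 := by
      by_contra h'
      exact h.2 ⟨hx, not_lt.1 h'⟩
    exact this.le
  · exact ⟨hx, le_rfl⟩

namespace Sweep

variable {D : Sweep} {P R : Finset Pt}

/-- The value of a state at the node `t` without an edge at `t`; `l` says that the node to the left is
connected, and `v₀` and `v₁` are the values of the states in which `t` is not, or is connected. -/
noncomputable def baseValue (D : Sweep) (t : ℕ) (l : Prop) (v₀ v₁ : ℝ × ℝ) : ℝ × ℝ :=
  open Classical in
  if D.Free t l then (v₁.1, v₁.2 / 3) else if D.PointAt t then (-1, 0) else (v₀.1, v₀.2 / 3)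

/-- One backward step of the dynamic program. -/
noncomputable def update (D : Sweep) (t : ℕ) (V : ℕ → ℝ × ℝ) (S : ℕ) : ℝ × ℝ :=
  open Classical in
  let v₁ := V (setBit S (t % D.h))
  let x := D.baseValue t (S.testBit (t % D.h)) (V (clearBit S (t % D.h))) v₁
  let y := if S.testBit (t % D.h) then relax v₁ x (D.dx t) 1 else x
  if D.Down t S then relax v₁ y (D.dy t) 2 else y

/-- The values of all states before the last `n` nodes. -/
noncomputable def valueRev (D : Sweep) : ℕ → ℕ → ℝ × ℝ
  | 0 => fun _ => (0, 0)
  | n + 1 => D.update (D.N * D.h - (n + 1)) (valueRev D n)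

/-- The value of the state `S` before the node `t`. -/
noncomputable def value (D : Sweep) (t : ℕ) : ℕ → ℝ × ℝ := D.valueRev (D.N * D.h - t)

lemma value_end : D.value (D.N * D.h) = fun _ => (0, 0) := by
  rw [value, Nat.sub_self, valueRev]

lemma value_eq {t : ℕ} (ht : t < D.N * D.h) : D.value t = D.update t (D.value (t + 1)) := by
  rw [value, value, show D.N * D.h - t = (D.N * D.h - (t + 1)) + 1 by omega, valueRev]
  congr 1
  omega

lemma next_zero_of_not_free {t S : ℕ} (h : ¬ D.Free t (S.testBit (t % D.h))) :
    D.next t S 0 = clearBit S (t % D.h) := by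
  rw [next, if_neg (by simpa using h)]

lemma next_of_free {t S d : ℕ} (h : D.Free t (S.testBit (t % D.h))) :
    D.next t S d = setBit S (t % D.h) := by
  rw [next, if_pos (Or.inr h)]

lemma next_of_ne_zero {t S d : ℕ} (h : d ≠ 0) : D.next t S d = setBit S (t % D.h) := by
  rw [next, if_pos (Or.inl h)]

lemma update_of_free {t S : ℕ} {V : ℕ → ℝ × ℝ} (hx : 0 ≤ D.dx t) (hy : 0 ≤ D.dy t)
    (h : D.Free t (S.testBit (t % D.h))) :
    D.update t V S = ((V (setBit S (t % D.h))).1, (V (setBit S (t % D.h))).2 / 3) := by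
  unfold update baseValue
  simp only [if_pos h]
  have h1 : ∀ w k, 0 ≤ w → relax (V (setBit S (t % D.h)))
      ((V (setBit S (t % D.h))).1, (V (setBit S (t % D.h))).2 / 3) w k =
      ((V (setBit S (t % D.h))).1, (V (setBit S (t % D.h))).2 / 3) :=
    fun w k hw => relax_of_le fun hv => ⟨hv, by simp only; linarith⟩
  simp only [h1 _ _ hx, h1 _ _ hy, ite_self]

/-- The value of a state comes from a decision. -/
lemma exists_decision {t S : ℕ} {V : ℕ → ℝ × ℝ} (hx : 0 ≤ D.dx t) (hy : 0 ≤ D.dy t)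
    (hV : ∀ S, 0 ≤ (V S).2 ∧ (V S).2 < 1) :
    (0 ≤ (D.update t V S).2 ∧ (D.update t V S).2 < 1) ∧
    (0 ≤ (D.update t V S).1 → ∃ d ≤ 2, D.Legal t (S.testBit (t % D.h)) (D.Down t S) d ∧
      0 ≤ (V (D.next t S d)).1 ∧ (D.update t V S).1 = D.cost t d + (V (D.next t S d)).1 ∧
      (D.update t V S).2 = ((V (D.next t S d)).2 + d) / 3) := by
  by_cases hf : D.Free t (S.testBit (t % D.h))
  · rw [update_of_free hx hy hf]
    have h1 := hV (setBit S (t % D.h))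
    refine ⟨⟨by simp only; linarith, by simp only; linarith⟩, fun h0 => ⟨0, by omega,
      Or.inl ⟨rfl, fun _ => hf⟩, ?_, ?_, ?_⟩⟩
    · rw [next_of_free hf]; exact h0
    · rw [next_of_free hf]; simp [cost]
    · rw [next_of_free hf]; simp
  · have key : ∀ x : ℝ × ℝ, (x = D.baseValue t (S.testBit (t % D.h)) (V (clearBit S (t % D.h)))
          (V (setBit S (t % D.h))) ∨
        (S.testBit (t % D.h) ∧ 0 ≤ (V (setBit S (t % D.h))).1 ∧
          x = ((V (setBit S (t % D.h))).1 + D.dx t, ((V (setBit S (t % D.h))).2 + (1 : ℕ)) / 3)) ∨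
        (D.Down t S ∧ 0 ≤ (V (setBit S (t % D.h))).1 ∧
          x = ((V (setBit S (t % D.h))).1 + D.dy t, ((V (setBit S (t % D.h))).2 + (2 : ℕ)) / 3))) →
        (0 ≤ x.2 ∧ x.2 < 1) ∧
        (0 ≤ x.1 → ∃ d ≤ 2, D.Legal t (S.testBit (t % D.h)) (D.Down t S) d ∧
          0 ≤ (V (D.next t S d)).1 ∧ x.1 = D.cost t d + (V (D.next t S d)).1 ∧
          x.2 = ((V (D.next t S d)).2 + d) / 3) := by
      have h1 := hV (setBit S (t % D.h))
      have h2 := hV (clearBit S (t % D.h))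
      rintro x (rfl | ⟨hl, h0, rfl⟩ | ⟨hb, h0, rfl⟩)
      · unfold baseValue
        rw [if_neg hf]
        split_ifs with hp
        · exact ⟨by norm_num, fun h => absurd h (by norm_num)⟩
        · refine ⟨⟨by simp only; linarith, by simp only; linarith⟩, fun h0 => ⟨0, by omega,
            Or.inl ⟨rfl, fun h => absurd h hp⟩, ?_, ?_, ?_⟩⟩
          · rw [next_zero_of_not_free hf]; exact h0
          · rw [next_zero_of_not_free hf]; simp [cost]
          · rw [next_zero_of_not_free hf]; simp
      · refine ⟨⟨by push_cast; linarith, by push_cast; linarith⟩, fun _ => ⟨1, by omega,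
          Or.inr (Or.inl ⟨rfl, hl, hf⟩), ?_⟩⟩
        rw [next_of_ne_zero one_ne_zero]
        exact ⟨h0, by simp [cost, add_comm], rfl⟩
      · refine ⟨⟨by push_cast; linarith, by push_cast; linarith⟩, fun _ => ⟨2, by omega,
          Or.inr (Or.inr ⟨rfl, hb, hf⟩), ?_⟩⟩
        rw [next_of_ne_zero two_ne_zero]
        exact ⟨h0, by simp [cost, add_comm], rfl⟩
    refine key _ ?_
    unfold update relax
    dsimp only
    split_ifs <;> tauto

/-- The value of a state is at most the value of each legal decision. -/
lemma update_le {t S d : ℕ} {V : ℕ → ℝ × ℝ} (hx : 0 ≤ D.dx t) (hy : 0 ≤ D.dy t)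
    (hd : D.Legal t (S.testBit (t % D.h)) (D.Down t S) d) (h0 : 0 ≤ (V (D.next t S d)).1) :
    0 ≤ (D.update t V S).1 ∧ (D.update t V S).1 ≤ D.cost t d + (V (D.next t S d)).1 := by
  classical
  by_cases hf : D.Free t (S.testBit (t % D.h))
  · have hd0 : d = 0 := by
      rcases hd with h | h | h
      · exact h.1
      · exact absurd hf h.2.2
      · exact absurd hf h.2.2
    subst hd0
    rw [update_of_free hx hy hf]
    rw [next_of_free hf] at h0 ⊢
    exact ⟨h0, by simp [cost]⟩
  · unfold update
    dsimp only
    -- `x`, `y` and the final value are the best ones without an edge, also with the edge to the left,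
    -- and also with the edge downwards
    set v₁ := V (setBit S (t % D.h))
    set x := D.baseValue t (S.testBit (t % D.h)) (V (clearBit S (t % D.h))) v₁ with hxdef
    set y := if S.testBit (t % D.h) then relax v₁ x (D.dx t) 1 else x with hydef
    have hxy : 0 ≤ x.1 → 0 ≤ y.1 ∧ y.1 ≤ x.1 := by
      intro h
      rw [hydef]
      split_ifs
      · exact relax_le_right hx h
      · exact ⟨h, le_rfl⟩
    have hyz : 0 ≤ y.1 → 0 ≤ (if D.Down t S then relax v₁ y (D.dy t) 2 else y).1 ∧
        (if D.Down t S then relax v₁ y (D.dy t) 2 else y).1 ≤ y.1 := by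
      intro h
      split_ifs
      · exact relax_le_right hy h
      · exact ⟨h, le_rfl⟩
    rcases hd with ⟨rfl, hp⟩ | ⟨rfl, hl, -⟩ | ⟨rfl, hb, -⟩
    · have hxe : x.1 = (V (clearBit S (t % D.h))).1 := by
        rw [hxdef, baseValue, if_neg hf, if_neg fun h => hf (hp h)]
      rw [next_zero_of_not_free hf] at h0 ⊢
      rw [← hxe] at h0 ⊢
      have h1 := hxy h0
      have h2 := hyz h1.1
      refine ⟨h2.1, ?_⟩
      simp only [cost]; norm_num
      linarith
    · rw [next_of_ne_zero one_ne_zero] at h0 ⊢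
      have h1 : 0 ≤ y.1 ∧ y.1 ≤ v₁.1 + D.dx t := by
        rw [hydef, if_pos hl]
        exact relax_le_left hx h0
      have h2 := hyz h1.1
      refine ⟨h2.1, ?_⟩
      simp only [cost, if_true]
      linarith
    · rw [next_of_ne_zero two_ne_zero] at h0 ⊢
      rw [if_pos hb]
      have := relax_le_left (x := y) (k := 2) hy h0
      refine ⟨this.1, this.2.trans (le_of_eq ?_)⟩
      simp [cost, add_comm]

/-- The code of a decision sequence is a base-three fraction in `[0, 1)`. -/
lemma value_snd_mem (hI : IsInstance P R) (hD : D.Valid P R) {t : ℕ} (ht : t ≤ D.N * D.h) (S : ℕ) :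
    0 ≤ (D.value t S).2 ∧ (D.value t S).2 < 1 := by
  induction ht using Nat.decreasingInduction generalizing S with
  | of_succ t ht ih =>
    rw [value_eq ht]
    exact (exists_decision (hD.dx_nonneg ht) (hD.dy_nonneg (hD.h_pos hI) t) ih).1
  | self => rw [value_end]; simp

/-- The value of a state is a lower bound for the remaining cost of a run through it. -/
lemma value_le_of_isStateRun (hI : IsInstance P R) (hD : D.Valid P R) {S d : ℕ → ℕ}
    (hS : D.IsStateRun S d) {t : ℕ} (ht : t ≤ D.N * D.h) :
    0 ≤ (D.value t (S t)).1 ∧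
      (D.value t (S t)).1 + ∑ s ∈ Finset.range t, D.cost s (d s) ≤
        ∑ s ∈ Finset.range (D.N * D.h), D.cost s (d s) := by
  induction ht using Nat.decreasingInduction with
  | of_succ t ht ih =>
    obtain ⟨h1, h2⟩ := hS.2 t ht
    rw [h2, Finset.sum_range_succ] at ih
    have := update_le (hD.dx_nonneg ht) (hD.dy_nonneg (hD.h_pos hI) t) h1 ih.1
    rw [value_eq ht]
    exact ⟨this.1, by linarith [this.2, ih.2]⟩
  | self => rw [value_end]; simp

/-- The coded decision sequence in the value of the initial state decodes to the decisions of an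
optimal sweep. -/
lemma exists_optimal_run (hI : IsInstance P R) (hD : D.Valid P R) :
    ∃ S d, D.IsStateRun S d ∧ (∀ t < D.N * D.h, d t ≤ 2 ∧
      3 * (D.value t (S t)).2 = (D.value (t + 1) (S (t + 1))).2 + d t) ∧
      ∀ S' d', D.IsStateRun S' d' →
        ∑ t ∈ Finset.range (D.N * D.h), D.cost t (d t) ≤
          ∑ t ∈ Finset.range (D.N * D.h), D.cost t (d' t) := by
  have hdec : ∀ t S, ∃ d, t < D.N * D.h → 0 ≤ (D.value t S).1 →
      d ≤ 2 ∧ D.Legal t (S.testBit (t % D.h)) (D.Down t S) d ∧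
      0 ≤ (D.value (t + 1) (D.next t S d)).1 ∧
      (D.value t S).1 = D.cost t d + (D.value (t + 1) (D.next t S d)).1 ∧
      (D.value t S).2 = ((D.value (t + 1) (D.next t S d)).2 + d) / 3 := by
    intro t S
    by_cases h : t < D.N * D.h ∧ 0 ≤ (D.value t S).1
    · obtain ⟨ht, h0⟩ := h
      rw [value_eq ht] at h0
      obtain ⟨d, h⟩ := (exists_decision (hD.dx_nonneg ht) (hD.dy_nonneg (hD.h_pos hI) t)
        (value_snd_mem hI hD ht)).2 h0
      exact ⟨d, fun _ _ => by rw [value_eq ht]; exact h⟩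
    · exact ⟨0, fun h1 h2 => absurd ⟨h1, h2⟩ h⟩
  choose g hg using hdec
  let S : ℕ → ℕ := fun t => Nat.rec 0 (fun t S => D.next t S (g t S)) t
  have hS0 : S 0 = 0 := rfl
  have hS1 : ∀ t, S (t + 1) = D.next t (S t) (g t (S t)) := fun _ => rfl
  -- some run is legal, so the initial state is feasible
  obtain ⟨S₁, d₁, hrun₁⟩ := exists_isStateRun hI hD
  have hinit : 0 ≤ (D.value 0 0).1 := by
    have := (value_le_of_isStateRun hI hD hrun₁ (Nat.zero_le _)).1
    rwa [hrun₁.1] at this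
  have key : ∀ t ≤ D.N * D.h, 0 ≤ (D.value t (S t)).1 ∧
      (D.value 0 0).1 = ∑ s ∈ Finset.range t, D.cost s (g s (S s)) + (D.value t (S t)).1 := by
    intro t
    induction t with
    | zero => intro _; rw [hS0]; simpa using hinit
    | succ t ih =>
      intro ht
      obtain ⟨h1, h2⟩ := ih (by omega)
      obtain ⟨-, -, h3, h4, -⟩ := hg t (S t) ht h1
      rw [hS1, Finset.sum_range_succ]
      exact ⟨h3, by linarith⟩
  refine ⟨S, fun t => g t (S t), ⟨hS0, fun t ht => ?_⟩, fun t ht => ?_, fun S' d' h' => ?_⟩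
  · exact ⟨(hg t (S t) ht (key t ht.le).1).2.1, hS1 t⟩
  · obtain ⟨h1, -, -, -, h2⟩ := hg t (S t) ht (key t ht.le).1
    refine ⟨h1, ?_⟩
    rw [h2, hS1]
    ring
  · have h1 := (key _ le_rfl).2
    have h2 := (value_le_of_isStateRun hI hD h' (Nat.zero_le _)).2
    rw [h'.1] at h2
    rw [value_end] at h1
    simp only [Finset.range_zero, Finset.sum_empty, add_zero] at h1 h2
    linarith

/-- Decoding `(D.value 0 0).2` in base three yields the edges of an optimal forest. -/
theorem exists_optimal_decisions (hI : IsInstance P R) (hD : D.Valid P R) :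
    ∃ (r : ℕ → ℝ) (d : ℕ → ℕ), r 0 = (D.value 0 0).2 ∧
      (∀ t < D.N * D.h, d t ≤ 2 ∧ 3 * r t = r (t + 1) + d t) ∧
      (∀ t ≤ D.N * D.h, 0 ≤ r t ∧ r t < 1) ∧
      ∃ F, ListsEdges (D.chosen d (D.N * D.h)) F ∧ IsOptimalRSFA P R F := by
  obtain ⟨S, d, hrun, hdec, hopt⟩ := exists_optimal_run hI hD
  obtain ⟨F, hF, hF', hw⟩ := hrun.exists_forest hI hD
  refine ⟨fun t => (D.value t (S t)).2, d, by simp only [hrun.1], hdec,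
    fun t ht => value_snd_mem hI hD ht _, F, hF, hF', fun F' h' => ?_⟩
  obtain ⟨S', d', hrun', hle⟩ := exists_isStateRun_cost_le hI hD h'
  rw [hw]
  exact (hopt S' d' hrun').trans hle

end Sweep

/-! ### Total correctness of programs with time bounds -/

/-- Started in `s`, the program `c` halts within `T` steps in a store that satisfies `Q`. -/
def Runs (inp : List (Pt × Bool)) (cap word : ℕ) (c : Prog) (s : Store) (T : ℕ) (Q : Store → Prop) :
    Prop :=
  ∃ t s', Exec inp cap word c s t s' ∧ t ≤ T ∧ Q s'

/-- The weakest precondition of a program without loops (and `False` for a program with a loop). -/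
def wp (inp : List (Pt × Bool)) (cap word : ℕ) : Prog → (Store → Prop) → Store → Prop
  | .skip, Q, s => Q s
  | .iset x e, Q, s => e.eval s ≤ word ∧ Q { s with ireg := Function.update s.ireg x (e.eval s) }
  | .rset x e, Q, s => Q { s with rreg := Function.update s.rreg x (e.eval s) }
  | .iload x a, Q, s =>
      a.eval s < cap ∧ Q { s with ireg := Function.update s.ireg x (s.imem (a.eval s)) }
  | .istore a e, Q, s => a.eval s < cap ∧ e.eval s ≤ word ∧
      Q { s with imem := Function.update s.imem (a.eval s) (e.eval s) }
  | .rload x a, Q, s =>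
      a.eval s < cap ∧ Q { s with rreg := Function.update s.rreg x (s.rmem (a.eval s)) }
  | .rstore a e, Q, s => a.eval s < cap ∧
      Q { s with rmem := Function.update s.rmem (a.eval s) (e.eval s) }
  | .inputLength x, Q, s => inp.length ≤ word ∧
      Q { s with ireg := Function.update s.ireg x inp.length }
  | .inputX x i, Q, s => ∃ h : i.eval s < inp.length,
      Q { s with rreg := Function.update s.rreg x (inp[i.eval s]'h).1.1 }
  | .inputY x i, Q, s => ∃ h : i.eval s < inp.length,
      Q { s with rreg := Function.update s.rreg x (inp[i.eval s]'h).1.2 }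
  | .inputRoot x i, Q, s => ∃ h : i.eval s < inp.length, 1 ≤ word ∧
      Q { s with ireg := Function.update s.ireg x (inp[i.eval s]'h).2.toNat }
  | .emit a b c d, Q, s =>
      Q { s with out := ((a.eval s, b.eval s), (c.eval s, d.eval s)) :: s.out }
  | .seq c₁ c₂, Q, s => wp inp cap word c₁ (wp inp cap word c₂ Q) s
  | .ite b c₁ c₂, Q, s =>
      (b.Holds s → wp inp cap word c₁ Q s) ∧ (¬ b.Holds s → wp inp cap word c₂ Q s)
  | .while _ _, _, _ => False

/-- The number of steps of a program without loops. -/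
def Prog.steps : Prog → ℕ
  | .seq c₁ c₂ => c₁.steps + c₂.steps
  | .ite _ c₁ c₂ => max c₁.steps c₂.steps + 1
  | _ => 1

variable {inp : List (Pt × Bool)} {cap word : ℕ}

namespace Runs

variable {c c₁ c₂ : Prog} {s : Store} {T T₁ T₂ : ℕ} {Q Q' : Store → Prop}

lemma mono (h : Runs inp cap word c s T Q) {T' : ℕ} (hT : T ≤ T') (hQ : ∀ s, Q s → Q' s) :
    Runs inp cap word c s T' Q' := by
  obtain ⟨t, s', h1, h2, h3⟩ := h
  exact ⟨t, s', h1, h2.trans hT, hQ _ h3⟩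

lemma seq (h₁ : Runs inp cap word c₁ s T₁ Q')
    (h₂ : ∀ s', Q' s' → Runs inp cap word c₂ s' T₂ Q) :
    Runs inp cap word (.seq c₁ c₂) s (T₁ + T₂) Q := by
  obtain ⟨t₁, s₁, e₁, l₁, q₁⟩ := h₁
  obtain ⟨t₂, s₂, e₂, l₂, q₂⟩ := h₂ _ q₁
  exact ⟨_, s₂, .seq e₁ e₂, by omega, q₂⟩

lemma of_wp (h : wp inp cap word c Q s) : Runs inp cap word c s c.steps Q := by
  induction c generalizing s Q with
  | skip => exact ⟨_, _, .skip s, le_rfl, h⟩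
  | iset x e => exact ⟨_, _, .iset s x e h.1, le_rfl, h.2⟩
  | rset x e => exact ⟨_, _, .rset s x e, le_rfl, h⟩
  | iload x a => exact ⟨_, _, .iload s x a h.1, le_rfl, h.2⟩
  | istore a e => exact ⟨_, _, .istore s a e h.1 h.2.1, le_rfl, h.2.2⟩
  | rload x a => exact ⟨_, _, .rload s x a h.1, le_rfl, h.2⟩
  | rstore a e => exact ⟨_, _, .rstore s a e h.1, le_rfl, h.2⟩
  | inputLength x => exact ⟨_, _, .inputLength s x h.1, le_rfl, h.2⟩
  | inputX x i => exact ⟨_, _, .inputX s x i h.1, le_rfl, h.2⟩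
  | inputY x i => exact ⟨_, _, .inputY s x i h.1, le_rfl, h.2⟩
  | inputRoot x i => exact ⟨_, _, .inputRoot s x i h.1 h.2.1, le_rfl, h.2.2⟩
  | emit a b c d => exact ⟨_, _, .emit s a b c d, le_rfl, h⟩
  | seq c₁ c₂ ih₁ ih₂ => exact (ih₁ h).seq fun _ h' => ih₂ h'
  | ite b c₁ c₂ ih₁ ih₂ =>
    by_cases hb : b.Holds s
    · obtain ⟨t, s', e, l, q⟩ := ih₁ (h.1 hb)
      exact ⟨_, s', .ite_true hb e, Nat.succ_le_succ (l.trans (le_max_left _ _)), q⟩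
    · obtain ⟨t, s', e, l, q⟩ := ih₂ (h.2 hb)
      exact ⟨_, s', .ite_false hb e, Nat.succ_le_succ (l.trans (le_max_right _ _)), q⟩
  | _ => exact h.elim

lemma of_wp_le (hT : c.steps ≤ T) (h : wp inp cap word c Q s) : Runs inp cap word c s T Q :=
  (of_wp h).mono hT fun _ h => h

lemma wp_seq (h : wp inp cap word c₁ (fun s' => Runs inp cap word c₂ s' T Q) s) :
    Runs inp cap word (.seq c₁ c₂) s (c₁.steps + T) Q :=
  (of_wp h).seq fun _ h' => h'

/-- A loop with the invariant `I k` after `k` iterations. -/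
lemma while_range {b : BExpr} (I : ℕ → Store → Prop) (n B : ℕ) (h0 : I 0 s)
    (hstep : ∀ k < n, ∀ s, I k s → b.Holds s ∧ Runs inp cap word c s B (I (k + 1)))
    (hend : ∀ s, I n s → ¬ b.Holds s) :
    Runs inp cap word (.while b c) s (n * (B + 1) + 1) (I n) := by
  have key : ∀ m k, k + m = n → ∀ s, I k s →
      Runs inp cap word (.while b c) s (m * (B + 1) + 1) (I n) := by
    intro m
    induction m with
    | zero =>
      intro k hk s hs
      simp only [add_zero] at hk
      subst hk
      exact ⟨_, s, .while_false (hend s hs), by omega, hs⟩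
    | succ m ih =>
      intro k hk s hs
      obtain ⟨hb, t₁, s₁, e₁, l₁, q₁⟩ := hstep k (by omega) s hs
      obtain ⟨t₂, s₂, e₂, l₂, q₂⟩ := ih (k + 1) (by omega) s₁ q₁
      refine ⟨_, s₂, .while_true hb e₁ e₂, ?_, q₂⟩
      rw [add_mul]
      omega
  exact key n 0 (by omega) s h0

end Runs

infixr:50 " ;; " => Prog.seq

/-! ### Listing the horizontal lines -/

/-- Look for the lowest input point above the height in real register 12: integer register 8 tells
whether there is one, and real register 13 is its height. -/
def findNextLine : Prog :=
  .while (.ile (.add (.reg 9) (.const 1)) (.reg 0)) (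
    .inputY 14 (.reg 9) ;;
    .ite (.and (.not (.rle (.reg 14) (.reg 12)))
        (.not (.and (.ile (.const 1) (.reg 8)) (.rle (.reg 13) (.reg 14)))))
      (.rset 13 (.reg 14) ;; .iset 8 (.const 1)) .skip ;;
    .iset 9 (.add (.reg 9) (.const 1)))

/-- Store the heights of the horizontal lines in increasing order at the addresses `0, …, h - 1` of the
real memory and the powers `2 ^ 0, …, 2 ^ (h - 1)` at those of the integer memory.  At the end, the
integer registers 0, 1 and 2 hold the number of input points, `h` and `2 ^ h`. -/
def listLines : Prog :=
  (.inputLength 0 ;; .iset 2 (.const 1) ;; .iset 8 (.const 1) ;; .rset 12 (.const (-1))) ;;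
  .while (.ile (.const 1) (.reg 8)) (
    (.iset 8 (.const 0) ;; .iset 9 (.const 0)) ;;
    findNextLine ;;
    .ite (.ile (.const 1) (.reg 8))
      (.rstore (.reg 1) (.reg 13) ;; .istore (.reg 1) (.reg 2) ;;
       .iset 1 (.add (.reg 1) (.const 1)) ;; .iset 2 (.mul (.const 2) (.reg 2)) ;;
       .rset 12 (.reg 13)) .skip)

/-- `f` tells whether some height in `l` exceeds `y`, and then `b` is the least such height. -/
def IsNextHeight (l : List (Pt × Bool)) (y : ℝ) (f : ℕ) (b : ℝ) : Prop :=
  (f = 0 ∧ ∀ q ∈ l, q.1.2 ≤ y) ∨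
    (f = 1 ∧ y < b ∧ (∃ q ∈ l, q.1.2 = b) ∧ ∀ q ∈ l, q.1.2 ≤ y ∨ b ≤ q.1.2)

lemma IsNextHeight.append_new {l : List (Pt × Bool)} {y b : ℝ} {f : ℕ} (h : IsNextHeight l y f b)
    {q : Pt × Bool} (h1 : y < q.1.2) (h2 : 1 ≤ f → q.1.2 < b) :
    IsNextHeight (l ++ [q]) y 1 q.1.2 := by
  refine Or.inr ⟨rfl, h1, ⟨q, by simp, rfl⟩, fun q' hq' => ?_⟩
  rcases List.mem_append.1 hq' with hq' | hq'
  · rcases h with h | h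
    · exact Or.inl (h.2 _ hq')
    · exact (h.2.2.2 _ hq').imp_right fun h' => (h2 h.1.ge).le.trans h'
  · rw [List.mem_singleton.1 hq']
    exact Or.inr le_rfl

lemma IsNextHeight.append_old {l : List (Pt × Bool)} {y b : ℝ} {f : ℕ} (h : IsNextHeight l y f b)
    {q : Pt × Bool} (hq : y < q.1.2 → 1 ≤ f ∧ b ≤ q.1.2) : IsNextHeight (l ++ [q]) y f b := by
  rcases h with h | h
  · refine Or.inl ⟨h.1, fun q' hq' => ?_⟩
    rcases List.mem_append.1 hq' with hq' | hq'
    · exact h.2 _ hq'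
    · rw [List.mem_singleton.1 hq']
      by_contra hlt
      have := (hq (not_le.1 hlt)).1
      omega
  · obtain ⟨q', hq', hb⟩ := h.2.2.1
    refine Or.inr ⟨h.1, h.2.1, ⟨q', List.mem_append_left _ hq', hb⟩, fun q' hq' => ?_⟩
    rcases List.mem_append.1 hq' with hq' | hq'
    · exact h.2.2.2 _ hq'
    · rw [List.mem_singleton.1 hq']
      by_cases hlt : q.1.2 ≤ y
      · exact Or.inl hlt
      · exact Or.inr (hq (not_le.1 hlt)).2

lemma runs_findNextLine (hN : inp.length ≤ word) {s : Store}
    (h0 : s.ireg 0 = inp.length) (h8 : s.ireg 8 = 0) (h9 : s.ireg 9 = 0) :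
    Runs inp cap word findNextLine s (inp.length * 7 + 1) fun s' =>
      (∀ k < 8, s'.ireg k = s.ireg k) ∧ s'.rreg 12 = s.rreg 12 ∧ s'.imem = s.imem ∧
      s'.rmem = s.rmem ∧ s'.out = s.out ∧
      IsNextHeight inp (s.rreg 12) (s'.ireg 8) (s'.rreg 13) := by
  let I : ℕ → Store → Prop := fun n s' =>
    s'.ireg 9 = n ∧ (∀ k < 8, s'.ireg k = s.ireg k) ∧ s'.rreg 12 = s.rreg 12 ∧ s'.imem = s.imem ∧
      s'.rmem = s.rmem ∧ s'.out = s.out ∧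
      IsNextHeight (inp.take n) (s.rreg 12) (s'.ireg 8) (s'.rreg 13)
  refine (Runs.while_range I inp.length 6 ?_ ?_ ?_).mono le_rfl ?_
  · exact ⟨h9, fun _ _ => rfl, rfl, rfl, rfl, rfl, Or.inl ⟨h8, by simp⟩⟩
  · rintro n hn s' ⟨i9, ireg, r12, im, rm, o, hbest⟩
    have i0 : s'.ireg 0 = inp.length := by rw [ireg 0 (by omega), h0]
    have htake : inp.take (n + 1) = inp.take n ++ [inp[n]] := by simp
    refine ⟨by simp only [BExpr.Holds, IExpr.eval]; omega, Runs.of_wp_le (by decide) ?_⟩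
    simp only [wp, IExpr.eval, RExpr.eval, BExpr.Holds, i9, Function.update_self]
    refine ⟨hn, ?_, ?_⟩
    · rintro ⟨hc1, hc2⟩
      simp [r12] at hc1 hc2
      dsimp only [I]
      refine ⟨by omega, by simp [i9]; omega, by simp [i9], fun k hk => ?_, by simp [r12], im, rm, o, ?_⟩
      · rw [Function.update_of_ne (by omega), Function.update_of_ne (by omega), ireg k hk]
      · rw [htake]
        simpa using hbest.append_new hc1 hc2
    · intro hc
      simp [r12] at hc
      dsimp only [I]
      refine ⟨by omega, by simp, fun k hk => ?_, by simp [r12], im, rm, o, ?_⟩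
      · rw [Function.update_of_ne (by omega), ireg k hk]
      · rw [htake]
        simpa using hbest.append_old hc
  · rintro s' ⟨i9, ireg, -⟩
    have i0 : s'.ireg 0 = inp.length := by rw [ireg 0 (by omega), h0]
    simp only [BExpr.Holds, IExpr.eval]
    omega
  · rintro s' ⟨-, h⟩
    rwa [List.take_length] at h

/-- The input has the horizontal lines of the sweep `D`. -/
structure HasLines (inp : List (Pt × Bool)) (D : Sweep) : Prop where
  length_eq : inp.length = D.N
  Y_nonneg : ∀ j < D.h, 0 ≤ D.Y j
  Y_lt : ∀ j j', j < j' → j' < D.h → D.Y j < D.Y j'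
  row : ∀ q ∈ inp, ∃ j < D.h, D.Y j = q.1.2
  row_used : ∀ j < D.h, ∃ q ∈ inp, q.1.2 = D.Y j

lemma HasLines.isNextHeight {D : Sweep} (hL : HasLines inp D) {j : ℕ} (hj : j ≤ D.h) {y b : ℝ} {f : ℕ}
    (hlow : ∀ k < j, D.Y k ≤ y) (hhigh : ∀ k, j ≤ k → k < D.h → y < D.Y k)
    (h : IsNextHeight inp y f b) : (j < D.h → f = 1 ∧ b = D.Y j) ∧ (j = D.h → f = 0) := by
  constructor
  · intro hj
    obtain ⟨q, hq, hqY⟩ := hL.row_used j hj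
    have hy := hhigh j le_rfl hj
    rcases h with h | ⟨h1, h2, ⟨q', hq', hb⟩, h4⟩
    · have := h.2 q hq
      linarith
    · refine ⟨h1, le_antisymm ?_ ?_⟩
      · rcases h4 q hq with h | h <;> linarith
      · obtain ⟨j', hj', hY⟩ := hL.row q' hq'
        rw [← hb, ← hY]
        have hjj : j ≤ j' := by
          by_contra hc
          have := hlow j' (not_le.1 hc)
          linarith
        rcases hjj.eq_or_lt with rfl | hlt
        · exact le_rfl
        · exact (hL.Y_lt _ _ hlt hj').le
  · rintro rfl
    rcases h with h | ⟨-, h2, ⟨q', hq', hb⟩, -⟩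
    · exact h.1
    · obtain ⟨j', hj', hY⟩ := hL.row q' hq'
      have := hlow j' hj'
      linarith

/-- What later parts of the program use of the lists of lines: the registers and the memory cells that
hold them. -/
structure HoldsLines (D : Sweep) (s : Store) : Prop where
  N_eq : s.ireg 0 = D.N
  h_eq : s.ireg 1 = D.h
  pow_eq : s.ireg 2 = 2 ^ D.h
  imem_eq : ∀ j < D.h, s.imem j = 2 ^ j
  rmem_eq : ∀ j < D.h, s.rmem j = D.Y j

/-- The lines are found one by one, each as the lowest height above the previous one; the search starts
from the height `-1`, and one more search finds that no line is left. -/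
lemma runs_listLines {D : Sweep} (hL : HasLines inp D) (hcap : 2 ^ D.h ≤ cap) (hword : 2 ^ D.h ≤ word)
    (hN : D.N ≤ word) :
    Runs inp cap word listLines Store.init (4 + ((D.h + 1) * (D.N * 7 + 10) + 1)) fun s =>
      HoldsLines D s ∧ (∀ a, D.h ≤ a → s.rmem a = 0) ∧ s.out = [] := by
  have hlt : D.h < 2 ^ D.h := Nat.lt_two_pow_self
  let I : ℕ → Store → Prop := fun n s =>
    s.ireg 0 = D.N ∧ s.ireg 1 = min n D.h ∧ s.ireg 2 = 2 ^ min n D.h ∧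
    s.ireg 8 = (if n ≤ D.h then 1 else 0) ∧ (∀ j < min n D.h, s.imem j = 2 ^ j) ∧
    (∀ j < min n D.h, s.rmem j = D.Y j) ∧ (∀ a, min n D.h ≤ a → s.rmem a = 0) ∧ s.out = [] ∧
    (∀ k < min n D.h, D.Y k ≤ s.rreg 12) ∧ ∀ k, min n D.h ≤ k → k < D.h → s.rreg 12 < D.Y k
  refine Runs.wp_seq ?_
  simp only [wp, IExpr.eval, RExpr.eval, Store.init, hL.length_eq]
  refine ⟨hN, by omega, by omega, ?_⟩
  refine (Runs.while_range I (D.h + 1) (D.N * 7 + 9) ?_ ?_ ?_).mono le_rfl ?_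
  · simp only [I, Nat.zero_min]
    refine ⟨by simp, by simp, by simp, by simp, by simp, by simp, by simp, trivial, by simp, fun k _ hk => ?_⟩
    have := hL.Y_nonneg k hk
    simp
    linarith
  · rintro n hn s ⟨i0, i1, i2, i8, im, rm, rz, o, hlow, hhigh⟩
    rw [min_eq_left (Nat.lt_succ_iff.1 hn)] at i1 i2 im rm rz hlow hhigh
    rw [if_pos (Nat.lt_succ_iff.1 hn)] at i8
    refine ⟨by simp [BExpr.Holds, IExpr.eval, i8], ?_⟩
    refine (Runs.wp_seq (T := (D.N * 7 + 1) + 6) ?_).mono (by simp [Prog.steps]; omega) fun _ h => h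
    simp only [wp, IExpr.eval]
    refine ⟨by omega, by omega, ?_⟩
    have hfind := runs_findNextLine (inp := inp) (cap := cap) (word := word)
      (s := { s with ireg := Function.update (Function.update s.ireg 8 0) 9 0 })
      (hL.length_eq.trans_le hN) (by simp [i0, hL.length_eq]) (by simp) (by simp)
    rw [hL.length_eq] at hfind
    refine hfind.seq ?_
    rintro s' ⟨ireg', r12', im', rm', o', hnext⟩
    dsimp only at ireg' r12' im' rm' o' hnext
    have e0 : s'.ireg 0 = D.N := by rw [ireg' 0 (by omega)]; simpa using i0
    have e1 : s'.ireg 1 = n := by rw [ireg' 1 (by omega)]; simpa using i1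
    have e2 : s'.ireg 2 = 2 ^ n := by rw [ireg' 2 (by omega)]; simpa using i2
    have hj := hL.isNextHeight (Nat.lt_succ_iff.1 hn) hlow hhigh hnext
    refine Runs.of_wp_le (by decide) ?_
    simp only [wp, IExpr.eval, RExpr.eval, BExpr.Holds, e1, e2, im', rm', o', o]
    rcases (Nat.lt_succ_iff.1 hn).lt_or_eq with hn' | hn'
    · obtain ⟨e8, e13⟩ := hj.1 hn'
      have hp : 2 ^ (n + 1) ≤ 2 ^ D.h := Nat.pow_le_pow_right (by norm_num) hn'
      have hp' : 2 ^ (n + 1) = 2 * 2 ^ n := by rw [pow_succ]; ring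
      refine ⟨fun _ => ?_, fun hc => absurd e8.ge hc⟩
      simp [e13, e2]
      refine ⟨by omega, by omega, by omega, by omega, ?_⟩
      simp only [I, min_eq_left (show n + 1 ≤ D.h from hn'), if_pos (show n + 1 ≤ D.h from hn')]
      refine ⟨by simp [e0], by simp, by simp [hp'], by simp [e8], ?_, ?_, ?_, trivial, ?_, ?_⟩
      · intro j hjn
        rcases Nat.lt_succ_iff_lt_or_eq.1 hjn with h | rfl
        · rw [Function.update_of_ne h.ne, im j h]
        · simp
      · intro j hjn
        rcases Nat.lt_succ_iff_lt_or_eq.1 hjn with h | rfl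
        · rw [Function.update_of_ne h.ne, rm j h]
        · simp
      · intro a ha
        rw [Function.update_of_ne (by omega), rz a (by omega)]
      · intro k hk
        simp only [Function.update_self]
        rcases Nat.lt_succ_iff_lt_or_eq.1 hk with h | rfl
        · exact (hL.Y_lt _ _ h hn').le
        · exact le_rfl
      · intro k hk hk'
        simp only [Function.update_self]
        exact hL.Y_lt _ _ hk hk'
    · have e8 := hj.2 hn'
      refine ⟨fun hc => absurd hc (by omega), fun _ => ?_⟩
      simp only [I, min_eq_right (show D.h ≤ n + 1 by omega), if_neg (show ¬ n + 1 ≤ D.h by omega)]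
      subst hn'
      rw [im', rm', o', r12']
      exact ⟨e0, e1, e2, e8, im, rm, rz, o, hlow, hhigh⟩
  · rintro s ⟨-, -, -, i8, -⟩
    simp [BExpr.Holds, IExpr.eval, i8]
  · rintro s ⟨i0, i1, i2, -, im, rm, rz, o, -, -⟩
    rw [min_eq_right (by omega)] at i1 i2 im rm rz
    exact ⟨⟨i0, i1, i2, im, rm⟩, rz, o⟩

/-! ### The program of the sweep -/

/-- Load the data of the node whose number is in integer register 3.  The program `fetch` has to load
the terminal whose index is in integer register 20 into the real registers 20 and 21 and the integer
register 21.

The integer registers 0 to 7 hold the number of terminals, `h`, `2 ^ h`, the node `t`, its row `j`, `2 ^ j`,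
the current state and the kind of the node. The real registers 0 and 10 hold the x-coordinates of the
previous and the current copy of a column, 11 and 2 the heights of the line below and of the line of the
node, and 1 and 3 the distances between these. The real memory holds the heights of the lines from address
`0` on, the costs of the states from `2 ^ h` on and their coded decisions from `2 * 2 ^ h` on. -/
def loadNode (fetch : Prog) : Prog :=
  (.iset 4 (.mod (.reg 3) (.reg 1)) ;;
    .iset 20 (.sub (.div (.reg 3) (.reg 1)) (.const 1))) ;;
  fetch ;;
  (.rset 0 (.reg 20) ;; .iset 20 (.div (.reg 3) (.reg 1))) ;;
  fetch ;;
  (.rset 10 (.reg 20) ;; .rload 2 (.reg 4) ;; .rload 11 (.sub (.reg 4) (.const 1)))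

/-- Put the base value into the real registers 8 and 9, where `free` tests if the node is connected
without a new edge. The values of the states without and with the node are in the real registers 4 and 5,
and 6 and 7. -/
def setBase (free : BExpr) : Prog :=
  .ite free (.rset 8 (.reg 6) ;; .rset 9 (.div (.reg 7) (.const 3)))
    (.ite (.ile (.const 1) (.reg 7)) (.rset 8 (.const (-1)) ;; .rset 9 (.const 0))
      (.rset 8 (.reg 4) ;; .rset 9 (.div (.reg 5) (.const 3))))

/-- Improve the value in the real registers 8 and 9 by an edge with the length in the real register
`w`, coded by `k`. -/
def relaxProg (w k : ℕ) : Prog :=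
  .ite (.and (.rle (.const 0) (.reg 6))
      (.not (.and (.rle (.const 0) (.reg 8)) (.rle (.reg 8) (.add (.reg 6) (.reg w))))))
    (.rset 8 (.add (.reg 6) (.reg w)) ;;
      .rset 9 (.div (.add (.reg 7) (.const k)) (.const 3))) .skip

/-- Improve the value in the real registers 8 and 9 by an edge downwards, if the state has the node
below.  The row number is `j` and `2 ^ j` is in register 5, so the bit `j - 1` of the state `S` is the bit
`j` of `2 * S`; this is zero for `j = 0`. -/
def relaxDown : Prog :=
  .ite (.ile (.const 1) (.mod (.div (.mul (.const 2) (.reg 6)) (.reg 5)) (.const 2)))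
    (relaxProg 3 2) .skip

/-- Update the values of the state in integer register 6, which does not contain the row of the node,
and of the state that contains this row in addition. -/
def updatePair : Prog :=
  (.rload 4 (.add (.reg 2) (.reg 6)) ;;
    .rload 5 (.add (.mul (.const 2) (.reg 2)) (.reg 6)) ;;
    .rload 6 (.add (.reg 2) (.add (.reg 6) (.reg 5))) ;;
    .rload 7 (.add (.mul (.const 2) (.reg 2)) (.add (.reg 6) (.reg 5)))) ;;
  setBase (.ile (.const 2) (.reg 7)) ;; relaxDown ;;
  (.rstore (.add (.reg 2) (.reg 6)) (.reg 8) ;;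
    .rstore (.add (.mul (.const 2) (.reg 2)) (.reg 6)) (.reg 9)) ;;
  setBase (.not (.and (.not (.ile (.const 2) (.reg 7))) (.not (.rle (.reg 1) (.const 0))))) ;;
  relaxProg 1 1 ;; relaxDown ;;
  (.rstore (.add (.reg 2) (.add (.reg 6) (.reg 5))) (.reg 8) ;;
    .rstore (.add (.mul (.const 2) (.reg 2)) (.add (.reg 6) (.reg 5))) (.reg 9))

/-- Update the values of all states. -/
def updateAll : Prog :=
  .while (.ile (.add (.reg 6) (.const 1)) (.reg 2)) (
    .ite (.ile (.mod (.div (.reg 6) (.reg 5)) (.const 2)) (.const 0)) updatePair .skip ;;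
    .iset 6 (.add (.reg 6) (.const 1)))

/-- Compute, after `loadNode`, the distances to the neighbours and the kind of the node: `0` for no
terminal, `1` for a point and `2` for a root. -/
def classifyNode : Prog :=
  .iload 5 (.reg 4) ;; .rset 1 (.sub (.reg 10) (.reg 0)) ;; .rset 3 (.sub (.reg 2) (.reg 11)) ;;
  .ite (.and (.rle (.reg 2) (.reg 21)) (.rle (.reg 21) (.reg 2)))
    (.iset 7 (.add (.const 1) (.reg 21))) (.iset 7 (.const 0)) ;;
  .iset 6 (.const 0)

/-- The backward pass of the dynamic program. -/
def backward (fetch : Prog) : Prog :=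
  .iset 3 (.mul (.reg 0) (.reg 1)) ;;
  .while (.ile (.const 1) (.reg 3))
    (.iset 3 (.sub (.reg 3) (.const 1)) ;; loadNode fetch ;; classifyNode ;; updateAll)

/-- The forward pass, which decodes the optimal decisions and outputs the edges. -/
def forward (fetch : Prog) : Prog :=
  (.rload 15 (.mul (.const 2) (.reg 2)) ;; .iset 3 (.const 0)) ;;
  .while (.ile (.add (.reg 3) (.const 1)) (.mul (.reg 0) (.reg 1))) (
    loadNode fetch ;;
    (.rset 15 (.mul (.const 3) (.reg 15)) ;;
    .ite (.rle (.const 2) (.reg 15))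
      (.emit (.reg 10) (.reg 11) (.reg 10) (.reg 2) ;; .rset 15 (.sub (.reg 15) (.const 2)))
      (.ite (.rle (.const 1) (.reg 15))
        (.emit (.reg 0) (.reg 2) (.reg 10) (.reg 2) ;; .rset 15 (.sub (.reg 15) (.const 1)))
        .skip) ;;
    .iset 3 (.add (.reg 3) (.const 1))))

/-- The algorithm, for a given way to access the terminals in lexicographic order. -/
def sweepProg (fetch : Prog) : Prog := listLines ;; backward fetch ;; forward fetch

/-! ### Correctness of the program -/

/-- The stores `s` and `s'` agree, except on the integer registers that do not satisfy `p` and the real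
registers that do not satisfy `q`. -/
structure AgreeOn (p q : ℕ → Prop) (s s' : Store) : Prop where
  ireg : ∀ k, p k → s'.ireg k = s.ireg k
  rreg : ∀ k, q k → s'.rreg k = s.rreg k
  imem : s'.imem = s.imem
  rmem : s'.rmem = s.rmem
  out : s'.out = s.out

/-- The program `fetch` loads the terminals of the sweep `D` in `TF` steps. -/
def Fetches (inp : List (Pt × Bool)) (cap word : ℕ) (D : Sweep) (fetch : Prog) (TF : ℕ) : Prop :=
  ∀ s : Store, s.ireg 20 < D.N → Runs inp cap word fetch s TF fun s' =>
    s'.rreg 20 = D.X (s.ireg 20) ∧ s'.rreg 21 = D.Z (s.ireg 20) ∧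
    s'.ireg 21 = (D.isRoot (s.ireg 20)).toNat ∧ AgreeOn (· < 20) (· < 20) s s'

lemma HoldsLines.of_agree {D : Sweep} {p q : ℕ → Prop} {s s' : Store} (h : HoldsLines D s)
    (ha : AgreeOn p q s s') (h0 : p 0) (h1 : p 1) (h2 : p 2) : HoldsLines D s' :=
  ⟨by rw [ha.ireg 0 h0, h.N_eq], by rw [ha.ireg 1 h1, h.h_eq], by rw [ha.ireg 2 h2, h.pow_eq],
    by rw [ha.imem]; exact h.imem_eq, by rw [ha.rmem]; exact h.rmem_eq⟩

lemma runs_loadNode {D : Sweep} {fetch : Prog} {TF : ℕ} (hf : Fetches inp cap word D fetch TF)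
    (hcap : 2 ^ D.h ≤ cap) (hword : 2 ^ D.h ≤ word) (hN : D.N ≤ word) {s : Store}
    (hs : HoldsLines D s) (ht : s.ireg 3 < D.N * D.h) :
    Runs inp cap word (loadNode fetch) s (2 * TF + 7) fun s' =>
      s'.ireg 4 = s.ireg 3 % D.h ∧ s'.rreg 0 = D.X (s.ireg 3 / D.h - 1) ∧
      s'.rreg 10 = D.X (s.ireg 3 / D.h) ∧ s'.rreg 2 = D.Y (s.ireg 3 % D.h) ∧
      s'.rreg 11 = D.Y (s.ireg 3 % D.h - 1) ∧ s'.rreg 21 = D.Z (s.ireg 3 / D.h) ∧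
      s'.ireg 21 = (D.isRoot (s.ireg 3 / D.h)).toNat ∧
      AgreeOn (fun k => k < 20 ∧ k ≠ 4) (fun k => k < 20 ∧ k ≠ 0 ∧ k ≠ 2 ∧ k ≠ 10 ∧ k ≠ 11) s s' := by
  have hh : 0 < D.h := Nat.pos_of_ne_zero fun h => by simp [h] at ht
  have hlt : D.h < 2 ^ D.h := Nat.lt_two_pow_self
  have hi : s.ireg 3 / D.h < D.N := Nat.div_lt_of_lt_mul (by rwa [mul_comm])
  have hj : s.ireg 3 % D.h < D.h := Nat.mod_lt _ hh
  refine (Runs.wp_seq (T := TF + (2 + (TF + 3))) ?_).mono (by simp [Prog.steps]; omega) fun _ h => h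
  simp only [wp, IExpr.eval]
  refine ⟨by rw [hs.h_eq]; omega, by simp [hs.h_eq]; omega, ?_⟩
  simp [hs.h_eq]
  refine (hf _ ?_).seq ?_
  · simpa using lt_of_le_of_lt (Nat.sub_le _ 1) hi
  rintro s₁ ⟨x1, -, -, a1⟩
  have b3 := a1.ireg 3 (by norm_num)
  have b1 := a1.ireg 1 (by norm_num)
  have b4 := a1.ireg 4 (by norm_num)
  simp [hs.h_eq] at x1 b3 b1 b4
  refine Runs.wp_seq ?_
  simp only [wp, IExpr.eval, RExpr.eval]
  refine ⟨by rw [b3, b1]; omega, ?_⟩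
  refine (hf _ ?_).seq ?_
  · simp [b3, b1]; exact hi
  rintro s₂ ⟨x2, y2, z2, a2⟩
  have c4 := a2.ireg 4 (by norm_num)
  have c0 := a2.rreg 0 (by norm_num)
  simp [b3, b1, b4, x1] at x2 y2 z2 c4 c0
  have hr : s₂.rmem = s.rmem := by rw [a2.rmem]; simpa using a1.rmem
  refine Runs.of_wp_le (by decide) ?_
  simp only [wp, IExpr.eval, RExpr.eval]
  simp [c4, c0, x2, y2, z2, hr, hs.rmem_eq _ hj,
    hs.rmem_eq (s.ireg 3 % D.h - 1) (by omega)]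
  refine ⟨by omega, by omega, ⟨?_, ?_, ?_, ?_, ?_⟩⟩
  · rintro k ⟨hk, hk4⟩
    dsimp only
    rw [a2.ireg k hk]
    dsimp only
    rw [Function.update_of_ne (by omega), a1.ireg k hk]
    dsimp only
    rw [Function.update_of_ne (by omega), Function.update_of_ne (by omega)]
  · rintro k ⟨hk, hk0, hk2, hk10, hk11⟩
    dsimp only
    rw [Function.update_of_ne (by omega), Function.update_of_ne (by omega),
      Function.update_of_ne (by omega), a2.rreg k hk]
    dsimp only
    rw [Function.update_of_ne (by omega), a1.rreg k hk]
  · simpa [a2.imem] using a1.imem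
  · rfl
  · simpa [a2.out] using a1.out

/-- The store with the value `x` in the real registers 8 and 9. -/
def Store.withResult (s : Store) (x : ℝ × ℝ) : Store :=
  { s with rreg := Function.update (Function.update s.rreg 8 x.1) 9 x.2 }

lemma Store.withResult_withResult (s : Store) (x y : ℝ × ℝ) :
    (s.withResult x).withResult y = s.withResult y := by
  unfold Store.withResult
  congr 1
  ext k
  simp only [Function.update_apply]
  split_ifs <;> rfl

lemma wp_setBase {free : BExpr} {D : Sweep} {t : ℕ} {l : Prop} {s : Store} {Q : Store → Prop}
    (hfree : free.Holds s ↔ D.Free t l) (hpt : ¬ D.Free t l → (1 ≤ s.ireg 7 ↔ D.PointAt t))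
    (hQ : Q (s.withResult (D.baseValue t l (s.rreg 4, s.rreg 5) (s.rreg 6, s.rreg 7)))) :
    wp inp cap word (setBase free) Q s := by
  simp only [setBase, wp, BExpr.Holds, IExpr.eval, RExpr.eval]
  refine ⟨fun h => ?_, fun h => ⟨fun h' => ?_, fun h' => ?_⟩⟩
  · rw [Sweep.baseValue, if_pos (hfree.1 h)] at hQ
    simpa [Store.withResult] using hQ
  · have hn := fun hf => h (hfree.2 hf)
    rw [Sweep.baseValue, if_neg hn, if_pos ((hpt hn).1 h')] at hQ
    simpa [Store.withResult] using hQ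
  · have hn := fun hf => h (hfree.2 hf)
    rw [Sweep.baseValue, if_neg hn, if_neg fun hp => h' ((hpt hn).2 hp)] at hQ
    simpa [Store.withResult] using hQ

lemma wp_relaxProg {w k : ℕ} (hw : w < 4) {s : Store} {x : ℝ × ℝ} {Q : Store → Prop}
    (hQ : Q (s.withResult (relax (s.rreg 6, s.rreg 7) x (s.rreg w) k))) :
    wp inp cap word (relaxProg w k) Q (s.withResult x) := by
  have h8 : w ≠ 8 := by omega
  have h9 : w ≠ 9 := by omega
  simp only [relaxProg, wp, BExpr.Holds, RExpr.eval]
  unfold relax at hQ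
  refine ⟨fun h => ?_, fun h => ?_⟩
  · simp [Store.withResult, h8, h9] at h
    rw [if_pos (by simpa using h)] at hQ
    rw [← Store.withResult_withResult s x] at hQ
    simpa [Store.withResult, h8, h9] using hQ
  · simp [Store.withResult, h8, h9] at h
    rw [if_neg (by simpa using h)] at hQ
    exact hQ

lemma testBit_two_mul_iff (S j : ℕ) :
    1 ≤ 2 * S / 2 ^ j % 2 ↔ 0 < j ∧ S.testBit (j - 1) = true := by
  rcases j with _ | j
  · simp
  · rw [Nat.add_sub_cancel, Nat.testBit_eq_decide_div_mod_eq, pow_succ, mul_comm (2 ^ j),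
      Nat.mul_div_mul_left _ _ (by norm_num)]
    simp
    omega

open Classical in
lemma wp_relaxDown {D : Sweep} {t S : ℕ} {s : Store} {x : ℝ × ℝ} {Q : Store → Prop}
    (h5 : s.ireg 5 = 2 ^ (t % D.h)) (hS : D.Down t S ↔ D.Down t (s.ireg 6))
    (hQ : Q (s.withResult (if D.Down t S then relax (s.rreg 6, s.rreg 7) x (s.rreg 3) 2 else x))) :
    wp inp cap word relaxDown Q (s.withResult x) := by
  have hiff : 1 ≤ 2 * s.ireg 6 / s.ireg 5 % 2 ↔ D.Down t S := by
    rw [h5, testBit_two_mul_iff, hS, Sweep.Down]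
  rw [relaxDown, wp]
  simp only [BExpr.Holds, IExpr.eval]
  change (1 ≤ 2 * s.ireg 6 / s.ireg 5 % 2 → _) ∧ (¬ (1 ≤ 2 * s.ireg 6 / s.ireg 5 % 2) → _)
  rw [hiff]
  refine ⟨fun h => ?_, fun h => ?_⟩
  · rw [if_pos h] at hQ
    exact wp_relaxProg (by norm_num) hQ
  · rw [if_neg h] at hQ
    exact hQ

/-- After the node data have been loaded: the values needed to update all states. -/
structure NodeLoaded (D : Sweep) (t : ℕ) (s : Store) : Prop where
  pow_eq : s.ireg 2 = 2 ^ D.h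
  bit_eq : s.ireg 5 = 2 ^ (t % D.h)
  root_iff : 2 ≤ s.ireg 7 ↔ D.RootAt t
  point_iff : ¬ D.RootAt t → (1 ≤ s.ireg 7 ↔ D.PointAt t)
  dx_eq : s.rreg 1 = D.dx t
  dy_eq : s.rreg 3 = D.dy t

/-- The real memory holds the value `V S` of the state `S`. -/
def HoldsValue (D : Sweep) (s : Store) (S : ℕ) (v : ℝ × ℝ) : Prop :=
  s.rmem (2 ^ D.h + S) = v.1 ∧ s.rmem (2 * 2 ^ D.h + S) = v.2

lemma clearBit_eq_self {S j : ℕ} (h : S.testBit j = false) : clearBit S j = S := by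
  simp [clearBit, h]

lemma setBit_eq_add {S j : ℕ} (h : S.testBit j = false) : setBit S j = S + 2 ^ j := by
  simp [setBit, h]

lemma clearBit_add_two_pow {S j : ℕ} (h : S.testBit j = false) : clearBit (S + 2 ^ j) j = S := by
  simp [clearBit, testBit_add_two_pow h]

lemma setBit_add_two_pow {S j : ℕ} (h : S.testBit j = false) :
    setBit (S + 2 ^ j) j = S + 2 ^ j := by
  simp [setBit, testBit_add_two_pow h]

lemma down_add_two_pow {D : Sweep} {t S : ℕ} (h : S.testBit (t % D.h) = false) :
    D.Down t (S + 2 ^ (t % D.h)) ↔ D.Down t S := by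
  unfold Sweep.Down
  refine and_congr_right fun hpos => ?_
  rw [testBit_add_two_pow h]
  simp
  omega

open Classical in
lemma wp_updatePair {D : Sweep} {t S : ℕ} {V : ℕ → ℝ × ℝ} {s : Store} {Q : Store → Prop}
    (hcap : 3 * 2 ^ D.h ≤ cap) (hdx : 0 ≤ D.dx t) (hs : NodeLoaded D t s) (h6 : s.ireg 6 = S)
    (hbit : S.testBit (t % D.h) = false) (hlt : S + 2 ^ (t % D.h) < 2 ^ D.h)
    (hV0 : HoldsValue D s S (V S))
    (hV1 : HoldsValue D s (S + 2 ^ (t % D.h)) (V (S + 2 ^ (t % D.h))))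
    (hQ : ∀ s' : Store, s'.ireg = s.ireg → s'.rreg 1 = s.rreg 1 → s'.rreg 3 = s.rreg 3 →
      s'.imem = s.imem → s'.out = s.out →
      s'.rmem = Function.update (Function.update (Function.update (Function.update s.rmem
        (2 ^ D.h + S) (D.update t V S).1)
        (2 * 2 ^ D.h + S) (D.update t V S).2)
        (2 ^ D.h + (S + 2 ^ (t % D.h))) (D.update t V (S + 2 ^ (t % D.h))).1)
        (2 * 2 ^ D.h + (S + 2 ^ (t % D.h))) (D.update t V (S + 2 ^ (t % D.h))).2 → Q s') :
    wp inp cap word updatePair Q s := by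
  have hpos : 0 < 2 ^ (t % D.h) := by positivity
  have hbit' := testBit_add_two_pow hbit (t % D.h)
  simp only [decide_true, Bool.true_or] at hbit'
  rw [updatePair]
  simp only [wp, IExpr.eval, hs.pow_eq, hs.bit_eq, h6]
  refine ⟨by omega, by omega, by omega, by omega, ?_⟩
  refine wp_setBase (D := D) (t := t) (l := S.testBit (t % D.h)) ?_ ?_ ?_
  · simp only [BExpr.Holds, IExpr.eval]
    rw [hs.root_iff, Sweep.Free, hbit]
    simp
  · intro hf
    exact hs.point_iff fun h => hf (Or.inl h)
  refine wp_relaxDown (t := t) (S := S) (D := D) hs.bit_eq (by rw [← h6]) ?_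
  dsimp only [Store.withResult]
  simp [hs.pow_eq, h6, hV0.1, hV0.2, hV1.1, hV1.2, hs.dy_eq]
  refine ⟨by omega, by omega, ?_⟩
  refine wp_setBase (D := D) (t := t) (l := (S + 2 ^ (t % D.h)).testBit (t % D.h)) ?_ ?_ ?_
  · have hzero : D.dx t ≤ 0 ↔ D.dx t = 0 := ⟨fun h => le_antisymm h hdx, fun h => h.le⟩
    change ¬ (¬ (2 ≤ s.ireg 7) ∧ ¬ (s.rreg 1 ≤ ((0 : ℚ) : ℝ))) ↔ _
    rw [hs.root_iff, Sweep.Free, hbit', hs.dx_eq, Rat.cast_zero, hzero]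
    tauto
  · intro hf
    exact hs.point_iff fun h => hf (Or.inl h)
  refine wp_relaxProg (by norm_num) ?_
  refine wp_relaxDown (t := t) (S := S + 2 ^ (t % D.h)) (D := D) hs.bit_eq
    (by rw [down_add_two_pow hbit, ← h6]) ?_
  dsimp only [Store.withResult]
  simp [hs.pow_eq, hs.bit_eq, h6, hs.dy_eq, hs.dx_eq]
  refine ⟨by omega, by omega, ?_⟩
  have hlow : D.update t V S = if D.Down t S then relax (V (S + 2 ^ (t % D.h)))
      (D.baseValue t (S.testBit (t % D.h)) (V S) (V (S + 2 ^ (t % D.h)))) (D.dy t) 2 else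
      D.baseValue t (S.testBit (t % D.h)) (V S) (V (S + 2 ^ (t % D.h))) := by
    rw [Sweep.update]
    simp [setBit_eq_add hbit, clearBit_eq_self hbit, hbit]
  have hhigh : D.update t V (S + 2 ^ (t % D.h)) = if D.Down t S then
      relax (V (S + 2 ^ (t % D.h))) (relax (V (S + 2 ^ (t % D.h)))
        (D.baseValue t ((S + 2 ^ (t % D.h)).testBit (t % D.h)) (V S) (V (S + 2 ^ (t % D.h))))
        (D.dx t) 1) (D.dy t) 2 else
      relax (V (S + 2 ^ (t % D.h)))
        (D.baseValue t ((S + 2 ^ (t % D.h)).testBit (t % D.h)) (V S) (V (S + 2 ^ (t % D.h))))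
        (D.dx t) 1 := by
    rw [Sweep.update]
    simp [setBit_add_two_pow hbit, clearBit_add_two_pow hbit, hbit', down_add_two_pow hbit]
  refine hQ _ rfl ?_ ?_ rfl rfl ?_
  · simp [hs.dx_eq]
  · simp [hs.dy_eq]
  · rw [hlow, hhigh]
    simp [RExpr.eval, down_add_two_pow hbit]

/-- Both states of a pair are updated when the loop reaches the one without the row of the node, so after
`n` iterations a state has its new value if it is below `n` after the row has been removed from it. -/
lemma runs_updateAll {D : Sweep} {t : ℕ} {V : ℕ → ℝ × ℝ} {s : Store} (hh : 0 < D.h)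
    (hcap : 3 * 2 ^ D.h ≤ cap) (hword : 2 ^ D.h ≤ word) (hdx : 0 ≤ D.dx t) (hs : NodeLoaded D t s)
    (h6 : s.ireg 6 = 0) (hV : ∀ S < 2 ^ D.h, HoldsValue D s S (V S)) :
    Runs inp cap word updateAll s (2 ^ D.h * 30 + 1) fun s' =>
      (∀ k, k ≠ 6 → s'.ireg k = s.ireg k) ∧ s'.imem = s.imem ∧ s'.out = s.out ∧
      (∀ a < 2 ^ D.h, s'.rmem a = s.rmem a) ∧
      ∀ S < 2 ^ D.h, HoldsValue D s' S (D.update t V S) := by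
  classical
  have hj : t % D.h < D.h := Nat.mod_lt _ hh
  let I : ℕ → Store → Prop := fun n s' =>
    s'.ireg 6 = n ∧ (∀ k, k ≠ 6 → s'.ireg k = s.ireg k) ∧ s'.rreg 1 = s.rreg 1 ∧
      s'.rreg 3 = s.rreg 3 ∧ s'.imem = s.imem ∧ s'.out = s.out ∧
      (∀ a < 2 ^ D.h, s'.rmem a = s.rmem a) ∧
      ∀ S < 2 ^ D.h, HoldsValue D s' S (if clearBit S (t % D.h) < n then D.update t V S else V S)
  refine (Runs.while_range I (2 ^ D.h) 29 ?_ ?_ ?_).mono le_rfl ?_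
  · exact ⟨h6, fun _ _ => rfl, rfl, rfl, rfl, rfl, fun _ _ => rfl, by simpa using hV⟩
  · rintro n hn s' ⟨i6, ireg, r1, r3, im, o, rlow, hval⟩
    have hs' : NodeLoaded D t s' := ⟨by rw [ireg 2 (by norm_num), hs.pow_eq],
      by rw [ireg 5 (by norm_num), hs.bit_eq], by rw [ireg 7 (by norm_num), hs.root_iff],
      by rw [ireg 7 (by norm_num)]; exact hs.point_iff, by rw [r1, hs.dx_eq], by rw [r3, hs.dy_eq]⟩
    refine ⟨by simp only [BExpr.Holds, IExpr.eval, i6, hs'.pow_eq]; omega,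
      Runs.of_wp_le (by decide) ?_⟩
    simp only [wp, BExpr.Holds, IExpr.eval, hs'.bit_eq, i6]
    refine ⟨fun hbit0 => ?_, fun hbit1 => ?_⟩
    · have hbit : n.testBit (t % D.h) = false := by
        rw [Nat.testBit_eq_decide_div_mod_eq]
        simp
        omega
      have hlt : n + 2 ^ (t % D.h) < 2 ^ D.h := by
        rw [← setBit_eq_add hbit]
        exact setBit_lt hn hj
      have hpos : 0 < 2 ^ (t % D.h) := by positivity
      refine wp_updatePair hcap hdx hs' i6 hbit hlt (V := V) ?_ ?_ ?_
      · have := hval n hn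
        rwa [clearBit_eq_self hbit, if_neg (lt_irrefl _)] at this
      · have := hval _ hlt
        rwa [clearBit_add_two_pow hbit, if_neg (lt_irrefl _)] at this
      · intro s'' e1 e2 e3 e4 e5 e6
        have i6' : s''.ireg 6 = n := by rw [e1, i6]
        simp only [I, i6', Function.update_self]
        refine ⟨by omega, trivial, fun k hk => ?_, by rw [e2, r1], by rw [e3, r3], by rw [e4, im],
          by rw [e5, o], fun a ha => ?_, fun S hS => ?_⟩
        · rw [Function.update_of_ne hk, e1, ireg k hk]
        · rw [e6, Function.update_of_ne (by omega), Function.update_of_ne (by omega),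
            Function.update_of_ne (by omega), Function.update_of_ne (by omega), rlow a ha]
        · have key : HoldsValue D s'' S
              (if clearBit S (t % D.h) < n + 1 then D.update t V S else V S) := by
            by_cases hc : clearBit S (t % D.h) = n
            · rw [hc, if_pos (Nat.lt_succ_self n)]
              rcases eq_or_eq_of_clearBit_eq hc with rfl | rfl
              · constructor
                · rw [e6, Function.update_of_ne (by omega), Function.update_of_ne (by omega),
                    Function.update_of_ne (by omega), Function.update_self]
                · rw [e6, Function.update_of_ne (by omega), Function.update_of_ne (by omega),
                    Function.update_self]
              · constructor
                · rw [e6, Function.update_of_ne (by omega), Function.update_self]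
                · rw [e6, Function.update_self]
            · have h1 : S ≠ n := fun h => hc (by rw [h, clearBit_eq_self hbit])
              have h2 : S ≠ n + 2 ^ (t % D.h) := fun h => hc (by rw [h, clearBit_add_two_pow hbit])
              have h3 : clearBit S (t % D.h) < n + 1 ↔ clearBit S (t % D.h) < n := by omega
              have h4 := hval S hS
              simp only [h3]
              constructor
              · rw [e6, Function.update_of_ne (by omega), Function.update_of_ne (by omega),
                  Function.update_of_ne (by omega), Function.update_of_ne (by omega), h4.1]
              · rw [e6, Function.update_of_ne (by omega), Function.update_of_ne (by omega),
                  Function.update_of_ne (by omega), Function.update_of_ne (by omega), h4.2]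
          exact key
    · have hbit : n.testBit (t % D.h) = true := by
        rw [Nat.testBit_eq_decide_div_mod_eq]
        simp
        omega
      simp only [I, Function.update_self]
      refine ⟨by omega, trivial, fun k hk => ?_, r1, r3, im, o, rlow, fun S hS => ?_⟩
      · rw [Function.update_of_ne hk, ireg k hk]
      · have hc : clearBit S (t % D.h) ≠ n := by
          intro h
          rw [testBit_ne_of_clearBit_eq h] at hbit
          exact absurd hbit (by simp)
        have h3 : clearBit S (t % D.h) < n + 1 ↔ clearBit S (t % D.h) < n := by omega
        simp only [h3]
        exact hval S hS
  · rintro s' ⟨i6, ireg, -⟩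
    have := ireg 2 (by norm_num)
    simp only [BExpr.Holds, IExpr.eval, i6, this, hs.pow_eq]
    omega
  · rintro s' ⟨-, ireg, -, -, im, o, rlow, hval⟩
    refine ⟨ireg, im, o, rlow, fun S hS => ?_⟩
    have := hval S hS
    rwa [if_pos ((clearBit_le _ _).trans_lt hS)] at this

/-- The backward pass computes the value of the initial state. It relies on the zeros in the untouched
real memory, which are the values of the states after the last node. -/
lemma runs_backward {D : Sweep} {fetch : Prog} {TF : ℕ} (hf : Fetches inp cap word D fetch TF)
    (hh : 0 < D.h) (hcap : 3 * 2 ^ D.h ≤ cap) (hword : 2 * D.N * 2 ^ D.h ≤ word) (hN : 0 < D.N)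
    (hdx : ∀ t < D.N * D.h, 0 ≤ D.dx t) {s : Store} (hs : HoldsLines D s)
    (hz : ∀ a, D.h ≤ a → s.rmem a = 0) (ho : s.out = []) :
    Runs inp cap word (backward fetch) s
      (1 + (D.N * D.h * (1 + (2 * TF + 7 + (6 + (2 ^ D.h * 30 + 1))) + 1) + 1)) fun s' =>
      HoldsLines D s' ∧ HoldsValue D s' 0 (D.value 0 0) ∧ s'.out = [] := by
  have hlt : D.h < 2 ^ D.h := Nat.lt_two_pow_self
  have hw1 : 2 * 2 ^ D.h ≤ word := by
    refine le_trans ?_ hword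
    rw [mul_right_comm]
    exact Nat.le_mul_of_pos_right _ hN
  have hw2 : D.N * D.h ≤ word := by
    have : D.N * D.h ≤ D.N * 2 ^ D.h := Nat.mul_le_mul_left _ hlt.le
    rw [mul_assoc] at hword
    omega
  have hw3 : D.N ≤ word := (Nat.le_mul_of_pos_right _ hh).trans hw2
  let I : ℕ → Store → Prop := fun n s =>
    HoldsLines D s ∧ s.ireg 3 = D.N * D.h - n ∧ s.out = [] ∧
      ∀ S < 2 ^ D.h, HoldsValue D s S (D.value (D.N * D.h - n) S)
  refine Runs.wp_seq ?_
  simp only [wp, IExpr.eval, hs.N_eq, hs.h_eq]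
  refine ⟨hw2, ?_⟩
  refine (Runs.while_range I (D.N * D.h) _ ?_ ?_ ?_).mono le_rfl ?_
  · refine ⟨⟨by simp [hs.N_eq], by simp [hs.h_eq], by simp [hs.pow_eq], hs.imem_eq, hs.rmem_eq⟩,
      by simp, ho, fun S hS => ?_⟩
    rw [Nat.sub_zero, Sweep.value_end]
    exact ⟨hz _ (by omega), hz _ (by omega)⟩
  · rintro n hn s ⟨hs, i3, ho, hval⟩
    set t := D.N * D.h - (n + 1) with ht
    have htlt : t < D.N * D.h := by omega
    have ht1 : D.N * D.h - n = t + 1 := by omega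
    have hj : t % D.h < D.h := Nat.mod_lt _ hh
    rw [ht1] at i3 hval
    refine ⟨by simp [BExpr.Holds, IExpr.eval, i3], ?_⟩
    refine Runs.wp_seq ?_
    simp only [wp, IExpr.eval, i3, Nat.add_sub_cancel]
    refine ⟨by omega, ?_⟩
    refine (runs_loadNode hf (by omega) (by omega) hw3 (s := _) ?_ ?_).seq ?_
    · exact ⟨by simp [hs.N_eq], by simp [hs.h_eq], by simp [hs.pow_eq], hs.imem_eq, hs.rmem_eq⟩
    · simpa using htlt
    rintro s₁ ⟨c4, c0, c10, c2, c11, c21, d21, a1⟩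
    simp only [Function.update_self] at c4 c0 c10 c2 c11 c21 d21
    have hs₁ : HoldsLines D s₁ := by
      refine HoldsLines.of_agree (p := fun k => k < 20 ∧ k ≠ 4) ?_ a1 ?_ ?_ ?_ <;> [skip; norm_num;
        norm_num; norm_num]
      exact ⟨by simp [hs.N_eq], by simp [hs.h_eq], by simp [hs.pow_eq], hs.imem_eq, hs.rmem_eq⟩
    have i3₁ : s₁.ireg 3 = t := by rw [a1.ireg 3 (by norm_num)]; simp
    have rm₁ : s₁.rmem = s.rmem := by rw [a1.rmem]
    have o₁ : s₁.out = [] := by rw [a1.out]; exact ho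
    have hclass : wp inp cap word classifyNode (fun s₂ => HoldsLines D s₂ ∧ NodeLoaded D t s₂ ∧
        s₂.ireg 3 = t ∧ s₂.ireg 6 = 0 ∧ s₂.rmem = s.rmem ∧ s₂.out = []) s₁ := by
      have hb := hs₁.imem_eq _ hj
      have hbool : (D.isRoot (t / D.h)).toNat ≤ 1 := Bool.toNat_le _
      simp only [classifyNode, wp, IExpr.eval, RExpr.eval, BExpr.Holds]
      refine ⟨by omega, ?_⟩
      simp [c4, c0, c10, c2, c11, c21, d21, hb]
      refine ⟨fun h1 h2 => ⟨by omega, ?_⟩, fun h1 => ?_⟩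
      · have heq : D.Y (t % D.h) = D.Z (t / D.h) := le_antisymm h1 h2
        refine ⟨⟨by simp [hs₁.N_eq], by simp [hs₁.h_eq], by simp [hs₁.pow_eq], hs₁.imem_eq,
          hs₁.rmem_eq⟩, ⟨by simp [hs₁.pow_eq], by simp, ?_, ?_, by simp [Sweep.dx],
          by simp [Sweep.dy]⟩, i3₁, rm₁, o₁⟩
        · simp [Sweep.RootAt, heq]
          cases D.isRoot (t / D.h) <;> simp
        · simp [Sweep.RootAt, Sweep.PointAt, heq]
      · have hne : ¬ D.Y (t % D.h) = D.Z (t / D.h) := fun h => (h1 h.le).ne' h.symm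
        refine ⟨⟨by simp [hs₁.N_eq], by simp [hs₁.h_eq], by simp [hs₁.pow_eq], hs₁.imem_eq,
          hs₁.rmem_eq⟩, ⟨by simp [hs₁.pow_eq], by simp, ?_, ?_, by simp [Sweep.dx],
          by simp [Sweep.dy]⟩, i3₁, rm₁, o₁⟩
        · simp [Sweep.RootAt, hne]
        · simp [Sweep.PointAt, hne]
    refine (Runs.of_wp_le (T := 6) (by decide) hclass).seq ?_
    rintro s₂ ⟨hs₂, hn₂, i3₂, i6₂, rm₂, o₂⟩
    refine (runs_updateAll hh hcap (by omega) (hdx t htlt) hn₂ i6₂ (V := D.value (t + 1))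
      fun S hS => ?_).mono le_rfl ?_
    · have := hval S hS
      exact ⟨by rw [rm₂]; exact this.1, by rw [rm₂]; exact this.2⟩
    · rintro s₃ ⟨ireg, im, o, rlow, hv⟩
      refine ⟨⟨by rw [ireg 0 (by norm_num), hs₂.N_eq], by rw [ireg 1 (by norm_num), hs₂.h_eq],
        by rw [ireg 2 (by norm_num), hs₂.pow_eq], by rw [im]; exact hs₂.imem_eq,
        fun j hj => by rw [rlow j (hj.trans hlt), hs₂.rmem_eq j hj]⟩,
        by rw [ireg 3 (by norm_num), i3₂], by rw [o, o₂], ?_⟩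
      rw [← ht, Sweep.value_eq htlt]
      exact hv
  · rintro s ⟨-, i3, -⟩
    simp [BExpr.Holds, IExpr.eval, i3]
  · rintro s ⟨h1, -, h2, h3⟩
    rw [Nat.sub_self] at h3
    exact ⟨h1, h3 0 (by positivity), h2⟩

/-- The forward pass outputs the edges of the decisions `d` that are coded in base three by `r 0`, where
`r t` codes the decisions from the node `t` on. -/
lemma runs_forward {D : Sweep} {fetch : Prog} {TF : ℕ} (hf : Fetches inp cap word D fetch TF)
    (hcap : 3 * 2 ^ D.h ≤ cap) (hword : 2 * D.N * 2 ^ D.h ≤ word) (hN : 0 < D.N) (hh : 0 < D.h)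
    {r : ℕ → ℝ} {d : ℕ → ℕ} (hd : ∀ t < D.N * D.h, d t ≤ 2 ∧ 3 * r t = r (t + 1) + d t)
    (hr : ∀ t ≤ D.N * D.h, 0 ≤ r t ∧ r t < 1) {s : Store} (hs : HoldsLines D s)
    (hv : s.rmem (2 * 2 ^ D.h + 0) = r 0) (ho : s.out = []) :
    Runs inp cap word (forward fetch) s (2 + (D.N * D.h * (2 * TF + 7 + 6 + 1) + 1)) fun s' =>
      s'.out = D.chosen d (D.N * D.h) := by
  have hlt : D.h < 2 ^ D.h := Nat.lt_two_pow_self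
  have hw1 : 2 * 2 ^ D.h ≤ word := by
    refine le_trans ?_ hword
    rw [mul_right_comm]
    exact Nat.le_mul_of_pos_right _ hN
  have hw2 : D.N * D.h ≤ word := by
    have : D.N * D.h ≤ D.N * 2 ^ D.h := Nat.mul_le_mul_left _ hlt.le
    rw [mul_assoc] at hword
    omega
  have hw3 : D.N ≤ word := (Nat.le_mul_of_pos_right _ hh).trans hw2
  let I : ℕ → Store → Prop := fun n s =>
    HoldsLines D s ∧ s.ireg 3 = n ∧ s.rreg 15 = r n ∧ s.out = D.chosen d n
  refine Runs.wp_seq ?_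
  simp only [wp, IExpr.eval, hs.pow_eq]
  refine ⟨by omega, by omega, ?_⟩
  refine (Runs.while_range I (D.N * D.h) _ ?_ ?_ ?_).mono le_rfl fun s h => h.2.2.2
  · refine ⟨⟨by simp [hs.N_eq], by simp [hs.h_eq], by simp [hs.pow_eq], hs.imem_eq, hs.rmem_eq⟩,
      by simp, by simpa using hv, ho⟩
  · rintro t ht s ⟨hs, i3, r15, ho⟩
    refine ⟨by simp only [BExpr.Holds, IExpr.eval, i3, hs.N_eq, hs.h_eq]; omega, ?_⟩
    refine (Runs.seq (T₂ := 6) (runs_loadNode hf (by omega) (by omega) hw3 hs (by rwa [i3]))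
      ?_).mono (by omega) fun _ h => h
    rintro s₁ ⟨-, c0, c10, c2, c11, -, -, a1⟩
    rw [i3] at c0 c10 c2 c11
    have hs₁ := hs.of_agree a1 (by norm_num) (by norm_num) (by norm_num)
    have i3₁ : s₁.ireg 3 = t := by rw [a1.ireg 3 (by norm_num), i3]
    have r15₁ : s₁.rreg 15 = r t := by rw [a1.rreg 15 (by norm_num), r15]
    have o₁ : s₁.out = D.chosen d t := by rw [a1.out, ho]
    obtain ⟨hd2, h3⟩ := hd t ht
    obtain ⟨hr0, hr1⟩ := hr (t + 1) ht
    have hlines : ∀ (f : ℕ → ℝ) (o : List (Pt × Pt)),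
        HoldsLines D ⟨Function.update s₁.ireg 3 (t + 1), f, s₁.imem, s₁.rmem, o⟩ := fun f o =>
      ⟨by simp [hs₁.N_eq], by simp [hs₁.h_eq], by simp [hs₁.pow_eq], hs₁.imem_eq, hs₁.rmem_eq⟩
    refine Runs.of_wp_le (by decide) ?_
    simp only [wp, IExpr.eval, RExpr.eval, BExpr.Holds, r15₁, i3₁]
    -- the integer part of `3 * r t` is the decision
    have hcases : d t = 0 ∨ d t = 1 ∨ d t = 2 := by omega
    simp only [Function.update_self, Rat.cast_ofNat, Rat.cast_one, h3]
    refine ⟨fun h2 => ?_, fun h2 => ⟨fun h1 => ?_, fun h1 => ?_⟩⟩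
    · have hdt : d t = 2 := by
        rcases hcases with h | h | h
        · rw [h] at h2; norm_num at h2; linarith
        · rw [h] at h2; norm_num at h2; linarith
        · exact h
      refine ⟨by omega, hlines _ _, by simp, by simp [hdt], ?_⟩
      simp [Sweep.chosen, hdt, Sweep.parentPt, Sweep.pt, o₁, c10, c2, c11]
    · have hdt : d t = 1 := by
        rcases hcases with h | h | h
        · rw [h] at h1; norm_num at h1; linarith
        · exact h
        · rw [h] at h2; norm_num at h2; linarith
      refine ⟨by omega, hlines _ _, by simp, by simp [hdt], ?_⟩
      simp [Sweep.chosen, hdt, Sweep.parentPt, Sweep.pt, o₁, c0, c10, c2]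
    · have hdt : d t = 0 := by
        rcases hcases with h | h | h
        · exact h
        · rw [h] at h1; norm_num at h1; linarith
        · rw [h] at h2; norm_num at h2; linarith
      refine ⟨by omega, hlines _ _, by simp, by simp [hdt], ?_⟩
      simp [Sweep.chosen, hdt, o₁]
  · rintro s ⟨hs, i3, -⟩
    simp only [BExpr.Holds, IExpr.eval, i3, hs.N_eq, hs.h_eq]
    omega

/-- The algorithm is correct if it has access to the terminals in lexicographic order. -/
theorem computesRSFA_sweepProg {P R : Finset Pt} (hI : IsInstance P R) {D : Sweep}
    (hD : D.Valid P R) (hL : HasLines inp D) {fetch : Prog} {TF : ℕ}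
    (hf : Fetches inp cap word D fetch TF) (hcap : 3 * 2 ^ D.h ≤ cap)
    (hword : 2 * D.N * 2 ^ D.h ≤ word) :
    ComputesRSFA (sweepProg fetch) inp P R (200 * (TF + 1) * (D.N * D.h * 2 ^ D.h)) cap word := by
  have hN := hD.N_pos hI
  have hh := hD.h_pos hI
  have hlt : D.h < 2 ^ D.h := Nat.lt_two_pow_self
  have hw1 : 2 * 2 ^ D.h ≤ word := by
    refine le_trans ?_ hword
    rw [mul_right_comm]
    exact Nat.le_mul_of_pos_right _ hN
  have hw2 : D.N ≤ word := by
    have : D.N ≤ D.N * 2 ^ D.h := Nat.le_mul_of_pos_right _ (by positivity)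
    rw [mul_assoc] at hword
    omega
  obtain ⟨r, d, hr0, hd, hr, F, hF, hopt⟩ := Sweep.exists_optimal_decisions hI hD
  have hrun := (runs_listLines (cap := cap) (word := word) hL (by omega) (by omega) hw2).seq
    fun s h => (runs_backward hf hh hcap hword hN (fun t ht => hD.dx_nonneg ht) h.1 h.2.1 h.2.2).seq
      fun s h => runs_forward hf hcap hword hN hh hd hr h.1 (h.2.1.2.trans hr0.symm) h.2.2
  obtain ⟨t, s, h1, h2, h3⟩ := hrun
  refine ⟨t, s, F, h1, h2.trans ?_, by rw [h3]; exact hF, hopt⟩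
  -- the bound holds coefficientwise in `D.N - 1`, `D.h - 1`, `2 ^ D.h - 1` and `TF`
  obtain ⟨n, hn⟩ : ∃ n, D.N = n + 1 := ⟨D.N - 1, by omega⟩
  obtain ⟨m, hm⟩ : ∃ m, D.h = m + 1 := ⟨D.h - 1, by omega⟩
  obtain ⟨k, hk⟩ : ∃ k, 2 ^ D.h = k + 1 := ⟨2 ^ D.h - 1, by omega⟩
  rw [hk, hm, hn]
  ring_nf
  linarith [Nat.zero_le m, Nat.zero_le n, Nat.zero_le k, Nat.zero_le TF, Nat.zero_le (m * n),
    Nat.zero_le (m * n * TF), Nat.zero_le (m * n * TF * k), Nat.zero_le (m * n * k),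
    Nat.zero_le (m * TF), Nat.zero_le (m * TF * k), Nat.zero_le (m * k), Nat.zero_le (n * TF),
    Nat.zero_le (n * TF * k), Nat.zero_le (n * k), Nat.zero_le (TF * k)]

/-! ### The sweep of a sorted list of terminals -/

/-- The sweep that visits the terminals in the order of the list `L`, along the horizontal lines
through `P ∪ R`. -/
noncomputable def Sweep.ofList (L : List (Pt × Bool)) (P R : Finset Pt) : Sweep where
  N := L.length
  h := numHorizontalLines P R
  X i := (L.getD i ((0, 0), false)).1.1
  Z i := (L.getD i ((0, 0), false)).1.2
  isRoot i := (L.getD i ((0, 0), false)).2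
  Y j := (((P ∪ R).image Prod.snd).sort (· ≤ ·)).getD j 0

variable {P R : Finset Pt} {L : List (Pt × Bool)}

lemma Presents.mem_iff (hL : Presents L P R) (p : Pt) :
    (∃ b, (p, b) ∈ L) ↔ p ∈ P ∪ R := by
  rw [Finset.mem_union, ← (hL.2 p).1, ← (hL.2 p).2, Bool.exists_bool]

lemma Presents.fst_injOn (hL : Presents L P R) (hI : IsInstance P R) {a b : Pt × Bool} (ha : a ∈ L)
    (hb : b ∈ L) (hab : a.1 = b.1) : a = b := by
  have key : ∀ p, (p, false) ∈ L → (p, true) ∈ L → False := fun p h1 h2 =>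
    Finset.disjoint_left.1 hI.disjoint ((hL.2 p).1.1 h1) ((hL.2 p).2.1 h2)
  obtain ⟨p, x⟩ := a
  obtain ⟨q, y⟩ := b
  obtain rfl : p = q := hab
  cases x <;> cases y
  · rfl
  · exact (key p ha hb).elim
  · exact (key p hb ha).elim
  · rfl

lemma Presents.length_eq (hL : Presents L P R) (hI : IsInstance P R) :
    L.length = P.card + R.card := by
  have hmap : (L.map Prod.fst).Nodup :=
    hL.1.map_on fun a ha b hb hab => hL.fst_injOn hI ha hb hab
  rw [← Finset.card_union_of_disjoint hI.disjoint, ← List.length_map (f := Prod.fst) (as := L),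
    ← List.toFinset_card_of_nodup hmap]
  congr 1
  ext p
  rw [← hL.mem_iff p]
  simp

lemma Sweep.ofList_Y_lt (j j' : ℕ) (h : j < j') (h' : j' < (Sweep.ofList L P R).h) :
    (Sweep.ofList L P R).Y j < (Sweep.ofList L P R).Y j' := by
  have hlen : (((P ∪ R).image Prod.snd).sort (· ≤ ·)).length = (Sweep.ofList L P R).h :=
    Finset.length_sort _
  simp only [Sweep.ofList]
  rw [List.getD_eq_getElem _ _ (by omega), List.getD_eq_getElem _ _ (by omega)]
  exact List.pairwise_iff_getElem.1 (Finset.sortedLT_sort ((P ∪ R).image Prod.snd)).pairwise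
    j j' _ _ h

lemma Sweep.exists_ofList_Y_eq_iff (y : ℝ) :
    (∃ j < (Sweep.ofList L P R).h, (Sweep.ofList L P R).Y j = y) ↔ ∃ p ∈ P ∪ R, p.2 = y := by
  have hlen : (((P ∪ R).image Prod.snd).sort (· ≤ ·)).length = (Sweep.ofList L P R).h :=
    Finset.length_sort _
  have hmem := Finset.mem_sort (s := (P ∪ R).image Prod.snd) (a := y) (· ≤ ·)
  rw [Finset.mem_image] at hmem
  rw [← hmem, List.mem_iff_getElem, ← hlen]
  refine exists_congr fun j => ⟨fun ⟨h1, h2⟩ => ⟨h1, ?_⟩, fun ⟨h1, h2⟩ => ⟨h1, ?_⟩⟩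
  · rw [← h2]
    simp only [Sweep.ofList, List.getD_eq_getElem _ _ h1]
  · rw [← h2]
    simp only [Sweep.ofList, List.getD_eq_getElem _ _ h1]

lemma Sweep.exists_ofList_eq_iff (p : Pt) (b : Bool) :
    (∃ i < (Sweep.ofList L P R).N, (Sweep.ofList L P R).isRoot i = b ∧
      ((Sweep.ofList L P R).X i, (Sweep.ofList L P R).Z i) = p) ↔ (p, b) ∈ L := by
  rw [List.mem_iff_getElem]
  refine exists_congr fun i => ⟨fun ⟨h1, h2, h3⟩ => ⟨h1, ?_⟩, fun ⟨h1, h2⟩ => ⟨h1, ?_⟩⟩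
  · have h1' : i < L.length := h1
    simp only [Sweep.ofList, List.getD_eq_getElem _ _ h1'] at h2 h3
    exact Prod.ext h3 h2
  · simp only [Sweep.ofList, List.getD_eq_getElem _ _ h1, h2, and_self]

lemma Sweep.valid_ofList (hL : Presents L P R) (hs : LexSorted L) :
    (Sweep.ofList L P R).Valid P R where
  lex i i' h h' := by
    have h1' : i' < L.length := h'
    have h1 : i < L.length := by omega
    have := List.pairwise_iff_getElem.1 hs i i' h1 h1' h
    simpa only [Sweep.ofList, List.getD_eq_getElem _ _ h1, List.getD_eq_getElem _ _ h1']
  Y_lt := Sweep.ofList_Y_lt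
  row i hi := by
    rw [Sweep.exists_ofList_Y_eq_iff]
    have := (Sweep.exists_ofList_eq_iff (L := L) (P := P) (R := R) _ _).1 ⟨i, hi, rfl, rfl⟩
    exact ⟨_, (hL.mem_iff _).1 ⟨_, this⟩, rfl⟩
  row_used j hj := by
    obtain ⟨p, hp, hY⟩ := (Sweep.exists_ofList_Y_eq_iff (L := L) (P := P) (R := R) _).1 ⟨j, hj, rfl⟩
    obtain ⟨b, hb⟩ := (hL.mem_iff p).2 hp
    obtain ⟨i, hi, -, h⟩ := (Sweep.exists_ofList_eq_iff (L := L) (P := P) (R := R) _ _).2 hb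
    exact ⟨i, hi, by rw [← hY, ← h]⟩
  mem_P q := by rw [Sweep.exists_ofList_eq_iff, (hL.2 q).1]
  mem_R q := by rw [Sweep.exists_ofList_eq_iff, (hL.2 q).2]

lemma Sweep.hasLines_ofList (hI : IsInstance P R) (hinp : Presents inp P R)
    (hlen : inp.length = L.length) : HasLines inp (Sweep.ofList L P R) where
  length_eq := hlen
  Y_nonneg j hj := by
    obtain ⟨p, hp, hY⟩ := (Sweep.exists_ofList_Y_eq_iff (L := L) (P := P) (R := R) _).1 ⟨j, hj, rfl⟩
    rw [← hY]
    exact (hI.quadrant p hp).2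
  Y_lt := Sweep.ofList_Y_lt
  row q hq := (Sweep.exists_ofList_Y_eq_iff _).2 ⟨q.1, (hinp.mem_iff _).1 ⟨q.2, hq⟩, rfl⟩
  row_used j hj := by
    obtain ⟨p, hp, hY⟩ := (Sweep.exists_ofList_Y_eq_iff (L := L) (P := P) (R := R) _).1 ⟨j, hj, rfl⟩
    obtain ⟨b, hb⟩ := (hinp.mem_iff p).2 hp
    exact ⟨_, hb, hY⟩

lemma numHorizontalLines_le (hI : IsInstance P R) : numHorizontalLines P R ≤ P.card + R.card := by
  rw [← Finset.card_union_of_disjoint hI.disjoint]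
  exact Finset.card_image_le

/-- An instance with a list of all its terminals also has a sorted one. -/
lemma Presents.exists_lexSorted (hI : IsInstance P R) (hinp : Presents inp P R) :
    ∃ L : List (Pt × Bool), L.Perm inp ∧ Presents L P R ∧ LexSorted L := by
  classical
  let r : Pt × Bool → Pt × Bool → Prop := fun a b => toLex a.1 ≤ toLex b.1
  have : Std.Total r := ⟨fun a b => le_total (toLex a.1) (toLex b.1)⟩
  have : IsTrans _ r := ⟨fun a b c => le_trans (a := toLex a.1)⟩
  have hp := List.perm_insertionSort r inp
  have hL : Presents (inp.insertionSort r) P R :=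
    ⟨hp.nodup_iff.2 hinp.1, fun q => by rw [hp.mem_iff, hp.mem_iff]; exact hinp.2 q⟩
  refine ⟨_, hp, hL, ?_⟩
  refine ((List.pairwise_insertionSort r inp).and hL.1).imp_of_mem fun {a b} ha hb hab => ?_
  refine Prod.Lex.toLex_lt_toLex.1 (lt_of_le_of_ne hab.1 fun h => ?_)
  exact hab.2 (hL.fst_injOn hI ha hb (toLex.injective h))

/-! ### Access to the terminals in lexicographic order -/

/-- Load a terminal of a sorted input. -/
def fetchSorted : Prog :=
  .inputX 20 (.reg 20) ;; .inputY 21 (.reg 20) ;; .inputRoot 21 (.reg 20)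

lemma fetches_fetchSorted (hword : 1 ≤ word) :
    Fetches inp cap word (Sweep.ofList inp P R) fetchSorted 3 := by
  intro s hs
  have hs' : s.ireg 20 < inp.length := hs
  refine Runs.of_wp_le (by decide) ?_
  simp only [fetchSorted, wp, IExpr.eval]
  refine ⟨hs', hs', hs', hword, ?_⟩
  simp only [Sweep.ofList, List.getD_eq_getElem _ _ hs']
  refine ⟨by simp, by simp, by simp, fun k hk => ?_, fun k hk => ?_, rfl, rfl, rfl⟩
  · exact Function.update_of_ne (by omega) _ _
  · simp only
    rw [Function.update_of_ne (by omega), Function.update_of_ne (by omega)]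

/-- Count the input points that are lexicographically less than the point in the real registers 22 and
23; integer register 25 holds the number of input points, and the count is put into integer register
24. -/
def countBelow : Prog :=
  (.iset 23 (.const 0) ;; .iset 24 (.const 0)) ;;
  .while (.ile (.add (.reg 23) (.const 1)) (.reg 25)) (
    .inputX 24 (.reg 23) ;; .inputY 25 (.reg 23) ;;
    .ite (.and (.rle (.reg 24) (.reg 22))
        (.not (.and (.rle (.reg 22) (.reg 24)) (.rle (.reg 23) (.reg 25)))))
      (.iset 24 (.add (.reg 24) (.const 1))) .skip ;;
    .iset 23 (.add (.reg 23) (.const 1)))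

/-- Load the terminal with a given index in the lexicographic order, from an input in any order: look
for the terminal with the right number of lexicographically smaller terminals. -/
def fetchUnsorted : Prog :=
  (.inputLength 25 ;; .iset 22 (.const 0)) ;;
  .while (.ile (.add (.reg 22) (.const 1)) (.reg 25)) (
    (.inputX 22 (.reg 22) ;; .inputY 23 (.reg 22)) ;;
    countBelow ;;
    .ite (.and (.ile (.reg 24) (.reg 20)) (.ile (.reg 20) (.reg 24)))
      (.rset 20 (.reg 22) ;; .rset 21 (.reg 23) ;; .inputRoot 21 (.reg 22)) .skip ;;
    .iset 22 (.add (.reg 22) (.const 1)))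

open Classical in
/-- The number of terminals in the list `l` that are lexicographically less than the point `p`. -/
noncomputable def lexRank (l : List (Pt × Bool)) (p : Pt) : ℕ :=
  l.countP fun q => toLex q.1 < toLex p

lemma lexRank_append_singleton (l : List (Pt × Bool)) (q : Pt × Bool) (p : Pt) :
    lexRank (l ++ [q]) p =
      lexRank l p + open Classical in if toLex q.1 < toLex p then 1 else 0 := by
  simp [lexRank, List.countP_append, List.countP_singleton]

lemma lexRank_getElem (hs : LexSorted L) {i : ℕ} (hi : i < L.length) : lexRank L L[i].1 = i := by
  classical
  have hpw := List.pairwise_iff_getElem.1 hs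
  have h1 : lexRank (L.take i) L[i].1 = i := by
    have : lexRank (L.take i) L[i].1 = (L.take i).length := by
      rw [lexRank, List.countP_eq_length]
      intro a ha
      obtain ⟨k, hk, rfl⟩ := List.mem_iff_getElem.1 ha
      simp only [List.length_take] at hk
      simp only [List.getElem_take, decide_eq_true_eq, Prod.Lex.toLex_lt_toLex]
      exact hpw k i _ hi (by omega)
    rw [this, List.length_take]
    omega
  have h2 : lexRank (L.drop i) L[i].1 = 0 := by
    rw [lexRank, List.countP_eq_zero]
    intro a ha
    obtain ⟨k, hk, rfl⟩ := List.mem_iff_getElem.1 ha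
    simp only [List.length_drop] at hk
    simp only [List.getElem_drop, decide_eq_true_eq, not_lt]
    rcases Nat.eq_zero_or_pos k with rfl | hk0
    · simp
    · exact (Prod.Lex.toLex_lt_toLex.2 (hpw i (i + k) hi (by omega) (by omega))).le
  have h3 : ∀ p, lexRank L p = lexRank (L.take i) p + lexRank (L.drop i) p := fun p => by
    simp only [lexRank, ← List.countP_append, List.take_append_drop]
  rw [h3, h1, h2, add_zero]

/-- In an input with the sorted arrangement `L`, the `i`-th entry of `L` is the entry of rank `i`. -/
lemma lexRank_eq_iff (hp : L.Perm inp) (hs : LexSorted L) {i : ℕ} (hi : i < L.length)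
    {q : Pt × Bool} (hq : q ∈ inp) : lexRank inp q.1 = i ↔ q = L[i] := by
  have heq : ∀ p, lexRank inp p = lexRank L p := fun p => (hp.countP_eq _).symm
  rw [heq]
  constructor
  · rintro rfl
    obtain ⟨k, hk, rfl⟩ := List.mem_iff_getElem.1 (hp.mem_iff.2 hq)
    simp only [lexRank_getElem hs hk]
  · rintro rfl
    exact lexRank_getElem hs hi

lemma runs_countBelow (hN : inp.length ≤ word) {s : Store} (h25 : s.ireg 25 = inp.length) :
    Runs inp cap word countBelow s (inp.length * 6 + 3) fun s' =>
      s'.ireg 24 = lexRank inp (s.rreg 22, s.rreg 23) ∧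
      AgreeOn (fun k => k ≠ 23 ∧ k ≠ 24) (fun k => k < 24) s s' := by
  let I : ℕ → Store → Prop := fun n s' =>
    s'.ireg 23 = n ∧ s'.ireg 24 = lexRank (inp.take n) (s.rreg 22, s.rreg 23) ∧
      AgreeOn (fun k => k ≠ 23 ∧ k ≠ 24) (fun k => k < 24) s s'
  refine (Runs.wp_seq (T := inp.length * 6 + 1) ?_).mono (by simp [Prog.steps]; omega) fun _ h => h
  simp only [wp, IExpr.eval]
  refine ⟨by omega, by omega, ?_⟩
  refine (Runs.while_range I inp.length 5 ?_ ?_ ?_).mono le_rfl ?_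
  · refine ⟨by simp, by simp [lexRank], ⟨fun k hk => ?_, fun _ _ => rfl, rfl, rfl, rfl⟩⟩
    simp [Function.update_of_ne hk.1, Function.update_of_ne hk.2]
  · rintro n hn s' ⟨i23, i24, ha⟩
    have i25 : s'.ireg 25 = inp.length := by rw [ha.ireg 25 (by omega), h25]
    have r22 := ha.rreg 22 (by omega)
    have r23 := ha.rreg 23 (by omega)
    have htake : inp.take (n + 1) = inp.take n ++ [inp[n]] := by simp
    have hle : lexRank (inp.take n) (s.rreg 22, s.rreg 23) ≤ n :=
      List.countP_le_length.trans (by simp)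
    refine ⟨by simp only [BExpr.Holds, IExpr.eval]; omega, Runs.of_wp_le (by decide) ?_⟩
    simp only [wp, IExpr.eval, RExpr.eval, BExpr.Holds, i23]
    refine ⟨hn, hn, ?_, ?_⟩
    · intro hc
      simp [r22, r23] at hc
      have hlt : toLex inp[n].1 < toLex (s.rreg 22, s.rreg 23) := by
        rw [Prod.Lex.toLex_lt_toLex]
        rcases hc.1.lt_or_eq with h | h
        · exact Or.inl h
        · exact Or.inr ⟨h, hc.2 h.ge⟩
      dsimp only [I]
      refine ⟨by omega, by simp [i23]; omega, by simp [i23], ?_, ⟨fun k hk => ?_, fun k hk => ?_,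
        ha.imem, ha.rmem, ha.out⟩⟩
      · rw [htake, lexRank_append_singleton, if_pos hlt]
        simp [i24]
      · simp [Function.update_of_ne hk.1, Function.update_of_ne hk.2, ha.ireg k hk]
      · simp only
        rw [Function.update_of_ne (by omega), Function.update_of_ne (by omega), ha.rreg k hk]
    · intro hc
      simp [r22, r23] at hc
      have hlt : ¬ toLex inp[n].1 < toLex (s.rreg 22, s.rreg 23) := by
        rw [Prod.Lex.toLex_lt_toLex]
        rintro (h | ⟨h, h'⟩)
        · exact absurd (hc h.le).1 (not_le.2 h)
        · exact absurd (hc h.le).2 (not_le.2 h')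
      dsimp only [I]
      refine ⟨by omega, by simp, ?_, ⟨fun k hk => ?_, fun k hk => ?_,
        ha.imem, ha.rmem, ha.out⟩⟩
      · rw [htake, lexRank_append_singleton, if_neg hlt]
        simp [i24]
      · simp [Function.update_of_ne hk.1, ha.ireg k hk]
      · simp only
        rw [Function.update_of_ne (by omega), Function.update_of_ne (by omega), ha.rreg k hk]
  · rintro s' ⟨i23, -, ha⟩
    have i25 : s'.ireg 25 = inp.length := by rw [ha.ireg 25 (by omega), h25]
    simp only [BExpr.Holds, IExpr.eval]
    omega
  · rintro s' ⟨-, h⟩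
    rwa [List.take_length] at h

/-- The entry of rank `i` is met exactly once, so that it is in the result registers at the end. -/
lemma fetches_fetchUnsorted (hp : L.Perm inp) (hs : LexSorted L) (hN : inp.length ≤ word) :
    Fetches inp cap word (Sweep.ofList L P R) fetchUnsorted
      (inp.length * (inp.length * 6 + 11) + 3) := by
  intro s hi
  obtain ⟨i, hi20⟩ : ∃ i, s.ireg 20 = i := ⟨_, rfl⟩
  rw [hi20] at hi
  have hi' : i < L.length := hi
  have hlen : L.length = inp.length := hp.length_eq
  let I : ℕ → Store → Prop := fun n s' =>
    s'.ireg 22 = n ∧ s'.ireg 25 = inp.length ∧ s'.ireg 20 = i ∧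
      (L[i] ∈ inp.take n → s'.rreg 20 = L[i].1.1 ∧ s'.rreg 21 = L[i].1.2 ∧
        s'.ireg 21 = L[i].2.toNat) ∧
      AgreeOn (· < 20) (· < 20) s s'
  refine (Runs.wp_seq (T := inp.length * (inp.length * 6 + 11) + 1) ?_).mono
    (by simp [Prog.steps]; omega) fun _ h => h
  simp only [wp, IExpr.eval]
  refine ⟨hN, by omega, ?_⟩
  refine (Runs.while_range I inp.length (inp.length * 6 + 10) ?_ ?_ ?_).mono le_rfl ?_
  · refine ⟨by simp, by simp, by simp [hi20], by simp, ⟨fun k hk => ?_, fun _ _ => rfl, rfl, rfl,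
      rfl⟩⟩
    simp only
    rw [Function.update_of_ne (by omega), Function.update_of_ne (by omega)]
  · rintro n hn s' ⟨i22, i25, i20, hfound, ha⟩
    refine ⟨by simp only [BExpr.Holds, IExpr.eval]; omega, ?_⟩
    refine (Runs.wp_seq (T := (inp.length * 6 + 3) + 5) ?_).mono (by simp [Prog.steps]; omega)
      fun _ h => h
    simp only [wp, IExpr.eval, i22]
    refine ⟨hn, hn, ?_⟩
    refine (runs_countBelow hN (by simpa using i25)).seq ?_
    rintro s₁ ⟨c24, hb⟩
    have e20 : s₁.ireg 20 = i := by rw [hb.ireg 20 (by omega)]; exact i20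
    have e21 : s₁.ireg 21 = s'.ireg 21 := hb.ireg 21 (by omega)
    have e22 : s₁.ireg 22 = n := by rw [hb.ireg 22 (by omega)]; exact i22
    have e25 : s₁.ireg 25 = inp.length := by rw [hb.ireg 25 (by omega)]; exact i25
    have f20 : s₁.rreg 20 = s'.rreg 20 := by rw [hb.rreg 20 (by omega)]; simp
    have f21 : s₁.rreg 21 = s'.rreg 21 := by rw [hb.rreg 21 (by omega)]; simp
    have f22 : s₁.rreg 22 = inp[n].1.1 := by rw [hb.rreg 22 (by omega)]; simp
    have f23 : s₁.rreg 23 = inp[n].1.2 := by rw [hb.rreg 23 (by omega)]; simp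
    have ha₁ : AgreeOn (· < 20) (· < 20) s s₁ := by
      refine ⟨fun k hk => ?_, fun k hk => ?_, hb.imem.trans ha.imem, hb.rmem.trans ha.rmem,
        hb.out.trans ha.out⟩
      · rw [hb.ireg k (by omega)]; exact ha.ireg k hk
      · rw [hb.rreg k (by omega)]
        simp only
        rw [Function.update_of_ne (by omega), Function.update_of_ne (by omega)]
        exact ha.rreg k hk
    have hrank : s₁.ireg 24 = i ↔ inp[n] = L[i] := by
      rw [← lexRank_eq_iff hp hs hi' (List.getElem_mem hn), c24]
      simp
    have htake : inp.take (n + 1) = inp.take n ++ [inp[n]] := by simp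
    refine Runs.of_wp_le (by decide) ?_
    simp only [wp, IExpr.eval, RExpr.eval, BExpr.Holds, e20]
    refine ⟨fun hc => ?_, fun hc => ?_⟩
    · have heq := hrank.1 (le_antisymm hc.1 hc.2)
      have hbool : inp[n].2.toNat ≤ 1 := Bool.toNat_le _
      refine ⟨by omega, by omega, by simp [e22]; omega, ?_⟩
      dsimp only [I]
      refine ⟨by simp [e22], by simp [e25], by simp [e20], fun _ => ?_, fun k hk => ?_,
        fun k hk => ?_, ha₁.imem, ha₁.rmem, ha₁.out⟩
      · simp [f22, f23, e22, heq]
      · simp only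
        rw [Function.update_of_ne (by omega), Function.update_of_ne (by omega), ha₁.ireg k hk]
      · simp only
        rw [Function.update_of_ne (by omega), Function.update_of_ne (by omega), ha₁.rreg k hk]
    · have hne : L[i] ≠ inp[n] := fun h => hc (by rw [hrank.2 h.symm]; exact ⟨le_rfl, le_rfl⟩)
      refine ⟨by omega, ?_⟩
      dsimp only [I]
      refine ⟨by simp [e22], by simp [e25], by simp [e20], fun hmem => ?_, fun k hk => ?_,
        ha₁.rreg, ha₁.imem, ha₁.rmem, ha₁.out⟩
      · rw [htake, List.mem_append, List.mem_singleton, or_iff_left hne] at hmem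
        have := hfound hmem
        simpa [f20, f21, e21] using this
      · simp only
        rw [Function.update_of_ne (by omega), ha₁.ireg k hk]
  · rintro s' ⟨i22, i25, -⟩
    simp only [BExpr.Holds, IExpr.eval]
    omega
  · rintro s' ⟨-, -, -, hfound, ha⟩
    rw [List.take_length] at hfound
    have := hfound (hp.mem_iff.1 (List.getElem_mem hi'))
    simp only [Sweep.ofList, hi20, List.getD_eq_getElem _ _ hi']
    exact ⟨this.1, this.2.1, this.2.2, ha⟩

lemma ComputesRSFA.mono {c : Prog} {time time' : ℕ}
    (h : ComputesRSFA c inp P R time cap word) (ht : time ≤ time') :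
    ComputesRSFA c inp P R time' cap word := by
  obtain ⟨t, s, F, h1, h2, h3⟩ := h
  exact ⟨t, s, F, h1, h2.trans ht, h3⟩

theorem mainTheorem3 :
    -- lexicographically sorted input: `O((n + m) h 2 ^ h)` time and `O(2 ^ h)` space, with
    -- integers of `O(log (n + m) + h)` bits
    (∃ (c : Prog) (C : ℕ), ∀ (P R : Finset Pt) (inp : List (Pt × Bool)) (n m h : ℕ),
      IsInstance P R → P.card = n → R.card = m → numHorizontalLines P R = h →
      Presents inp P R → LexSorted inp →
      ComputesRSFA c inp P R (C * ((n + m) * h * 2 ^ h)) (C * 2 ^ h) (C * ((n + m) * 2 ^ h))) ∧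
    -- input in any order: `2 ^ h` times a polynomial in `n + m`, so the problem is
    -- fixed-parameter tractable with respect to `h`
    (∃ (c : Prog) (C : ℕ), ∀ (P R : Finset Pt) (inp : List (Pt × Bool)) (n m h : ℕ),
      IsInstance P R → P.card = n → R.card = m → numHorizontalLines P R = h →
      Presents inp P R →
      ComputesRSFA c inp P R (C * (2 ^ h * (n + m) ^ C)) (C * (2 ^ h * (n + m) ^ C))
        (C * (2 ^ h * (n + m) ^ C))) := by
  constructor
  · -- an access takes three steps, and `800 = 200 * (3 + 1)`
    refine ⟨sweepProg fetchSorted, 800, ?_⟩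
    rintro P R inp _ _ _ hI rfl rfl rfl hinp hs
    have hlen := hinp.length_eq hI
    have hD := Sweep.valid_ofList hinp hs
    have hN : 0 < inp.length := hD.N_pos hI
    have h2 : 0 < 2 ^ numHorizontalLines P R := by positivity
    rw [← hlen]
    refine (computesRSFA_sweepProg hI hD (Sweep.hasLines_ofList hI hinp rfl)
      (fetches_fetchSorted ?_) ?_ ?_).mono ?_
    · have := Nat.mul_pos hN h2
      omega
    · exact Nat.mul_le_mul_right _ (by norm_num)
    · simp only [Sweep.ofList]
      rw [mul_assoc]
      exact Nat.mul_le_mul_right _ (by norm_num)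
    · simp only [Sweep.ofList]
      exact le_rfl
  · -- each access takes at most `21 * N ^ 2` steps, and `h ≤ N`, so `200 * 21 * N ^ 4 * 2 ^ h` steps suffice
    obtain ⟨C, hC⟩ : ∃ C, C = 4200 := ⟨_, rfl⟩
    refine ⟨sweepProg fetchUnsorted, C, ?_⟩
    rintro P R inp _ _ _ hI rfl rfl rfl hinp
    obtain ⟨L, hp, hL, hs⟩ := hinp.exists_lexSorted hI
    have hD := Sweep.valid_ofList hL hs
    have hhN := numHorizontalLines_le hI
    have hlen := hp.length_eq
    have hN : 1 ≤ inp.length := hlen ▸ hD.N_pos hI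
    rw [← hinp.length_eq hI] at hhN ⊢
    have hpow4 : inp.length ^ 4 ≤ inp.length ^ C := Nat.pow_le_pow_right hN (by omega)
    have hpow1 : inp.length ≤ inp.length ^ C := Nat.le_self_pow (by omega) _
    have h2 : 1 ≤ 2 ^ numHorizontalLines P R := Nat.one_le_two_pow
    have hword : 2 * inp.length * 2 ^ numHorizontalLines P R ≤
        C * (2 ^ numHorizontalLines P R * inp.length ^ C) := by
      rw [mul_assoc, mul_comm inp.length]
      exact Nat.mul_le_mul (by omega) (Nat.mul_le_mul_left _ hpow1)
    refine (computesRSFA_sweepProg hI hD (Sweep.hasLines_ofList hI hinp hlen.symm)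
      (fetches_fetchUnsorted hp hs ?_) ?_ ?_).mono ?_
    · refine le_trans ?_ hword
      nlinarith
    · rw [← mul_one (2 ^ (Sweep.ofList L P R).h)]
      exact Nat.mul_le_mul (by omega) (Nat.mul_le_mul_left _ (hN.trans hpow1))
    · simp only [Sweep.ofList, hlen]
      exact hword
    · simp only [Sweep.ofList, hlen]
      generalize inp.length = N at *
      generalize numHorizontalLines P R = h at *
      have hTF : N * (N * 6 + 11) + 3 + 1 ≤ 21 * N ^ 2 := by nlinarith
      calc 200 * (N * (N * 6 + 11) + 3 + 1) * (N * h * 2 ^ h)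
          ≤ 200 * (21 * N ^ 2) * (N * N * 2 ^ h) := by gcongr
        _ = 4200 * (2 ^ h * N ^ 4) := by ring
        _ ≤ C * (2 ^ h * N ^ C) := by rw [hC] at *; gcongr
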